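/- Let $0<r<1$ and $\alpha\ge\frac12$, and let $$\Omega=\{z\in\mathbb C:\ r<|z|<1,\ 0<\arg z<\pi/\alpha\}\qquad(\arg z\in[0,2\pi)).$$ Put $\varpi=e^{i\pi/\alpha}$, $\omega=re^{i\pi/\alpha}$. The boundary $\partial\Omega=[r,1]\cup\Gamma_1\cup[\varpi,\omega]\cup\Gamma_2$ is oriented counter-clockwise, where $\Gamma_1$ is the arc $e^{i\tau}$ with $\tau$ running from $0$ to $\pi/\alpha$, and $\Gamma_2$ is the arc $re^{i\tau}$ with $\tau$ running from $\pi/\alpha$ to $0$. Powers are $\zeta^{\beta}=s^{\beta}e^{i\beta\tau}$ for $\zeta=se^{i\tau}$, $0\le\tau\le\pi/\alpha$ (if $\alpha=\frac12$, then $\tau=0$ on $[r,1]$ and $\tau=2\pi$ on $[\varpi,\omega]$). Define $$H_1(z,\zeta)=\frac{\zeta+z}{\zeta-z}-\frac{\overline\zeta+z}{\overline\zeta-z}+2\sum_{n=1}^\infty r^{2\alpha n}\left[\frac{\zeta}{r^{2\alpha n}\zeta-z}-\frac{z}{r^{2\alpha n}z-\zeta}-\frac{\overline\zeta}{r^{2\alpha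 n}\overline\zeta-z}+\frac{z}{r^{2\alpha n}z-\overline\zeta}\right],$$ $$H_2(z,\zeta)=\frac1{\zeta-z}-\frac z{1-z\zeta}+\sum_{n=1}^\infty r^{2\alpha n}\left[\frac1{r^{2\alpha n}\zeta-z}-\frac{z}{\zeta(r^{2\alpha n}z-\zeta)}-\frac1{\zeta(r^{2\alpha n}-z\zeta)}+\frac{z}{r^{2\alpha n}z\zeta-1}\right].$$ Let $f\in L_p(\Omega;\mathbb C)$ with $p>2$, let $\gamma\in C(\partial\Omega;\mathbb R)$ and $c\in\mathbb R$. Consider the Schwarz problem of finding a continuous $w:\Omega\to\mathbb C$ with $$w_{\bar z}=f\ \text{ in }\Omega,\qquad \operatorname{Re}w=\gamma\ \text{ on }\partial\Omega,\qquad \frac{\alpha}{\pi i}\int_{\Gamma_1}\frac{\operatorname{Im}w(\zeta)}{\zeta}\,d\zeta=c .$$ Here the equation is understood in the sense of distributions; the second condition means $\lim_{z\in\Omega,\,z\to t}\operatorname{Re}w(z)=\gamma(t)$ for every $t\in\partial\Omega$; and in the third condition $\operatorname{Im}w$ on $\Gamma_1$ is the $L^1$ boundary value, that is, an integrable function $v$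 on $(0,\pi/\alpha)$, standing for $\operatorname{Im}w(e^{i\tau})$, with $\int_0^{\pi/\alpha}|\operatorname{Im}w(se^{i\tau})-v(\tau)|\,d\tau\to0$ as $s\to1^-$, whose existence is part of the condition. Then this problem has exactly one solution, namely $$\begin{aligned}w(z)={}&\frac{\alpha}{2\pi i}\int_{\Gamma_1\cup\Gamma_2}\gamma(\zeta)H_1(z^\alpha,\zeta^\alpha)\frac{d\zeta}{\zeta}+\frac{\alpha}{\pi i}\int_{[\varpi,\omega]\cup[r,1]}\gamma(\zeta)H_2(z^\alpha,\zeta^\alpha)\zeta^{\alpha-1}\,d\zeta+ic\\&-\frac{\alpha}{\pi}\iint_\Omega\Big[\zeta^{\alpha-1}H_2(z^\alpha,\zeta^\alpha)f(\zeta)-\overline{\zeta^{\alpha-1}}\,H_2(z^\alpha,\overline{\zeta^\alpha})\,\overline{f(\zeta)}\Big]\,d\xi\,d\eta,\qquad z\in\Omega,\ \zeta=\xi+i\eta,\end{aligned}$$ and all the series and integrals in this formula converge absolutely for every $z\in\Omega$. -/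

import Mathlib

open scoped ENNReal Topology ContDiff
open MeasureTheory Filter

noncomputable section

namespace SectorRing

/-- The argument of `z` normalised to lie in `[0, 2π)`. -/
def argPos (z : ℂ) : ℝ :=
  if 0 ≤ Complex.arg z then Complex.arg z else Complex.arg z + 2 * Real.pi

/-- The sector ring `Ω = {r < |z| < 1, 0 < arg z < π / α}`, as an open subset of the plane. -/
def domain (r α : ℝ) : Set ℂ :=
  {z : ℂ | r < ‖z‖ ∧ ‖z‖ < 1 ∧ 0 < argPos z ∧ argPos z < Real.pi / α}

/-- The point `ζ = s e^{iτ}`. -/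
def polarPt (s τ : ℝ) : ℂ := (s : ℂ) * Complex.exp (τ * Complex.I)

/-- The branch `s ^ β * e^{iβτ}` of `ζ ^ β` at the point `ζ = s e^{iτ}`, for `s > 0`.  The angle is
kept as an argument so that the two sides of the slit are distinguished when `α = 1 / 2`. -/
def polarPow (β s τ : ℝ) : ℂ :=
  ((s ^ β : ℝ) : ℂ) * Complex.exp (((β * τ : ℝ) : ℂ) * Complex.I)

/-- The branch of `z ^ β` on the sector ring: the argument is taken in `[0, 2π)`. -/
def branchPow (β : ℝ) (z : ℂ) : ℂ := polarPow β ‖z‖ (argPos z)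

/-- The summand with index `n` of the series in the kernel `H₁`. -/
def H1term (r α : ℝ) (z ζ : ℂ) (n : ℕ) : ℂ :=
  let k : ℂ := ((r ^ (2 * α * n) : ℝ) : ℂ)
  let ζ' : ℂ := starRingEnd ℂ ζ
  k * (ζ / (k * ζ - z) - z / (k * z - ζ) - ζ' / (k * ζ' - z) + z / (k * z - ζ'))

/-- The summand with index `n` of the series in the kernel `H₂`. -/
def H2term (r α : ℝ) (z ζ : ℂ) (n : ℕ) : ℂ :=
  let k : ℂ := ((r ^ (2 * α * n) : ℝ) : ℂ)
  k * (1 / (k * ζ - z) - z / (ζ * (k * z - ζ)) - 1 / (ζ * (k - z * ζ)) + z / (k * z * ζ - 1))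

/-- The kernel `H₁(z, ζ)`; the series runs over `n ≥ 1`. -/
def H1 (r α : ℝ) (z ζ : ℂ) : ℂ :=
  (ζ + z) / (ζ - z) - (starRingEnd ℂ ζ + z) / (starRingEnd ℂ ζ - z)
    + 2 * ∑' n : ℕ, H1term r α z ζ (n + 1)

/-- The kernel `H₂(z, ζ)`; the series runs over `n ≥ 1`. -/
def H2 (r α : ℝ) (z ζ : ℂ) : ℂ :=
  1 / (ζ - z) - z / (1 - z * ζ) + ∑' n : ℕ, H2term r α z ζ (n + 1)

/-- The line integral `∫ F(ζ) dζ` along the circular arc `ζ = s e^{iτ}`, `τ` running from `a` to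
`b`.  The integrand is given as a function `F s τ` of the polar coordinates of `ζ`. -/
def arcIntegral (F : ℝ → ℝ → ℂ) (s a b : ℝ) : ℂ :=
  ∫ τ in a..b, F s τ * (Complex.I * polarPt s τ)

/-- The line integral `∫ F(ζ) dζ` along the segment `ζ = s e^{iτ}`, `s` running from `a` to `b`. -/
def rayIntegral (F : ℝ → ℝ → ℂ) (τ a b : ℝ) : ℂ :=
  ∫ s in a..b, F s τ * Complex.exp (τ * Complex.I)

/-- The integrand `γ(ζ) H₁(z^α, ζ^α) / ζ` at `ζ = s e^{iτ}`. -/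
def arcIntegrand (r α : ℝ) (γ : ℂ → ℝ) (z : ℂ) (s τ : ℝ) : ℂ :=
  (γ (polarPt s τ) : ℂ) * H1 r α (branchPow α z) (polarPow α s τ) / polarPt s τ

/-- The integrand `γ(ζ) H₂(z^α, ζ^α) ζ^{α-1}` at `ζ = s e^{iτ}`. -/
def rayIntegrand (r α : ℝ) (γ : ℂ → ℝ) (z : ℂ) (s τ : ℝ) : ℂ :=
  (γ (polarPt s τ) : ℂ) * H2 r α (branchPow α z) (polarPow α s τ) * polarPow (α - 1) s τ

/-- The integrand of the area integral. -/
def areaIntegrand (r α : ℝ) (f : ℂ → ℂ) (z ζ : ℂ) : ℂ :=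
  branchPow (α - 1) ζ * H2 r α (branchPow α z) (branchPow α ζ) * f ζ
    - starRingEnd ℂ (branchPow (α - 1) ζ)
      * H2 r α (branchPow α z) (starRingEnd ℂ (branchPow α ζ)) * starRingEnd ℂ (f ζ)

/-- The explicit formula.  `Γ₁` is the arc `|ζ| = 1` with `τ` from `0` to `π/α`, `Γ₂` the arc
`|ζ| = r` with `τ` from `π/α` to `0`, `[ϖ, ω]` the segment on the ray `τ = π/α` traversed from
`s = 1` to `s = r`, and `[r, 1]` the segment on the ray `τ = 0`. -/
def formula (r α : ℝ) (f : ℂ → ℂ) (γ : ℂ → ℝ) (c : ℝ) (z : ℂ) : ℂ :=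
  (α / (2 * Real.pi * Complex.I) : ℂ)
      * (arcIntegral (arcIntegrand r α γ z) 1 0 (Real.pi / α)
        + arcIntegral (arcIntegrand r α γ z) r (Real.pi / α) 0)
    + (α / (Real.pi * Complex.I) : ℂ)
      * (rayIntegral (rayIntegrand r α γ z) (Real.pi / α) 1 r
        + rayIntegral (rayIntegrand r α γ z) 0 r 1)
    + Complex.I * c
    - (α / Real.pi : ℂ) * ∫ ζ in domain r α, areaIntegrand r α f z ζ

/-- All the series and all the integrals in `formula` at the point `z` converge absolutely. -/
def FormulaConverges (r α : ℝ) (f : ℂ → ℂ) (γ : ℂ → ℝ) (z : ℂ) : Prop :=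
  (∀ s ∈ Set.Icc r 1, ∀ τ ∈ Set.Icc 0 (Real.pi / α),
    Summable (fun n : ℕ => H1term r α (branchPow α z) (polarPow α s τ) (n + 1)) ∧
    Summable (fun n : ℕ => H2term r α (branchPow α z) (polarPow α s τ) (n + 1)) ∧
    Summable (fun n : ℕ =>
      H2term r α (branchPow α z) (starRingEnd ℂ (polarPow α s τ)) (n + 1))) ∧
  IntervalIntegrable (fun τ => arcIntegrand r α γ z 1 τ) volume 0 (Real.pi / α) ∧
  IntervalIntegrable (fun τ => arcIntegrand r α γ z r τ) volume 0 (Real.pi / α) ∧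
  IntervalIntegrable (fun s => rayIntegrand r α γ z s (Real.pi / α)) volume r 1 ∧
  IntervalIntegrable (fun s => rayIntegrand r α γ z s 0) volume r 1 ∧
  IntegrableOn (areaIntegrand r α f z) (domain r α)

/-- The Wirtinger derivative `∂φ/∂z̄` of a real-differentiable function. -/
def dbar (φ : ℂ → ℂ) (z : ℂ) : ℂ :=
  (1 / 2 : ℂ) * (fderiv ℝ φ z 1 + Complex.I * fderiv ℝ φ z Complex.I)

/-- `w_z̄ = f` in the open set `U`, in the sense of weak (distributional) derivatives. -/
def HasWeakDbar (U : Set ℂ) (w f : ℂ → ℂ) : Prop :=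
  ∀ φ : ℂ → ℂ, ContDiff ℝ ∞ φ → HasCompactSupport φ → tsupport φ ⊆ U →
    ∫ z in U, w z * dbar φ z = - ∫ z in U, f z * φ z

/-- `v` (a function of the angle `τ`) is the boundary value of `Im w` on `Γ₁`, as an `L¹` trace:
`v` is integrable and `Im w (s e^{iτ}) → v τ` in `L¹(0, π/α)` as `s → 1⁻`. -/
def IsImTrace (α : ℝ) (w : ℂ → ℂ) (v : ℝ → ℝ) : Prop :=
  IntegrableOn v (Set.Ioo 0 (Real.pi / α)) ∧
  Tendsto (fun s : ℝ => eLpNorm (fun τ : ℝ => (w (polarPt s τ)).im - v τ) 1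
    (volume.restrict (Set.Ioo 0 (Real.pi / α)))) (𝓝[<] 1) (𝓝 0)

/-- `w` solves the Schwarz problem `w_z̄ = f` in `Ω`, `Re w = γ` on `∂Ω`,
`(α / πi) ∫_{Γ₁} Im w(ζ) dζ / ζ = c`. -/
structure IsSolution (r α : ℝ) (f : ℂ → ℂ) (γ : ℂ → ℝ) (c : ℝ) (w : ℂ → ℂ) : Prop where
  continuousOn : ContinuousOn w (domain r α)
  equation : HasWeakDbar (domain r α) w f
  boundary : ∀ t ∈ frontier (domain r α),
    Tendsto (fun z => (w z).re) (𝓝[domain r α] t) (𝓝 (γ t))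
  normalization : ∃ v : ℝ → ℝ, IsImTrace α w v ∧
    (α / (Real.pi * Complex.I) : ℂ)
      * arcIntegral (fun s τ => (v τ : ℂ) / polarPt s τ) 1 0 (Real.pi / α) = c

end SectorRing

end

/-!
The map `u ↦ e^{u/α}` (`expMap`) takes the rectangle `Q = (-L, 0) × (0, π)`, `L = -α log r`, onto the
sector ring, and for `α = 1 / 2` it separates the two sides of the slit.  In the coordinate `u` the
kernels `H₁` and `H₂` become one elliptic kernel `kerK L u v = 1 + (kerP L (u - v) - kerP L (u + v)) / 2`,
where `kerP` is odd, `2πi`-periodic, changes by a constant under translation by `2L`, and has the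
single pole `-2 / X` modulo periods.  The formula turns into `bdOp + ic + areaPot` (`formula_expMap`),
and it remains to solve the Schwarz problem in the rectangle.

*The area potential.*  The density lies in `L^p` with `p > 2`, and the kernel is locally in the
conjugate space, so the potential is a convolution and continuous up to the boundary
(`continuousOn_areaPot`).  The residue of the kernel, through the Cauchy–Pompeiu formula and Fubini's
theorem, gives its weak equation (`hasWeakDbar_areaPot`).  The symmetry of the kernel under reflection
in the sides of `Q` makes its real part vanish on `∂Q` (`areaPot_re_eq_zero`).

*The boundary operator.*  The residue theorem for `kerK` on `Q`, combined with the same reflection,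
yields the Schwarz representation of holomorphic functions (`eq_bdOp_add`).  Let `G` be smooth.  Then
`G` minus the area potential of its `z̄`-derivative is holomorphic by Weyl's lemma, so by the
representation it is `bdOp L G`.  This shows that `bdOp` attains smooth data continuously, and the
maximum principle for the real part extends this to continuous data (`tendsto_re_bdOp`).

*The trace of the imaginary part.*  For merely continuous data the imaginary part need not extend
continuously, but it is bounded in `L¹` over vertical lines by the supremum of the data
(`exists_eLpNorm_im_bdOp_le`).  The horizontal sides contribute an integrable kernel and the left side
a bounded one.  The contribution `a` of the right side is periodic and holomorphic with bounded real
part, and by M. Riesz' argument the mean of `a²` is the same over all vertical lines, which bounds the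
mean of `(Im a)²`.  Approximation by smooth data then produces the trace and shows that its mean is
zero (`exists_trace_bdOp`).

*Uniqueness.*  The difference of two solutions is holomorphic by Weyl's lemma, and its real part tends
to zero at the boundary.  The maximum modulus principle for its exponential shows that it is an
imaginary constant, and the normalization makes the constant zero (`IsSolution.eqOn`).
-/

noncomputable section

namespace SectorRing

/-! ### The Wirtinger derivative: integration by parts and the Cauchy–Pompeiu formula -/

lemma realLinear_apply_eq (T : ℂ →L[ℝ] ℂ) (z : ℂ) :
    T z = z.re * T 1 + z.im * T Complex.I := by
  conv_lhs => rw [show z = z.re • (1 : ℂ) + z.im • Complex.I by simp]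
  rw [map_add, map_smul, map_smul, Complex.real_smul, Complex.real_smul]

lemma dbar_of_differentiableAt {h : ℂ → ℂ} {z : ℂ} (hh : DifferentiableAt ℂ h z) :
    dbar h z = 0 := by
  have h1 : fderiv ℝ h z = (fderiv ℂ h z).restrictScalars ℝ :=
    (hh.hasFDerivAt.restrictScalars ℝ).fderiv
  have h2 : fderiv ℂ h z Complex.I = Complex.I * fderiv ℂ h z 1 := by
    simp
  simp only [dbar, h1, ContinuousLinearMap.coe_restrictScalars', h2, ← mul_assoc, Complex.I_mul_I]
  ring

lemma dbar_mul {g h : ℂ → ℂ} {z : ℂ} (hg : DifferentiableAt ℝ g z) (hh : DifferentiableAt ℝ h z) :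
    dbar (fun u => g u * h u) z = dbar g z * h z + g z * dbar h z := by
  simp only [dbar, fderiv_fun_mul hg hh, add_apply, smul_apply, smul_eq_mul]
  ring

lemma dbar_congr {g h : ℂ → ℂ} {z : ℂ} (hgh : g =ᶠ[𝓝 z] h) : dbar g z = dbar h z := by
  simp only [dbar, hgh.fderiv_eq]

lemma dbar_eq_zero_of_notMem_tsupport {φ : ℂ → ℂ} {z : ℂ} (hz : z ∉ tsupport φ) :
    dbar φ z = 0 := by
  simp [dbar, fderiv_of_notMem_tsupport (𝕜 := ℝ) hz]

lemma continuous_dbar {φ : ℂ → ℂ} (hφ : ContDiff ℝ 1 φ) : Continuous (dbar φ) := by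
  have h := hφ.continuous_fderiv one_ne_zero
  unfold dbar
  fun_prop

lemma hasCompactSupport_dbar {φ : ℂ → ℂ} (hφ : HasCompactSupport φ) :
    HasCompactSupport (dbar φ) :=
  hφ.mono' fun z hz => by
    by_contra h
    exact hz (dbar_eq_zero_of_notMem_tsupport h)

lemma tsupport_dbar_subset (φ : ℂ → ℂ) : tsupport (dbar φ) ⊆ tsupport φ :=
  closure_minimal (fun z hz => by
    by_contra h
    exact hz (dbar_eq_zero_of_notMem_tsupport h)) (isClosed_tsupport φ)

/-- A test function times a function continuous near its support is continuous. -/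
lemma continuous_mul_of_tsupport_subset {O : Set ℂ} (hO : IsOpen O) {h φ : ℂ → ℂ}
    (hh : ContinuousOn h O) (hφ : Continuous φ) (hs : tsupport φ ⊆ O) :
    Continuous fun z => h z * φ z := by
  refine continuous_of_tsupport fun x hx => ?_
  have hx' : x ∈ tsupport φ := tsupport_mul_subset_right hx
  exact (hh.continuousAt (hO.mem_nhds (hs hx'))).mul hφ.continuousAt

lemma contDiff_of_contDiffAt_tsupport {n : WithTop ℕ∞} {φ : ℂ → ℂ}
    (h : ∀ x ∈ tsupport φ, ContDiffAt ℝ n φ x) : ContDiff ℝ n φ := by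
  refine contDiff_iff_contDiffAt.mpr fun x => ?_
  by_cases hx : x ∈ tsupport φ
  · exact h x hx
  · exact contDiffAt_const.congr_of_eventuallyEq (notMem_tsupport_iff_eventuallyEq.mp hx)

lemma integral_dbar_eq_zero {φ : ℂ → ℂ} (hφ : ContDiff ℝ 1 φ) (hc : HasCompactSupport φ) :
    ∫ z, dbar φ z = 0 := by
  have hcont := hφ.continuous_fderiv one_ne_zero
  have key : ∀ v : ℂ, Integrable (fun z => fderiv ℝ φ z v) ∧ ∫ z, fderiv ℝ φ z v = 0 := by
    intro v
    have hc' : HasCompactSupport fun z => fderiv ℝ φ z v := hc.fderiv_apply (𝕜 := ℝ) v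
    have hi : Integrable fun z => fderiv ℝ φ z v :=
      (hcont.clm_apply continuous_const).integrable_of_hasCompactSupport hc'
    refine ⟨hi, ?_⟩
    have := integral_mul_fderiv_eq_neg_fderiv_mul_of_integrable (μ := (volume : Measure ℂ))
      (f := fun _ : ℂ => (1 : ℂ)) (g := φ) (v := v) (by simp) (by simpa using hi)
      (by simpa using hφ.continuous.integrable_of_hasCompactSupport hc)
      (fun _ _ => differentiableAt_const _) (fun x _ => hφ.differentiable one_ne_zero x)
    simpa using this
  simp only [dbar]
  rw [integral_const_mul, integral_add (key 1).1 ((key Complex.I).1.const_mul _),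
    integral_const_mul, (key 1).2, (key Complex.I).2]
  simp

/-- Integration by parts for `∂/∂z̄` against a test function. -/
lemma setIntegral_mul_dbar {O : Set ℂ} (hO : IsOpen O) {h φ : ℂ → ℂ}
    (hh : ContDiffOn ℝ 1 h O) (hφ : ContDiff ℝ 1 φ) (hc : HasCompactSupport φ)
    (hs : tsupport φ ⊆ O) :
    ∫ z in O, h z * dbar φ z = - ∫ z in O, dbar h z * φ z := by
  have hprod : ContDiff ℝ 1 fun z => h z * φ z := by
    refine contDiff_of_contDiffAt_tsupport fun x hx => ?_
    have hx' : x ∈ tsupport φ := tsupport_mul_subset_right hx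
    exact (hh.contDiffAt (hO.mem_nhds (hs hx'))).mul hφ.contDiffAt
  have hpc : HasCompactSupport fun z => h z * φ z := hc.mul_left
  have h0 := integral_dbar_eq_zero hprod hpc
  have hdh : ContinuousOn (dbar h) O := by
    have := hh.continuousOn_fderiv_of_isOpen hO le_rfl
    unfold dbar
    fun_prop
  have i1 : Integrable fun z => dbar h z * φ z :=
    (continuous_mul_of_tsupport_subset hO hdh hφ.continuous hs).integrable_of_hasCompactSupport
      hc.mul_left
  have i2 : Integrable fun z => h z * dbar φ z :=
    (continuous_mul_of_tsupport_subset hO hh.continuousOn (continuous_dbar hφ)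
      ((tsupport_dbar_subset φ).trans hs)).integrable_of_hasCompactSupport
      (hasCompactSupport_dbar hc).mul_left
  have h1 : ∀ z, dbar (fun z => h z * φ z) z = dbar h z * φ z + h z * dbar φ z := by
    intro z
    by_cases hz : z ∈ tsupport φ
    · exact dbar_mul ((hh.contDiffAt (hO.mem_nhds (hs hz))).differentiableAt one_ne_zero)
        (hφ.differentiable one_ne_zero z)
    · rw [dbar_eq_zero_of_notMem_tsupport hz, image_eq_zero_of_notMem_tsupport hz,
        dbar_eq_zero_of_notMem_tsupport (fun h' => hz (tsupport_mul_subset_right h'))]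
      simp
  simp only [h1] at h0
  rw [integral_add i1 i2] at h0
  rw [setIntegral_eq_integral_of_forall_compl_eq_zero, setIntegral_eq_integral_of_forall_compl_eq_zero]
  · linear_combination h0
  · intro z hz
    rw [image_eq_zero_of_notMem_tsupport (fun h' => hz (hs h')), mul_zero]
  · intro z hz
    rw [dbar_eq_zero_of_notMem_tsupport (fun h' => hz (hs h')), mul_zero]

lemma setIntegral_mul_dbar_of_differentiableOn {O : Set ℂ} (hO : IsOpen O) {h φ : ℂ → ℂ}
    (hh : DifferentiableOn ℂ h O) (hφ : ContDiff ℝ 1 φ) (hc : HasCompactSupport φ)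
    (hs : tsupport φ ⊆ O) : ∫ z in O, h z * dbar φ z = 0 := by
  have h1 : ContDiffOn ℝ 1 h O := (hh.contDiffOn hO).restrict_scalars ℝ
  rw [setIntegral_mul_dbar hO h1 hφ hc hs, neg_eq_zero]
  refine setIntegral_eq_zero_of_forall_eq_zero fun z hz => ?_
  rw [dbar_of_differentiableAt (hh.differentiableAt (hO.mem_nhds hz)), zero_mul]

/-- The Cauchy–Pompeiu formula for a compactly supported function, at the origin: in polar
coordinates `∂φ/∂z̄ · e^{-iτ} = (∂_s + (i/s) ∂_τ) φ / 2`, and each part integrates explicitly. -/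
lemma integral_dbar_div {φ : ℂ → ℂ} (hφ : ContDiff ℝ 1 φ) (hc : HasCompactSupport φ) :
    ∫ z, dbar φ z / z = -Real.pi * φ 0 := by
  have hcont := hφ.continuous_fderiv one_ne_zero
  have hdiff : Differentiable ℝ φ := hφ.differentiable one_ne_zero
  set E : ℝ → ℂ := fun θ => Complex.exp (θ * Complex.I) with hE
  have hEc : Continuous E := by fun_prop
  have hEn : ∀ θ, ‖E θ‖ = 1 := fun θ => Complex.norm_exp_ofReal_mul_I θ
  -- the derivative in the direction `c e^{iτ}`: radial for `c = 1`, angular for `c = i`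
  set G : ℂ → ℝ × ℝ → ℂ := fun c p => fderiv ℝ φ ((p.1 : ℂ) * E p.2) (c * E p.2) with hG
  have hGc : ∀ c, Continuous (G c) := fun c => by
    refine Continuous.clm_apply (hcont.comp ?_) ?_ <;> fun_prop
  obtain ⟨R, hR⟩ := hc.isCompact.isBounded.subset_closedBall (0 : ℂ)
  have hG0 : ∀ c (p : ℝ × ℝ), R < p.1 → 0 < p.1 → G c p = 0 := by
    intro c p hp hp0
    have : ((p.1 : ℂ) * E p.2) ∉ tsupport φ := by
      intro h
      have := hR h
      rw [mem_closedBall_zero_iff, norm_mul, hEn, mul_one, Complex.norm_real, Real.norm_eq_abs,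
        abs_of_pos hp0] at this
      exact absurd hp (not_lt.mpr this)
    simp [hG, fderiv_of_notMem_tsupport (𝕜 := ℝ) this]
  have hGi : ∀ c, IntegrableOn (G c) (Set.Ioi 0 ×ˢ Set.Ioo (-Real.pi) Real.pi) := by
    intro c
    have h1 : IntegrableOn (G c) (Set.Icc 0 R ×ˢ Set.Icc (-Real.pi) Real.pi) :=
      (hGc c).continuousOn.integrableOn_compact (isCompact_Icc.prod isCompact_Icc)
    refine h1.of_forall_sdiff_eq_zero (measurableSet_Ioi.prod measurableSet_Ioo) ?_
    rintro ⟨s, τ⟩ ⟨⟨hs, hτ⟩, hn⟩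
    simp only [Set.mem_prod, Set.mem_Icc, not_and_or] at hn
    simp only [Set.mem_Ioi, Set.mem_Ioo] at hs hτ
    refine hG0 c _ ?_ hs
    rcases hn with h | h
    · rcases h with h | h
      · exact absurd hs.le h
      · exact not_le.mp h
    · rcases h with h | h
      · exact absurd hτ.1.le h
      · exact absurd hτ.2.le h
  rw [← Complex.integral_comp_polarCoord_symm]
  have hval : ∀ p ∈ polarCoord.target, p.1 • (dbar φ (Complex.polarCoord.symm p)
      / Complex.polarCoord.symm p) = (1 / 2 : ℂ) * G 1 p + (Complex.I / 2) * G Complex.I p := by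
    rintro ⟨s, τ⟩ hp
    simp only [polarCoord_target, Set.mem_prod, Set.mem_Ioi] at hp
    have hs : (s : ℂ) ≠ 0 := by exact_mod_cast hp.1.ne'
    have h1 : Complex.polarCoord.symm (s, τ) = (s : ℂ) * E τ := by
      simp [Complex.polarCoord_symm_apply, hE, Complex.exp_mul_I]
    have hE0 : E τ ≠ 0 := Complex.exp_ne_zero _
    rw [h1]
    have hre : (E τ).re = Real.cos τ := Complex.exp_ofReal_mul_I_re τ
    have him : (E τ).im = Real.sin τ := Complex.exp_ofReal_mul_I_im τ
    have e1 : (E τ) * (Complex.cos τ - Complex.sin τ * Complex.I) = 1 := by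
      simp only [hE, Complex.exp_mul_I]
      have := Complex.sin_sq_add_cos_sq (τ : ℂ)
      have hI := Complex.I_sq
      linear_combination this - (Complex.sin τ)^2 * hI
    have e2 : (E τ)⁻¹ = Complex.cos τ - Complex.sin τ * Complex.I :=
      inv_eq_of_mul_eq_one_right e1
    simp only [hG, one_mul]
    rw [realLinear_apply_eq _ (E τ), realLinear_apply_eq _ (Complex.I * E τ), dbar,
      div_eq_mul_inv, mul_inv, e2, Complex.real_smul]
    simp only [Complex.I_mul_re, Complex.I_mul_im, hre, him]
    push_cast
    have hI := Complex.I_sq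
    field_simp
    linear_combination (-(fderiv ℝ φ (↑s * E τ)) Complex.I * Complex.sin τ) * hI
  rw [setIntegral_congr_fun (Complex.polarCoord.open_target.measurableSet.congr rfl |> fun h => by
    simpa using polarCoord.open_target.measurableSet) hval]
  rw [polarCoord_target, integral_add ((hGi 1).const_mul _) ((hGi Complex.I).const_mul _),
    integral_const_mul, integral_const_mul]
  -- the radial part integrates to `-φ(0)` along each ray
  have hA : ∫ p in Set.Ioi (0:ℝ) ×ˢ Set.Ioo (-Real.pi) Real.pi, G 1 p = -(2 * Real.pi) * φ 0 := by
    have hGi1 := hGi 1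
    rw [Measure.volume_eq_prod] at hGi1 ⊢
    rw [← setIntegral_prod_swap, setIntegral_prod _ (by
      have := hGi1.swap
      exact this)]
    have : ∀ τ : ℝ, ∫ s in Set.Ioi (0:ℝ), G 1 (s, τ) = - φ 0 := by
      intro τ
      have hd : ∀ s : ℝ, HasDerivAt (fun s : ℝ => φ ((s : ℂ) * E τ)) (G 1 (s, τ)) s := by
        intro s
        have h1 : HasDerivAt (fun s : ℝ => (s : ℂ) * E τ) (1 * E τ) s :=
          (Complex.ofRealCLM.hasDerivAt (x := s)).mul_const _
        have h2 := (hdiff ((s : ℂ) * E τ)).hasFDerivAt.comp_hasDerivAt s h1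
        exact h2
      have hint : IntegrableOn (fun s => G 1 (s, τ)) (Set.Ioi 0) := by
        have h1 : IntegrableOn (fun s => G 1 (s, τ)) (Set.Icc 0 R) :=
          ((hGc 1).comp (by fun_prop : Continuous fun s : ℝ => (s, τ))).continuousOn.integrableOn_compact
            isCompact_Icc
        refine h1.of_forall_sdiff_eq_zero measurableSet_Ioi fun s hs => hG0 1 _ ?_ hs.1
        by_contra h
        exact hs.2 ⟨le_of_lt hs.1, not_lt.mp h⟩
      have hlim : Tendsto (fun s : ℝ => φ ((s : ℂ) * E τ)) atTop (𝓝 0) := by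
        refine tendsto_const_nhds.congr' ?_
        filter_upwards [eventually_gt_atTop (max R 0)] with s hs
        have : ((s : ℂ) * E τ) ∉ tsupport φ := by
          intro h
          have := hR h
          rw [mem_closedBall_zero_iff, norm_mul, hEn, mul_one, Complex.norm_real, Real.norm_eq_abs,
            abs_of_pos ((le_max_right _ _).trans_lt hs)] at this
          exact absurd ((le_max_left _ _).trans_lt hs) (not_lt.mpr this)
        exact (image_eq_zero_of_notMem_tsupport this).symm
      have := integral_Ioi_of_hasDerivAt_of_tendsto' (a := (0:ℝ)) (fun s _ => hd s) hint hlim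
      simpa using this
    simp only [Prod.swap_prod_mk, this]
    rw [setIntegral_const]
    simp [Measure.real, Real.volume_Ioo]
    rw [ENNReal.toReal_ofReal (by linarith [Real.pi_pos])]
    push_cast; left; ring
  -- the angular part is `1 / s` times a `τ`-derivative, which integrates to zero over a circle
  have hB : ∫ p in Set.Ioi (0:ℝ) ×ˢ Set.Ioo (-Real.pi) Real.pi, G Complex.I p = 0 := by
    have hGi1 := hGi Complex.I
    rw [Measure.volume_eq_prod] at hGi1 ⊢
    rw [setIntegral_prod _ hGi1]
    refine setIntegral_eq_zero_of_forall_eq_zero fun s hs => ?_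
    have hs' : (s : ℂ) ≠ 0 := by exact_mod_cast (ne_of_gt hs)
    have hd : ∀ τ : ℝ, HasDerivAt (fun τ : ℝ => (s : ℂ)⁻¹ * φ ((s : ℂ) * E τ))
        (G Complex.I (s, τ)) τ := by
      intro τ
      have h1 : HasDerivAt (fun τ : ℝ => (s : ℂ) * E τ) ((s : ℂ) * (Complex.I * E τ)) τ := by
        have h0 : HasDerivAt (fun τ : ℝ => (τ : ℂ) * Complex.I) (1 * Complex.I) τ :=
          (Complex.ofRealCLM.hasDerivAt (x := τ)).mul_const _
        have := h0.cexp.const_mul (s : ℂ)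
        convert! this using 1
        simp only [hE]; ring
      have h2 := ((hdiff ((s : ℂ) * E τ)).hasFDerivAt.comp_hasDerivAt τ h1).const_mul (s : ℂ)⁻¹
      convert! h2 using 1
      have : (s : ℂ) * (Complex.I * E τ) = (s : ℝ) • (Complex.I * E τ) := by simp
      simp only [hG]
      rw [this, map_smul, Complex.real_smul, ← mul_assoc, inv_mul_cancel₀ hs', one_mul]
    rw [← integral_Ioc_eq_integral_Ioo, ← intervalIntegral.integral_of_le (by linarith [Real.pi_pos]),
      intervalIntegral.integral_eq_sub_of_hasDerivAt (fun τ _ => hd τ)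
        (((hGc Complex.I).comp (by fun_prop : Continuous fun τ : ℝ => (s, τ))).intervalIntegrable _ _)]
    have : E Real.pi = E (-Real.pi) := by
      simp only [hE]
      rw [show ((-Real.pi : ℝ) : ℂ) * Complex.I = -(Real.pi * Complex.I) by push_cast; ring,
        Complex.exp_neg, Complex.exp_pi_mul_I]
      norm_num
    rw [this, sub_self]
  rw [hA, hB]
  ring

/-- The Cauchy–Pompeiu formula for a compactly supported function. -/
lemma integral_dbar_div_sub {φ : ℂ → ℂ} (hφ : ContDiff ℝ 1 φ) (hc : HasCompactSupport φ) (v : ℂ) :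
    ∫ z, dbar φ z / (z - v) = -Real.pi * φ v := by
  have h1 : ContDiff ℝ 1 fun z => φ (z + v) := by fun_prop
  have h2 : HasCompactSupport fun z => φ (z + v) := hc.comp_homeomorph (Homeomorph.addRight v)
  have h3 := integral_dbar_div h1 h2
  have h4 : ∀ z, dbar (fun z => φ (z + v)) z = dbar φ (z + v) := fun z => by
    simp only [dbar, fderiv_comp_add_right]
  rw [← integral_add_right_eq_self (fun z => dbar φ z / (z - v)) v]
  simpa [h4] using h3

/-! ### Weyl's lemma and integrals depending on a parameter -/

/-- The convolution of functions in conjugate Lebesgue spaces is continuous. -/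
lemma continuous_convolution_of_memLp {p q : ℝ≥0∞} (hpq : p.HolderConjugate q) (hq : q ≠ ⊤)
    {K F : ℂ → ℂ} (hK : MemLp K q volume) (hF : MemLp F p volume) :
    Continuous fun u : ℂ => ∫ v, K (u - v) * F v := by
  have hp1 : 1 ≤ p := hpq.one_le
  have hmp : ∀ u : ℂ, MeasurePreserving (fun v : ℂ => u - v) volume volume :=
    fun u => Measure.measurePreserving_sub_left volume u
  have hint : ∀ {k : ℂ → ℂ}, MemLp k q volume → ∀ u, Integrable fun v => k (u - v) * F v :=
    fun hk u => (hk.comp_measurePreserving (hmp u)).integrable_mul hF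
  refine continuous_of_uniform_approx_of_continuous fun S hS => ?_
  obtain ⟨ε, hε, hεS⟩ := Metric.mem_uniformity_dist.mp hS
  obtain ⟨M, hM⟩ : ∃ M : ℝ, eLpNorm F p volume ≤ ENNReal.ofReal M ∧ 0 < M :=
    ⟨(eLpNorm F p volume).toReal + 1, by
      rw [ENNReal.ofReal_add ENNReal.toReal_nonneg zero_le_one, ENNReal.ofReal_toReal hF.2.ne]
      exact le_self_add, by positivity⟩
  obtain ⟨k, hkc, hkε, hkcont, hkq⟩ := hK.exists_hasCompactSupport_eLpNorm_sub_le hq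
    (ε := ENNReal.ofReal (ε / (2 * M))) (by simp; exact div_pos hε (by linarith))
  refine ⟨fun u => ∫ v, k (u - v) * F v, ?_, fun u => hεS ?_⟩
  · have h := hkc.continuous_convolution_left (ContinuousLinearMap.mul ℝ ℂ) hkcont
      (hF.locallyIntegrable hp1)
    have h2 : (fun u => ∫ v, k (u - v) * F v)
        = MeasureTheory.convolution k F (ContinuousLinearMap.mul ℝ ℂ) volume := by
      ext u; rw [convolution_eq_swap]; rfl
    rw [h2]; exact h
  · rw [dist_eq_norm, ← integral_sub (hint hK u) (hint hkq u)]
    have hKk : MemLp (K - k) q volume := hK.sub hkq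
    have h1 : eLpNorm (fun v => (K - k) (u - v) * F v) 1 volume
        ≤ eLpNorm (fun v => (K - k) (u - v)) q volume * eLpNorm F p volume := by
      have := eLpNorm_smul_le_mul_eLpNorm (p := q) (q := p) (r := 1) (𝕜 := ℂ) hF.1
        (hKk.comp_measurePreserving (hmp u)).1
      exact this
    have h2 : eLpNorm (fun v => (K - k) (u - v)) q volume = eLpNorm (K - k) q volume :=
      eLpNorm_comp_measurePreserving hKk.1 (hmp u)
    have h3 : ‖∫ v, K (u - v) * F v - k (u - v) * F v‖ₑ
        ≤ ENNReal.ofReal (ε / (2 * M)) * ENNReal.ofReal M := by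
      refine (enorm_integral_le_lintegral_enorm _).trans ?_
      rw [eLpNorm_one_eq_lintegral_enorm, h2] at h1
      refine (le_of_eq ?_).trans (h1.trans (mul_le_mul' hkε hM.1))
      refine lintegral_congr fun v => ?_
      simp [sub_mul]
    rw [← ENNReal.ofReal_mul (by have := hM.2; positivity), ← ofReal_norm,
      ENNReal.ofReal_le_ofReal_iff (by have := hM.2; positivity)] at h3
    have h4 : ε / (2 * M) * M = ε / 2 := by have := hM.2; field_simp
    linarith

/-- Weyl's lemma for `∂/∂z̄`: a continuous function with vanishing weak `z̄`-derivative is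
holomorphic, being locally the uniform limit of its mollifications. -/
lemma HasWeakDbar.differentiableOn {O : Set ℂ} (hO : IsOpen O) {w : ℂ → ℂ}
    (hw : ContinuousOn w O) (h : HasWeakDbar O w 0) : DifferentiableOn ℂ w O := by
  intro z₀ hz₀
  obtain ⟨δ, hδ, hball⟩ : ∃ δ > 0, Metric.closedBall z₀ (2 * δ) ⊆ O := by
    obtain ⟨δ, hδ, hb⟩ := Metric.nhds_basis_closedBall.mem_iff.mp (hO.mem_nhds hz₀)
    exact ⟨δ / 2, by positivity, by simpa [mul_div_cancel₀] using hb⟩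
  set C := Metric.closedBall z₀ (2 * δ) with hC
  have hCc : IsCompact C := isCompact_closedBall _ _
  have hwC : ContinuousOn w C := hw.mono hball
  set g : ℂ → ℂ := C.indicator w with hg
  have hgi : Integrable g := (integrable_indicator_iff hCc.measurableSet).mpr
    (hwC.integrableOn_compact hCc)
  have huc : UniformContinuousOn w C := hCc.uniformContinuousOn_of_continuous hwC
  -- mollifiers with supports shrinking to the origin, all of radius less than `δ`
  let ρ : ℕ → ContDiffBump (0 : ℂ) := fun n =>
    ⟨δ / (2 * (n + 2)), δ / (n + 2), by positivity, by
      have : (0:ℝ) < n + 2 := by positivity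
      rw [div_lt_div_iff₀ (by positivity) this]; nlinarith⟩
  have hρout : ∀ n, (ρ n).rOut = δ / (n + 2) := fun n => rfl
  have hρlt : ∀ n, (ρ n).rOut < δ := fun n => by
    rw [hρout, div_lt_iff₀ (by positivity)]; nlinarith [n.cast_nonneg (α := ℝ)]
  set W : ℕ → ℂ → ℂ := fun n =>
    MeasureTheory.convolution ((ρ n).normed volume) g (ContinuousLinearMap.lsmul ℝ ℝ) volume with hW
  -- on the smaller ball the mollifications see only values of `w` on the compact ball
  have hunif : TendstoUniformlyOn W w atTop (Metric.ball z₀ δ) := by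
    rw [Metric.tendstoUniformlyOn_iff]
    intro ε hε
    obtain ⟨η, hη, hηw⟩ := Metric.uniformContinuousOn_iff.mp huc (ε / 2) (by positivity)
    have hlim : Tendsto (fun n : ℕ => δ / ((n : ℝ) + 2)) atTop (𝓝 0) :=
      tendsto_const_nhds.div_atTop (tendsto_atTop_add_const_right _ _ tendsto_natCast_atTop_atTop)
    filter_upwards [hlim.eventually (gt_mem_nhds hη)] with n hn x hx
    have hxC : x ∈ C := by
      rw [hC, Metric.mem_closedBall]; rw [Metric.mem_ball] at hx; linarith
    have hgx : g x = w x := Set.indicator_of_mem hxC _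
    rw [dist_comm, ← hgx]
    refine (ContDiffBump.dist_normed_convolution_le hgi.1 fun y hy => ?_).trans_lt
      (half_lt_self hε)
    have hyC : y ∈ C := by
      rw [Metric.mem_ball] at hx hy
      have := dist_triangle y x z₀
      have := hρlt n
      rw [hC, Metric.mem_closedBall]; linarith
    rw [hgx, show g y = w y from Set.indicator_of_mem hyC _]
    exact (hηw y hyC x hxC (lt_trans (Metric.mem_ball.mp hy) hn)).le
  have hdiff : ∀ n, DifferentiableOn ℂ (W n) (Metric.ball z₀ δ) := by
    intro n x hx
    refine DifferentiableAt.differentiableWithinAt ?_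
    have hρs : ContDiff ℝ ∞ ((ρ n).normed (volume : Measure ℂ)) := (ρ n).contDiff_normed
    have hρc : HasCompactSupport ((ρ n).normed (volume : Measure ℂ)) := (ρ n).hasCompactSupport_normed
    have hd := hρc.hasFDerivAt_convolution_left (ContinuousLinearMap.lsmul ℝ ℝ)
      (hρs.of_le (by exact_mod_cast le_top) : ContDiff ℝ 1 _) hgi.locallyIntegrable x
    have hval : ∀ v : ℂ, fderiv ℝ (W n) x v
        = ∫ t, ((fderiv ℝ ((ρ n).normed volume) (x - t) v : ℝ) : ℂ) * g t := by
      intro v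
      rw [hd.fderiv, convolution_eq_swap, ContinuousLinearMap.integral_apply]
      · refine integral_congr_ae (Eventually.of_forall fun t => ?_)
        simp [ContinuousLinearMap.precompL_apply]
      · have := (hρc.fderiv (𝕜 := ℝ)).convolutionExists_left
          (L := ContinuousLinearMap.precompL ℂ (ContinuousLinearMap.lsmul ℝ ℝ (E := ℂ)))
          (hρs.continuous_fderiv (by simp)) hgi.locallyIntegrable x
        exact ((convolutionExistsAt_flip.mpr this).congr (Eventually.of_forall fun t => by simp))
    rw [differentiableAt_complex_iff_differentiableAt_real]
    refine ⟨hd.differentiableAt, ?_⟩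
    -- the weak equation tested with the reflected mollifier centred at `x`
    set φ : ℂ → ℂ := fun t => (((ρ n).normed volume (x - t) : ℝ) : ℂ) with hφ
    have hφs : ContDiff ℝ ∞ φ :=
      Complex.ofRealCLM.contDiff.comp (hρs.comp (contDiff_const.sub contDiff_id))
    have hφsupp : tsupport φ ⊆ Metric.closedBall x (ρ n).rOut := by
      refine closure_minimal (fun t ht => ?_) Metric.isClosed_closedBall
      have h1 : (ρ n).normed volume (x - t) ≠ 0 := by
        intro h0; exact ht (by simp [hφ, h0])
      have h2 : x - t ∈ Function.support ((ρ n).normed (volume : Measure ℂ)) := h1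
      rw [(ρ n).support_normed_eq, mem_ball_zero_iff] at h2
      rw [Metric.mem_closedBall, dist_comm, dist_eq_norm]; exact h2.le
    have hsub : Metric.closedBall x (ρ n).rOut ⊆ C := by
      intro t ht
      rw [Metric.mem_ball] at hx
      rw [Metric.mem_closedBall] at ht ⊢
      have := dist_triangle t x z₀
      have := hρlt n
      linarith
    have hφc : HasCompactSupport φ :=
      HasCompactSupport.of_support_subset_isCompact (isCompact_closedBall x (ρ n).rOut)
        ((subset_tsupport φ).trans hφsupp)
    have hweak := h φ hφs hφc ((hφsupp.trans hsub).trans hball)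
    have hφd : ∀ t v, fderiv ℝ φ t v = -((fderiv ℝ ((ρ n).normed volume) (x - t) v : ℝ) : ℂ) := by
      intro t v
      have h1 : HasFDerivAt (fun t : ℂ => x - t) (-(ContinuousLinearMap.id ℝ ℂ)) t := by
        exact (hasFDerivAt_id (𝕜 := ℝ) t).const_sub x
      have h2 := (hρs.differentiable (by simp) (x - t)).hasFDerivAt.comp t h1
      have h3 := Complex.ofRealCLM.hasFDerivAt.comp t h2
      have h4 : fderiv ℝ φ t = _ := h3.fderiv
      rw [h4]; simp
    have hint : ∀ v : ℂ, Integrable fun t => ((fderiv ℝ ((ρ n).normed volume) (x - t) v : ℝ) : ℂ) * g t := by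
      intro v
      have hc1 : Continuous fun t => ((fderiv ℝ ((ρ n).normed (volume : Measure ℂ)) (x - t) v : ℝ) : ℂ) := by
        have := hρs.continuous_fderiv (by simp)
        fun_prop
      obtain ⟨M, hM⟩ := (hρc.fderiv (𝕜 := ℝ)).exists_bound_of_continuous
        (hρs.continuous_fderiv (by simp))
      refine hgi.bdd_mul (c := M * ‖v‖) hc1.aestronglyMeasurable
        (Eventually.of_forall fun t => ?_)
      rw [Complex.norm_real]
      exact (ContinuousLinearMap.le_opNorm _ _).trans (by gcongr; exact hM _)
    -- the Cauchy–Riemann equation for the mollification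
    have hsum : fderiv ℝ (W n) x 1 + Complex.I * fderiv ℝ (W n) x Complex.I = 0 := by
      rw [hval, hval, ← integral_const_mul, ← integral_add (hint 1) ((hint Complex.I).const_mul _)]
      have h0 : ∫ t, g t * dbar φ t = 0 := by
        rw [← setIntegral_eq_integral_of_forall_compl_eq_zero (s := O)]
        · rw [show (∫ z in O, g z * dbar φ z) = ∫ z in O, w z * dbar φ z from
            setIntegral_congr_fun hO.measurableSet fun z _ => ?_, hweak]
          · simp
          · by_cases hz : z ∈ C
            · simp only [hg, Set.indicator_of_mem hz]
            · rw [dbar_eq_zero_of_notMem_tsupport (fun h' => hz (hsub (hφsupp h'))), mul_zero,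
                mul_zero]
        · intro z hz
          rw [hg, Set.indicator_of_notMem (fun h' => hz (hball h')), zero_mul]
      have h1 : ∀ t, ((fderiv ℝ ((ρ n).normed volume) (x - t) 1 : ℝ) : ℂ) * g t + Complex.I *
          (((fderiv ℝ ((ρ n).normed volume) (x - t) Complex.I : ℝ) : ℂ) * g t)
          = (-2 : ℂ) * (g t * dbar φ t) := by
        intro t
        simp only [dbar, hφd]; ring
      simp only [h1]
      rw [integral_const_mul, h0, mul_zero]
    rw [smul_eq_mul]
    linear_combination (-Complex.I) * hsum + fderiv ℝ (W n) x Complex.I * Complex.I_sq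
  have := hunif.tendstoLocallyUniformlyOn.differentiableOn (Eventually.of_forall hdiff)
    Metric.isOpen_ball
  exact (this.differentiableAt (Metric.ball_mem_nhds z₀ hδ)).differentiableWithinAt

/-- Integrating a holomorphic kernel of difference type along a path gives a holomorphic
function. -/
lemma differentiableOn_intervalIntegral {κ : ℂ → ℂ} {S O : Set ℂ} (hS : IsOpen S) (hO : IsOpen O)
    (hκ : DifferentiableOn ℂ κ S) {g σ : ℝ → ℂ} {a b : ℝ} (hg : ContinuousOn g (Set.uIcc a b))
    (hσ : ContinuousOn σ (Set.uIcc a b)) (hmaps : ∀ u ∈ O, ∀ s ∈ Set.uIcc a b, u + σ s ∈ S) :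
    DifferentiableOn ℂ (fun u => ∫ s in a..b, g s * κ (u + σ s)) O := by
  intro u₀ hu₀
  obtain ⟨δ, hδ, hb⟩ := Metric.nhds_basis_closedBall.mem_iff.mp (hO.mem_nhds hu₀)
  have hκ' : ContinuousOn (deriv κ) S := (hκ.deriv hS).continuousOn
  have hcomp : IsCompact (Metric.closedBall u₀ δ ×ˢ Set.uIcc a b) :=
    (isCompact_closedBall _ _).prod isCompact_uIcc
  have hmap2 : ContinuousOn (fun x : ℂ × ℝ => x.1 + σ x.2) (Metric.closedBall u₀ δ ×ˢ Set.uIcc a b) :=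
    continuousOn_fst.add (hσ.comp continuousOn_snd fun x hx => hx.2)
  have hc2 : ContinuousOn (fun x : ℂ × ℝ => g x.2 * deriv κ (x.1 + σ x.2))
      (Metric.closedBall u₀ δ ×ˢ Set.uIcc a b) :=
    (hg.comp continuousOn_snd fun x hx => hx.2).mul
      (hκ'.comp hmap2 fun x hx => hmaps _ (hb hx.1) _ hx.2)
  obtain ⟨M, hM⟩ := hcomp.exists_bound_of_continuousOn hc2
  have hcont : ∀ u ∈ O, ContinuousOn (fun s => g s * κ (u + σ s)) (Set.uIcc a b) := fun u hu =>
    hg.mul (hκ.continuousOn.comp (continuousOn_const.add hσ) fun s hs => hmaps u hu s hs)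
  have hcont' : ContinuousOn (fun s => g s * deriv κ (u₀ + σ s)) (Set.uIcc a b) :=
    hg.mul (hκ'.comp (continuousOn_const.add hσ) fun s hs => hmaps u₀ hu₀ s hs)
  have hI : Set.uIoc a b ⊆ Set.uIcc a b := Set.uIoc_subset_uIcc
  have := intervalIntegral.hasDerivAt_integral_of_dominated_loc_of_deriv_le (μ := volume)
    (F := fun u s => g s * κ (u + σ s)) (F' := fun u s => g s * deriv κ (u + σ s)) (x₀ := u₀)
    (s := Metric.closedBall u₀ δ) (bound := fun _ => M) (a := a) (b := b)
    (Metric.closedBall_mem_nhds u₀ hδ)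
    (by
      filter_upwards [hO.mem_nhds hu₀] with u hu
      exact ((hcont u hu).mono hI).aestronglyMeasurable measurableSet_uIoc)
    (hcont u₀ hu₀).intervalIntegrable
    ((hcont'.mono hI).aestronglyMeasurable measurableSet_uIoc)
    (Eventually.of_forall fun s hs u hu => hM (u, s) ⟨hu, hI hs⟩)
    intervalIntegrable_const
    (Eventually.of_forall fun s hs u hu => by
      have h1 : HasDerivAt κ (deriv κ (u + σ s)) (u + σ s) :=
        (hκ.differentiableAt (hS.mem_nhds (hmaps u (hb hu) s (hI hs)))).hasDerivAt
      exact (h1.comp_add_const u (σ s)).const_mul (g s))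
  exact this.2.differentiableAt.differentiableWithinAt

/-! ### The Schwarz kernel in logarithmic coordinates -/

/-- The function `e^Y / (1 - e^Y)`. -/
def psi (Y : ℂ) : ℂ := Complex.exp Y / (1 - Complex.exp Y)

/-- The sum of `psi (X - 2nL)` over `n ≥ 1`, convergent for `Re X < 2L`. -/
def kerA (L : ℝ) (X : ℂ) : ℂ := ∑' n : ℕ, psi (X - (2 * L * (n + 1) : ℝ))

/-- The Schwarz kernel of the annulus in the logarithmic coordinate: `2πi`-periodic, odd, and
changing by the additive constant `2` under the translation by `-2L`.  It has the simple pole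
`-2 / X` at the origin. -/
def kerP (L : ℝ) (X : ℂ) : ℂ := 1 + 2 * psi X + 2 * kerA L X - 2 * kerA L (-X)

/-- The kernel `ζ H₂(z, ζ)` for `z = e^u` and `ζ = e^v`. -/
def kerK (L : ℝ) (u v : ℂ) : ℂ := 1 + (kerP L (u - v) - kerP L (u + v)) / 2

/-- The regular part of `kerP` at the origin: `kerP L X = -2 / X + kerE L X`. -/
def kerE (L : ℝ) (X : ℂ) : ℂ :=
  dslope (fun Y => -(1 + Complex.exp Y) / dslope Complex.exp 0 Y) 0 X
    + 2 * kerA L X - 2 * kerA L (-X)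

lemma exp_ne_one_of_re_ne_zero {X : ℂ} (h : X.re ≠ 0) : Complex.exp X ≠ 1 := by
  intro h1
  have h2 := congrArg norm h1
  rw [Complex.norm_exp, norm_one, Real.exp_eq_one_iff] at h2
  exact h h2

lemma exp_ne_one_of_abs_im_lt {X : ℂ} (h : |X.im| < 2 * Real.pi) (h0 : X ≠ 0) :
    Complex.exp X ≠ 1 := by
  intro h1
  obtain ⟨n, hn⟩ := Complex.exp_eq_one_iff.mp h1
  have him : X.im = n * (2 * Real.pi) := by rw [hn]; simp
  have hn0 : n = 0 := by
    rw [him, abs_mul, abs_of_pos Real.two_pi_pos] at h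
    have h2 : |(n : ℝ)| < 1 := by
      by_contra h3
      have := mul_le_mul_of_nonneg_right (not_lt.mp h3) Real.two_pi_pos.le
      linarith
    have h4 : |n| < 1 := by exact_mod_cast h2
    exact Int.abs_lt_one_iff.mp h4
  exact h0 (by rw [hn, hn0]; simp)

lemma psi_add_two_pi_I (Y : ℂ) : psi (Y + 2 * Real.pi * Complex.I) = psi Y := by
  simp only [psi, Complex.exp_add, Complex.exp_two_pi_mul_I, mul_one]

lemma psi_conj (Y : ℂ) : psi (starRingEnd ℂ Y) = starRingEnd ℂ (psi Y) := by
  simp only [psi, Complex.exp_conj, map_div₀, map_sub, map_one]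

lemma psi_neg {Y : ℂ} (h : Complex.exp Y ≠ 1) : psi (-Y) = -1 - psi Y := by
  have h1 : 1 - Complex.exp Y ≠ 0 := sub_ne_zero.mpr h.symm
  have h2 := Complex.exp_ne_zero Y
  have h3 : Complex.exp Y - 1 ≠ 0 := sub_ne_zero.mpr h
  have h4 : 1 - (Complex.exp Y)⁻¹ ≠ 0 := by
    intro h5; apply h3; field_simp at h5; simpa using h5
  simp only [psi, Complex.exp_neg]
  field_simp
  ring

lemma norm_psi_le {Y : ℂ} {b : ℝ} (hb : b < 0) (h : Y.re ≤ b) :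
    ‖psi Y‖ ≤ Real.exp Y.re / (1 - Real.exp b) := by
  have h1 : Real.exp b < 1 := Real.exp_lt_one_iff.mpr hb
  have h2 : 1 - Real.exp b ≤ ‖1 - Complex.exp Y‖ := by
    have := norm_sub_norm_le (1 : ℂ) (Complex.exp Y)
    rw [norm_one, Complex.norm_exp] at this
    have h3 : Real.exp Y.re ≤ Real.exp b := Real.exp_le_exp.mpr h
    linarith
  rw [psi, norm_div, Complex.norm_exp]
  gcongr

lemma norm_psi_sub_le {L : ℝ} (hL : 0 < L) {b : ℝ} (hb : b < 2 * L) {X : ℂ} (h : X.re ≤ b) (n : ℕ) :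
    ‖psi (X - (2 * L * (n + 1) : ℝ))‖
      ≤ (Real.exp (b - 2 * L) / (1 - Real.exp (b - 2 * L))) * Real.exp (-(2 * L)) ^ n := by
  have h0 : (0:ℝ) ≤ n := n.cast_nonneg
  have hre : (X - (2 * L * (n + 1) : ℝ)).re = X.re - 2 * L * (n + 1) := by simp
  have h1 := norm_psi_le (Y := X - (2 * L * (n + 1) : ℝ)) (b := b - 2 * L) (by linarith)
    (by rw [hre]; nlinarith)
  refine h1.trans ?_
  have h2 : Real.exp (b - 2 * L) < 1 := Real.exp_lt_one_iff.mpr (by linarith)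
  rw [div_mul_eq_mul_div, ← Real.exp_nat_mul, ← Real.exp_add]
  have h3 : 0 < 1 - Real.exp (b - 2 * L) := by linarith
  gcongr
  rw [hre]; nlinarith

lemma summable_bound {L : ℝ} (hL : 0 < L) (c : ℝ) :
    Summable fun n : ℕ => c * Real.exp (-(2 * L)) ^ n :=
  (summable_geometric_of_lt_one (Real.exp_nonneg _) (Real.exp_lt_one_iff.mpr (by linarith))).mul_left c

lemma summable_psi {L : ℝ} (hL : 0 < L) {X : ℂ} (h : X.re < 2 * L) :
    Summable fun n : ℕ => psi (X - (2 * L * (n + 1) : ℝ)) :=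
  Summable.of_norm_bounded (summable_bound hL _) (norm_psi_sub_le hL h le_rfl)

lemma isOpen_re_lt (b : ℝ) : IsOpen {X : ℂ | X.re < b} := isOpen_lt Complex.continuous_re continuous_const

lemma differentiableAt_psi {Y : ℂ} (h : Complex.exp Y ≠ 1) : DifferentiableAt ℂ psi Y := by
  unfold psi
  exact Complex.differentiableAt_exp.div ((differentiableAt_const _).sub Complex.differentiableAt_exp)
    (sub_ne_zero.mpr h.symm)

lemma differentiableAt_kerA {L : ℝ} (hL : 0 < L) {X : ℂ} (h : X.re < 2 * L) :
    DifferentiableAt ℂ (kerA L) X := by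
  set b := (X.re + 2 * L) / 2
  have hb : b < 2 * L := by simp only [b]; linarith
  have hX : X ∈ {X : ℂ | X.re < b} := by simp only [b, Set.mem_ofPred_eq]; linarith
  refine DifferentiableOn.differentiableAt (s := {X : ℂ | X.re < b}) ?_ ((isOpen_re_lt b).mem_nhds hX)
  refine Complex.differentiableOn_tsum_of_summable_norm (summable_bound hL _) (fun n Y hY => ?_)
    (isOpen_re_lt b) fun n Y hY => norm_psi_sub_le hL hb (le_of_lt hY) n
  refine DifferentiableAt.differentiableWithinAt ?_
  refine DifferentiableAt.comp Y (differentiableAt_psi ?_) (differentiableAt_id.sub_const _)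
  apply exp_ne_one_of_re_ne_zero
  have h0 : (0:ℝ) ≤ n := n.cast_nonneg
  have hY' : Y.re < b := hY
  simp only [Complex.sub_re, Complex.ofReal_re]
  nlinarith

lemma kerA_eq_add {L : ℝ} (hL : 0 < L) {X : ℂ} (h : X.re < 2 * L) :
    kerA L X = psi (X - (2 * L : ℝ)) + kerA L (X - (2 * L : ℝ)) := by
  rw [kerA, (summable_psi hL h).tsum_eq_zero_add, kerA]
  congr 1
  · simp
  · refine tsum_congr fun n => ?_
    congr 1
    push_cast; ring

lemma kerA_add_two_pi_I (L : ℝ) (X : ℂ) : kerA L (X + 2 * Real.pi * Complex.I) = kerA L X := by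
  refine tsum_congr fun n => ?_
  rw [← psi_add_two_pi_I (X - (2 * L * (n + 1) : ℝ))]
  congr 1; ring

lemma kerA_sub_two_pi_I (L : ℝ) (X : ℂ) : kerA L (X - 2 * Real.pi * Complex.I) = kerA L X := by
  rw [← kerA_add_two_pi_I L (X - 2 * Real.pi * Complex.I), sub_add_cancel]

lemma kerA_conj (L : ℝ) (X : ℂ) : kerA L (starRingEnd ℂ X) = starRingEnd ℂ (kerA L X) := by
  rw [kerA, kerA, Complex.conj_tsum]
  refine tsum_congr fun n => ?_
  rw [← psi_conj, map_sub, Complex.conj_ofReal]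

lemma kerP_add_two_pi_I (L : ℝ) (X : ℂ) : kerP L (X + 2 * Real.pi * Complex.I) = kerP L X := by
  rw [kerP, kerP, psi_add_two_pi_I, kerA_add_two_pi_I, neg_add', kerA_sub_two_pi_I]

lemma kerP_sub_two_pi_I (L : ℝ) (X : ℂ) : kerP L (X - 2 * Real.pi * Complex.I) = kerP L X := by
  rw [← kerP_add_two_pi_I L (X - 2 * Real.pi * Complex.I), sub_add_cancel]

lemma kerP_conj (L : ℝ) (X : ℂ) : kerP L (starRingEnd ℂ X) = starRingEnd ℂ (kerP L X) := by
  simp only [kerP, psi_conj, kerA_conj, ← map_neg, map_add, map_sub, map_mul, map_one, map_ofNat]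

lemma kerP_neg (L : ℝ) {X : ℂ} (h : Complex.exp X ≠ 1) : kerP L (-X) = -kerP L X := by
  rw [kerP, kerP, psi_neg h, neg_neg]; ring

lemma kerP_sub_two_mul {L : ℝ} (hL : 0 < L) {X : ℂ} (h0 : 0 < X.re) (h : X.re < 2 * L) :
    kerP L (X - (2 * L : ℝ)) = kerP L X + 2 := by
  have h1 := kerA_eq_add hL h
  have h2 := kerA_eq_add hL (X := -(X - (2 * L : ℝ))) (by simp; linarith)
  rw [show -(X - ((2 * L : ℝ) : ℂ)) - ((2 * L : ℝ) : ℂ) = -X by ring,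
    psi_neg (exp_ne_one_of_re_ne_zero h0.ne')] at h2
  rw [kerP, kerP, h1, h2]; ring

lemma kerP_add_two_mul {L : ℝ} (hL : 0 < L) {X : ℂ} (h0 : X.re < 0) (h : -(2 * L) < X.re) :
    kerP L (X + (2 * L : ℝ)) = kerP L X - 2 := by
  have := kerP_sub_two_mul hL (X := X + (2 * L : ℝ)) (by simp; linarith) (by simp; linarith)
  rw [add_sub_cancel_right] at this
  rw [this]; ring

lemma differentiableAt_kerP {L : ℝ} (hL : 0 < L) {X : ℂ} (h : |X.re| < 2 * L)
    (h1 : Complex.exp X ≠ 1) : DifferentiableAt ℂ (kerP L) X := by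
  obtain ⟨h2, h3⟩ := abs_lt.mp h
  unfold kerP
  refine ((((differentiableAt_psi h1).const_mul 2).const_add 1).add
    ((differentiableAt_kerA hL h3).const_mul 2)).sub (DifferentiableAt.const_mul ?_ 2)
  exact (differentiableAt_kerA hL (X := -X) (by simp; linarith)).comp X differentiable_neg.differentiableAt

lemma kerP_eq_add_kerE (L : ℝ) {X : ℂ} (h : X ≠ 0) (h1 : Complex.exp X ≠ 1) :
    kerP L X = -2 / X + kerE L X := by
  have h2 : Complex.exp X - 1 ≠ 0 := sub_ne_zero.mpr h1
  have h3 : 1 - Complex.exp X ≠ 0 := sub_ne_zero.mpr h1.symm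
  rw [kerP, kerE, dslope_of_ne _ h, slope_def_field, dslope_of_ne _ h, slope_def_field, dslope_same,
    psi]
  simp
  field_simp
  ring

/-- An open rectangle around the origin, containing the origin as the only pole of `kerP`. -/
def poleBox (L : ℝ) : Set ℂ := {X : ℂ | |X.re| < 2 * L ∧ |X.im| < 2 * Real.pi}

lemma isOpen_poleBox (L : ℝ) : IsOpen (poleBox L) :=
  (isOpen_lt (f := fun X : ℂ => |X.re|) (by fun_prop) continuous_const).inter
    (isOpen_lt (f := fun X : ℂ => |X.im|) (by fun_prop) continuous_const)

lemma dslope_exp_ne_zero {X : ℂ} (h : |X.im| < 2 * Real.pi) : dslope Complex.exp 0 X ≠ 0 := by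
  by_cases h0 : X = 0
  · rw [h0, dslope_same]; simp
  · rw [dslope_of_ne _ h0, slope_def_field]
    simp only [Complex.exp_zero, sub_zero]
    exact div_ne_zero (sub_ne_zero.mpr (exp_ne_one_of_abs_im_lt h h0)) h0

lemma differentiableOn_kerE {L : ℝ} (hL : 0 < L) : DifferentiableOn ℂ (kerE L) (poleBox L) := by
  have hopen := isOpen_poleBox L
  have h0 : (0 : ℂ) ∈ poleBox L := by simp [poleBox, hL, Real.pi_pos]
  have h1 : Differentiable ℂ (dslope Complex.exp 0) := by
    rw [← differentiableOn_univ]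
    exact (Complex.differentiableOn_dslope univ_mem).mpr Complex.differentiable_exp.differentiableOn
  have h2 : DifferentiableOn ℂ (fun Y => -(1 + Complex.exp Y) / dslope Complex.exp 0 Y) (poleBox L) :=
    DifferentiableOn.div (by fun_prop) h1.differentiableOn fun Y hY => dslope_exp_ne_zero hY.2
  have h3 := (Complex.differentiableOn_dslope (hopen.mem_nhds h0)).mpr h2
  intro X hX
  obtain ⟨h4, h5⟩ := abs_lt.mp hX.1
  unfold kerE
  refine ((h3 X hX).add ((differentiableAt_kerA hL h5).const_mul 2).differentiableWithinAt).sub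
    (DifferentiableAt.differentiableWithinAt (DifferentiableAt.const_mul ?_ 2))
  exact (differentiableAt_kerA hL (X := -X) (by simp; linarith)).comp X differentiable_neg.differentiableAt

/-! ### The rectangle, reflection of the kernel, and its periods -/

/-- The open rectangle onto which `log`, scaled by `α`, maps the sector ring. -/
def rectDom (L : ℝ) : Set ℂ := Set.Ioo (-L) 0 ×ℂ Set.Ioo 0 Real.pi

/-- The closed rectangle. -/
def rectClosed (L : ℝ) : Set ℂ := Set.Icc (-L) 0 ×ℂ Set.Icc 0 Real.pi

lemma mem_rectDom {L : ℝ} {u : ℂ} :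
    u ∈ rectDom L ↔ (-L < u.re ∧ u.re < 0) ∧ 0 < u.im ∧ u.im < Real.pi := Iff.rfl

lemma mem_rectClosed {L : ℝ} {u : ℂ} :
    u ∈ rectClosed L ↔ (-L ≤ u.re ∧ u.re ≤ 0) ∧ 0 ≤ u.im ∧ u.im ≤ Real.pi := Iff.rfl

lemma isOpen_rectDom (L : ℝ) : IsOpen (rectDom L) := isOpen_Ioo.reProdIm isOpen_Ioo

lemma isCompact_rectClosed (L : ℝ) : IsCompact (rectClosed L) := isCompact_Icc.reProdIm isCompact_Icc

lemma rectDom_subset (L : ℝ) : rectDom L ⊆ rectClosed L := fun _ hu =>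
  ⟨⟨hu.1.1.le, hu.1.2.le⟩, hu.2.1.le, hu.2.2.le⟩

lemma boundary_cases {L : ℝ} {u : ℂ} (hu : u ∈ rectClosed L) (hu' : u ∉ rectDom L) :
    u.im = 0 ∨ u.im = Real.pi ∨ u.re = 0 ∨ u.re = -L := by
  rw [mem_rectClosed] at hu
  rw [mem_rectDom] at hu'
  by_contra h
  push Not at h
  obtain ⟨h1, h2, h3, h4⟩ := h
  exact hu' ⟨⟨lt_of_le_of_ne hu.1.1 (Ne.symm h4), lt_of_le_of_ne hu.1.2 h3⟩,
    lt_of_le_of_ne hu.2.1 (Ne.symm h1), lt_of_le_of_ne hu.2.2 h2⟩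

lemma conj_eq_self_of_im {u : ℂ} (h : u.im = 0) : starRingEnd ℂ u = u := by
  apply Complex.ext <;> simp [h]

lemma conj_eq_sub_of_im {u : ℂ} (h : u.im = Real.pi) :
    starRingEnd ℂ u = u - 2 * Real.pi * Complex.I := by
  apply Complex.ext
  · simp
  · simp [h]; ring

lemma conj_eq_neg_of_re {u : ℂ} (h : u.re = 0) : starRingEnd ℂ u = -u := by
  apply Complex.ext <;> simp [h]

lemma conj_eq_of_re {L : ℝ} {u : ℂ} (h : u.re = -L) :
    starRingEnd ℂ u = -u - (2 * L : ℝ) := by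
  apply Complex.ext
  · simp [h]; ring
  · simp

lemma kerK_conj_conj (L : ℝ) (u v : ℂ) :
    kerK L (starRingEnd ℂ u) (starRingEnd ℂ v) = starRingEnd ℂ (kerK L u v) := by
  simp only [kerK, map_add, map_sub, map_div₀, map_one, map_ofNat, ← kerP_conj]

lemma kerK_conj_left_of_im (L : ℝ) {u : ℂ} (h : u.im = 0 ∨ u.im = Real.pi) (v : ℂ) :
    kerK L (starRingEnd ℂ u) v = kerK L u v := by
  rcases h with h | h
  · rw [conj_eq_self_of_im h]
  · rw [conj_eq_sub_of_im h, kerK, kerK,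
      show u - 2 * Real.pi * Complex.I - v = u - v - 2 * Real.pi * Complex.I by ring,
      show u - 2 * Real.pi * Complex.I + v = u + v - 2 * Real.pi * Complex.I by ring,
      kerP_sub_two_pi_I, kerP_sub_two_pi_I]

lemma kerK_conj_right_of_im (L : ℝ) (u : ℂ) {v : ℂ} (h : v.im = 0 ∨ v.im = Real.pi) :
    kerK L u (starRingEnd ℂ v) = kerK L u v := by
  rcases h with h | h
  · rw [conj_eq_self_of_im h]
  · rw [conj_eq_sub_of_im h, kerK, kerK,
      show u - (v - 2 * Real.pi * Complex.I) = u - v + 2 * Real.pi * Complex.I by ring,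
      show u + (v - 2 * Real.pi * Complex.I) = u + v - 2 * Real.pi * Complex.I by ring,
      kerP_sub_two_pi_I, kerP_add_two_pi_I]

lemma kerK_conj_right_of_re_zero (L : ℝ) (u : ℂ) {v : ℂ} (h : v.re = 0) :
    kerK L u (starRingEnd ℂ v) = 2 - kerK L u v := by
  rw [conj_eq_neg_of_re h, kerK, kerK, sub_neg_eq_add, ← sub_eq_add_neg]; ring

lemma kerK_conj_right_of_re {L : ℝ} (hL : 0 < L) {u v : ℂ} (hu : -L < u.re) (hu' : u.re < 0)
    (h : v.re = -L) : kerK L u (starRingEnd ℂ v) = -kerK L u v := by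
  have h1 := kerP_add_two_mul hL (X := u + v) (by simp; linarith) (by simp; linarith)
  have h2 := kerP_sub_two_mul hL (X := u - v) (by simp; linarith) (by simp; linarith)
  rw [conj_eq_of_re h, kerK, kerK,
    show u - (-v - ((2 * L : ℝ) : ℂ)) = u + v + (2 * L : ℝ) by ring,
    show u + (-v - ((2 * L : ℝ) : ℂ)) = u - v - (2 * L : ℝ) by ring, h1, h2]
  ring

/-- The kernel takes the same value at a boundary point and at its mirror image, which makes the
real part of the area potential vanish on the boundary. -/
lemma kerK_conj_left {L : ℝ} (hL : 0 < L) {u v : ℂ} (hu : u ∈ rectClosed L) (hu' : u ∉ rectDom L)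
    (hv : v ∈ rectDom L) : kerK L (starRingEnd ℂ u) v = kerK L u v := by
  rw [mem_rectDom] at hv
  rcases boundary_cases hu hu' with h | h | h | h
  · exact kerK_conj_left_of_im L (Or.inl h) v
  · exact kerK_conj_left_of_im L (Or.inr h) v
  · rw [conj_eq_neg_of_re h, kerK, kerK, show -u - v = -(u + v) by ring,
      show -u + v = -(u - v) by ring,
      kerP_neg L (exp_ne_one_of_re_ne_zero (by simp [h]; exact hv.1.2.ne)),
      kerP_neg L (exp_ne_one_of_re_ne_zero (by simp [h]; exact hv.1.2.ne))]
    ring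
  · have h1 := kerP_add_two_mul hL (X := u + v) (by simp; linarith) (by simp; linarith)
    have h2 := kerP_add_two_mul hL (X := u - v) (by simp; linarith) (by simp; linarith)
    rw [conj_eq_of_re h, kerK, kerK,
      show -u - ((2 * L : ℝ) : ℂ) - v = -(u + v + (2 * L : ℝ)) by ring,
      show -u - ((2 * L : ℝ) : ℂ) + v = -(u - v + (2 * L : ℝ)) by ring,
      kerP_neg L (exp_ne_one_of_re_ne_zero (by simp; linarith)),
      kerP_neg L (exp_ne_one_of_re_ne_zero (by simp; linarith)), h1, h2]
    ring

/-- Over a full period to the right of a pole the kernel has mean `-1`. -/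
lemma integral_kerP {L : ℝ} (hL : 0 < L) {X : ℂ} (h0 : 0 < X.re) (h : X.re < 2 * L) :
    ∫ y in (-Real.pi)..Real.pi, kerP L (y * Complex.I + X) = -(2 * Real.pi) := by
  set M : ℝ → ℂ := fun x => ∫ y in (-Real.pi)..Real.pi, kerP L (x + y * Complex.I) with hM
  have hd : ∀ Y : ℂ, 0 < Y.re → Y.re < 2 * L → DifferentiableAt ℂ (kerP L) Y := fun Y h1 h2 =>
    differentiableAt_kerP hL (abs_lt.mpr ⟨by linarith, h2⟩) (exp_ne_one_of_re_ne_zero h1.ne')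
  have hline : ∀ x : ℝ, 0 < x → x < 2 * L → Continuous fun y : ℝ => kerP L (x + y * Complex.I) := by
    intro x h1 h2
    refine continuous_iff_continuousAt.mpr fun y => ?_
    exact ContinuousAt.comp (f := fun y : ℝ => (x : ℂ) + y * Complex.I)
      (hd (x + y * Complex.I) (by simpa using h1) (by simpa using h2)).continuousAt
      (by fun_prop)
  -- Cauchy's theorem: the mean is the same over all vertical lines
  have hconst : M X.re = M L := by
    have := Complex.integral_boundary_rect_eq_zero_of_differentiableOn (kerP L)
      ⟨X.re, -Real.pi⟩ ⟨L, Real.pi⟩ fun Y hY => by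
        have h1 : Y.re ∈ Set.uIcc X.re L := hY.1
        rw [Set.mem_uIcc] at h1
        refine (hd Y ?_ ?_).differentiableWithinAt <;> rcases h1 with h1 | h1 <;> linarith
    simp only at this
    have hper : ∀ x : ℝ, kerP L (x + ((-Real.pi : ℝ) : ℂ) * Complex.I)
        = kerP L (x + (Real.pi : ℂ) * Complex.I) := by
      intro x
      rw [← kerP_add_two_pi_I]; congr 1; push_cast; ring
    simp only [hper, sub_self, zero_add] at this
    rw [← smul_sub, smul_eq_zero_iff_right Complex.I_ne_zero, sub_eq_zero] at this
    exact this.symm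
  -- on the line `Re X = L` oddness and quasi-periodicity determine the mean
  have hML : M L = -(2 * Real.pi) := by
    have h1 : ∀ y : ℝ, kerP L (L + ((-y : ℝ) : ℂ) * Complex.I)
        = -kerP L (L + (y : ℂ) * Complex.I) - 2 := by
      intro y
      have h2 := kerP_sub_two_mul hL (X := L + (y : ℂ) * Complex.I) (by simpa using hL)
        (by simp; linarith)
      rw [show (L : ℂ) + ((-y : ℝ) : ℂ) * Complex.I
        = -(L + (y : ℂ) * Complex.I - (2 * L : ℝ)) by push_cast; ring,
        kerP_neg L (exp_ne_one_of_re_ne_zero (by simp; linarith)), h2]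
      ring
    have h2 : M L = ∫ y in (-Real.pi)..Real.pi, kerP L (L + ((-y : ℝ) : ℂ) * Complex.I) := by
      rw [intervalIntegral.integral_comp_neg (fun y : ℝ => kerP L (L + (y : ℂ) * Complex.I)), neg_neg]
    simp only [h1] at h2
    rw [intervalIntegral.integral_sub ((hline L hL (by linarith)).fun_neg.intervalIntegrable _ _)
      intervalIntegrable_const, intervalIntegral.integral_neg, intervalIntegral.integral_const] at h2
    rw [Complex.real_smul] at h2
    have h3 : M L = -M L - ((Real.pi - -Real.pi : ℝ) : ℂ) * 2 := h2
    push_cast at h3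
    linear_combination h3 / 2
  have hper : Function.Periodic (fun y : ℝ => kerP L (X.re + y * Complex.I)) (2 * Real.pi) := by
    intro y
    beta_reduce
    rw [← kerP_add_two_pi_I L (X.re + y * Complex.I)]
    congr 1; push_cast; ring
  have h3 : ∫ y in (-Real.pi)..Real.pi, kerP L (y * Complex.I + X)
      = ∫ y in (-Real.pi)..Real.pi, kerP L (X.re + ((y + X.im : ℝ) : ℂ) * Complex.I) := by
    refine intervalIntegral.integral_congr fun y _ => ?_
    congr 1
    apply Complex.ext <;> simp
  rw [h3, intervalIntegral.integral_comp_add_right (fun y : ℝ => kerP L (X.re + (y : ℂ) * Complex.I)),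
    ← hML, ← hconst]
  have := hper.intervalIntegral_add_eq (-Real.pi + X.im) (-Real.pi)
  convert! this using 2 <;> ring

/-- The kernel has mean zero over the right side in its first variable: the two terms together run over
a full period. -/
lemma integral_kerK_left {L : ℝ} (hL : 0 < L) {v : ℂ} (h0 : -L < v.re) (h : v.re < 0) :
    ∫ y in (0:ℝ)..Real.pi, kerK L (y * Complex.I) v = 0 := by
  have hc : ∀ (a b : ℝ), IntervalIntegrable (fun y : ℝ => kerP L (y * Complex.I - v)) volume a b := by
    intro a b
    refine Continuous.intervalIntegrable (continuous_iff_continuousAt.mpr fun y => ?_) _ _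
    exact ContinuousAt.comp (f := fun y : ℝ => (y : ℂ) * Complex.I - v)
      (differentiableAt_kerP hL (X := (y : ℂ) * Complex.I - v)
        (by simp; exact abs_lt.mpr ⟨by linarith, by linarith⟩)
        (exp_ne_one_of_re_ne_zero (by simp; exact h.ne))).continuousAt (by fun_prop)
  have h1 := integral_kerP hL (X := -v) (by simpa using h) (by simp; linarith)
  simp only [← sub_eq_add_neg] at h1
  rw [← intervalIntegral.integral_add_adjacent_intervals (hc _ 0) (hc _ _)] at h1
  have h2 : ∫ y in (-Real.pi)..0, kerP L (y * Complex.I - v)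
      = ∫ y in (0:ℝ)..Real.pi, -kerP L (y * Complex.I + v) := by
    have := intervalIntegral.integral_comp_neg (a := 0) (b := Real.pi)
      (fun y : ℝ => kerP L (y * Complex.I - v))
    rw [neg_zero] at this
    rw [← this]
    refine intervalIntegral.integral_congr fun y _ => ?_
    rw [← kerP_neg L (exp_ne_one_of_re_ne_zero (by simp; exact h.ne))]
    congr 1; push_cast; ring
  have hc2 : IntervalIntegrable (fun y : ℝ => kerP L (y * Complex.I + v)) volume 0 Real.pi := by
    refine Continuous.intervalIntegrable (continuous_iff_continuousAt.mpr fun y => ?_) _ _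
    exact ContinuousAt.comp (f := fun y : ℝ => (y : ℂ) * Complex.I + v)
      (differentiableAt_kerP hL (X := (y : ℂ) * Complex.I + v)
        (by simp; exact abs_lt.mpr ⟨by linarith, by linarith⟩)
        (exp_ne_one_of_re_ne_zero (by simp; exact h.ne))).continuousAt (by fun_prop)
  rw [h2, intervalIntegral.integral_neg] at h1
  simp only [kerK]
  rw [intervalIntegral.integral_add intervalIntegrable_const (((hc _ _).sub hc2).div_const 2),
    intervalIntegral.integral_div, intervalIntegral.integral_sub (hc _ _) hc2,
    intervalIntegral.integral_const, Complex.real_smul]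
  push_cast
  linear_combination h1 / 2

/-! ### Local integrability of the kernel -/

lemma memLp_inv_norm {q : ℝ≥0∞} (hq0 : q ≠ 0) (hq : q < 2) (R : ℝ) :
    MemLp ((Metric.ball (0 : ℂ) R).indicator fun X => ‖X‖⁻¹) q volume := by
  have hqt : q ≠ ⊤ := (hq.trans (by simp)).ne
  rw [memLp_indicator_iff_restrict measurableSet_ball]
  have hm : AEStronglyMeasurable (fun X : ℂ => ‖X‖⁻¹) (volume.restrict (Metric.ball (0 : ℂ) R)) :=
    (measurable_norm.inv).aestronglyMeasurable
  rw [← integrable_norm_rpow_iff hm hq0 hqt]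
  have h2 : q.toReal < 2 := by
    have := (ENNReal.toReal_lt_toReal hqt (by simp)).mpr hq
    simpa using this
  have := (integrableOn_fun_norm_addHaar (μ := (volume : Measure ℂ)) (E := ℂ) (F := ℝ) (r := R)
    (f := fun y : ℝ => ‖y⁻¹‖ ^ q.toReal)).mpr ?_
  · simpa [IntegrableOn] using this
  · have h3 : IntegrableOn (fun y : ℝ => y ^ (1 - q.toReal)) (Set.Ioo 0 R) := by
      rcases le_or_gt R 0 with h | h
      · simp [Set.Ioo_eq_empty (not_lt.mpr h)]
      · have := (intervalIntegral.intervalIntegrable_rpow' (a := 0) (b := R)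
          (r := 1 - q.toReal) (by linarith))
        rw [intervalIntegrable_iff_integrableOn_Ioo_of_le h.le] at this
        exact this
    refine h3.congr_fun (fun y hy => ?_) measurableSet_Ioo
    have hy0 : 0 < y := hy.1
    simp only [Complex.finrank_real_complex, smul_eq_mul, norm_inv, Real.norm_eq_abs,
      abs_of_pos hy0]
    rw [Real.rpow_sub hy0, Real.rpow_one, Real.inv_rpow hy0.le]
    simp [div_eq_mul_inv]

/-- The kernel cut off outside a rectangle containing all differences and sums of points of the
closed rectangle and of the open one. -/
def kerBox (L : ℝ) : ℂ → ℂ := (poleBox L).indicator (kerP L)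

lemma isOpen_kerP_regular (L : ℝ) : IsOpen {X : ℂ | |X.re| < 2 * L ∧ Complex.exp X ≠ 1} :=
  (isOpen_lt (f := fun X : ℂ => |X.re|) (by fun_prop) continuous_const).inter
    (isOpen_ne_fun Complex.continuous_exp continuous_const)

lemma differentiableOn_kerP {L : ℝ} (hL : 0 < L) :
    DifferentiableOn ℂ (kerP L) {X : ℂ | |X.re| < 2 * L ∧ Complex.exp X ≠ 1} := fun _ hX =>
  (differentiableAt_kerP hL hX.1 hX.2).differentiableWithinAt

lemma measurable_kerBox {L : ℝ} (hL : 0 < L) : Measurable (kerBox L) := by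
  set S : Set ℂ := {X : ℂ | X.re < 2 * L}
  have hS : MeasurableSet S := (isOpen_re_lt _).measurableSet
  have hA : Measurable (S.indicator (kerA L)) := by
    have h1 : ContinuousOn (kerA L) S := fun X hX =>
      (differentiableAt_kerA hL hX).continuousAt.continuousWithinAt
    have h2 := h1.measurable_piecewise (g := 0) continuousOn_const hS
    rwa [Set.piecewise_eq_indicator] at h2
  have hpsi : Measurable psi := Complex.measurable_exp.div (Complex.measurable_exp.const_sub 1)
  have h3 : kerBox L = (poleBox L).indicator fun X =>
      1 + 2 * psi X + 2 * S.indicator (kerA L) X - 2 * S.indicator (kerA L) (-X) := by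
    refine Set.indicator_congr fun X hX => ?_
    obtain ⟨h4, h5⟩ := abs_lt.mp hX.1
    have h6 : -X ∈ S := by simp only [S, Set.mem_ofPred_eq, Complex.neg_re]; linarith
    rw [kerP, Set.indicator_of_mem (show X ∈ S from h5), Set.indicator_of_mem h6]
  rw [h3]
  exact (((measurable_const.add (hpsi.const_mul 2)).add (hA.const_mul 2)).sub
    ((hA.comp measurable_neg).const_mul 2)).indicator (isOpen_poleBox L).measurableSet

lemma exists_norm_kerP_le {L : ℝ} (hL : 0 < L) : ∃ M : ℝ, 0 ≤ M ∧
    ∀ X : ℂ, |X.re| ≤ L → |X.im| ≤ Real.pi → ‖kerP L X‖ ≤ 2 * ‖X‖⁻¹ + M := by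
  have hK : IsCompact (Set.Icc (-L) L ×ℂ Set.Icc (-Real.pi) Real.pi) :=
    isCompact_Icc.reProdIm isCompact_Icc
  obtain ⟨M, hM⟩ := hK.exists_bound_of_continuousOn
    ((differentiableOn_kerE hL).continuousOn.mono fun X hX => by
      have h1 := hX.1
      have h2 := hX.2
      refine ⟨abs_lt.mpr ⟨?_, ?_⟩, abs_lt.mpr ⟨?_, ?_⟩⟩ <;>
        linarith [h1.1, h1.2, h2.1, h2.2, Real.pi_pos])
  refine ⟨max M ‖kerP L 0‖, le_max_of_le_right (norm_nonneg _), fun X h1 h2 => ?_⟩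
  by_cases h0 : X = 0
  · rw [h0]; simp
  · rw [kerP_eq_add_kerE L h0 (exp_ne_one_of_abs_im_lt (by linarith [Real.pi_pos]) h0)]
    refine (norm_add_le _ _).trans (add_le_add (le_of_eq ?_) (le_max_of_le_left ?_))
    · rw [norm_div, norm_neg, Complex.norm_ofNat, div_eq_mul_inv]
    · exact hM X ⟨abs_le.mp h1, abs_le.mp h2⟩

/-- Every point of the box is a lattice translate of a point near the origin, and translating
changes the kernel by at most `2`. -/
lemma exists_translate {L : ℝ} (hL : 0 < L) {X : ℂ} (hX : X ∈ poleBox L) :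
    ∃ a ∈ Finset.Icc (-1 : ℤ) 1, ∃ b ∈ Finset.Icc (-1 : ℤ) 1,
      |(X - (2 * L * a + 2 * Real.pi * b * Complex.I)).re| ≤ L ∧
      |(X - (2 * L * a + 2 * Real.pi * b * Complex.I)).im| ≤ Real.pi ∧
      ‖kerP L X‖ ≤ ‖kerP L (X - (2 * L * a + 2 * Real.pi * b * Complex.I))‖ + 2 := by
  have h2 : ∃ b ∈ Finset.Icc (-1 : ℤ) 1, |X.im - 2 * Real.pi * b| ≤ Real.pi ∧
      ∀ Y : ℂ, kerP L (Y - 2 * Real.pi * b * Complex.I) = kerP L Y := by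
    have hpi := Real.pi_pos
    have h3 := abs_lt.mp hX.2
    rcases le_or_gt X.im Real.pi with h | h
    · rcases le_or_gt (-Real.pi) X.im with h' | h'
      · exact ⟨0, by simp, by simpa using abs_le.mpr ⟨h', h⟩, fun Y => by simp⟩
      · refine ⟨-1, by simp, abs_le.mpr ⟨?_, ?_⟩, fun Y => ?_⟩
        · push_cast; linarith
        · push_cast; linarith
        · rw [← kerP_add_two_pi_I L Y]; congr 1; push_cast; ring
    · refine ⟨1, by simp, abs_le.mpr ⟨?_, ?_⟩, fun Y => ?_⟩
      · push_cast; linarith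
      · push_cast; linarith
      · rw [← kerP_sub_two_pi_I L Y]; congr 1; push_cast; ring
  have h1 : ∃ a ∈ Finset.Icc (-1 : ℤ) 1, |X.re - 2 * L * a| ≤ L ∧
      ‖kerP L X‖ ≤ ‖kerP L (X - 2 * L * a)‖ + 2 := by
    have h3 := abs_lt.mp hX.1
    rcases le_or_gt X.re L with h | h
    · rcases le_or_gt (-L) X.re with h' | h'
      · exact ⟨0, by simp, by simpa using abs_le.mpr ⟨h', h⟩, by simp⟩
      · refine ⟨-1, by simp, abs_le.mpr ⟨?_, ?_⟩, ?_⟩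
        · push_cast; linarith
        · push_cast; linarith
        · have := kerP_add_two_mul hL (X := X) (by linarith) h3.1
          rw [show X - 2 * L * ((-1 : ℤ) : ℂ) = X + (2 * L : ℝ) by push_cast; ring, this]
          have := norm_sub_norm_le (kerP L X) (2 : ℂ)
          rw [Complex.norm_ofNat] at this
          linarith
    · refine ⟨1, by simp, abs_le.mpr ⟨?_, ?_⟩, ?_⟩
      · push_cast; linarith
      · push_cast; linarith
      · have := kerP_sub_two_mul hL (X := X) (by linarith) h3.2
        rw [show X - 2 * L * ((1 : ℤ) : ℂ) = X - (2 * L : ℝ) by push_cast; ring, this]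
        have := norm_sub_norm_le (kerP L X) (-2 : ℂ)
        rw [norm_neg, Complex.norm_ofNat, sub_neg_eq_add] at this
        linarith
  obtain ⟨a, ha, ha1, ha2⟩ := h1
  obtain ⟨b, hb, hb1, hb2⟩ := h2
  refine ⟨a, ha, b, hb, ?_, ?_, ?_⟩
  · simpa using ha1
  · simpa using hb1
  · rw [← sub_sub, hb2]; exact ha2

/-- The kernel, having simple poles, is locally in `L^q` for every `q < 2`. -/
lemma memLp_kerBox {L : ℝ} (hL : 0 < L) {q : ℝ≥0∞} (hq0 : q ≠ 0) (hq : q < 2) :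
    MemLp (kerBox L) q volume := by
  obtain ⟨M, hM0, hM⟩ := exists_norm_kerP_le hL
  set R := L + Real.pi + 1
  set N : ℂ → ℝ := (Metric.ball (0 : ℂ) R).indicator fun X => ‖X‖⁻¹ with hN
  have hN0 : ∀ X, 0 ≤ N X := fun X => Set.indicator_nonneg (fun _ _ => by positivity) X
  have hNq : MemLp N q volume := memLp_inv_norm hq0 hq R
  -- the poles of `kerP` in the closed box are the nine lattice points with indices in `{-1, 0, 1}`
  set G : ℂ → ℝ := fun X => (poleBox L).indicator (fun _ => M + 2) X
    + ∑ a ∈ Finset.Icc (-1 : ℤ) 1, ∑ b ∈ Finset.Icc (-1 : ℤ) 1,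
      2 * N (X - (2 * L * a + 2 * Real.pi * b * Complex.I)) with hG
  have hfin : volume (poleBox L) ≠ ⊤ := by
    have : poleBox L ⊆ Set.Icc (-(2 * L)) (2 * L) ×ℂ Set.Icc (-(2 * Real.pi)) (2 * Real.pi) := by
      intro X hX
      have h1 := abs_lt.mp hX.1
      have h2 := abs_lt.mp hX.2
      exact ⟨⟨h1.1.le, h1.2.le⟩, ⟨h2.1.le, h2.2.le⟩⟩
    exact ((measure_mono this).trans_lt
      (isCompact_Icc.reProdIm isCompact_Icc).measure_lt_top).ne
  have hGq : MemLp G q volume := by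
    refine MemLp.add (memLp_indicator_const q (isOpen_poleBox L).measurableSet _ (Or.inr hfin)) ?_
    refine memLp_finsetSum _ fun a _ => memLp_finsetSum _ fun b _ => ?_
    exact (hNq.comp_measurePreserving (measurePreserving_sub_right volume
      (2 * L * a + 2 * Real.pi * b * Complex.I))).const_mul 2
  refine hGq.mono (measurable_kerBox hL).aestronglyMeasurable (Eventually.of_forall fun X => ?_)
  have hsum0 : ∀ a b : ℤ, 0 ≤ 2 * N (X - (2 * L * a + 2 * Real.pi * b * Complex.I)) :=
    fun a b => mul_nonneg zero_le_two (hN0 _)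
  refine le_trans ?_ (le_abs_self _)
  by_cases hX : X ∈ poleBox L
  · rw [kerBox, Set.indicator_of_mem hX]
    obtain ⟨a, ha, b, hb, h1, h2, h3⟩ := exists_translate hL hX
    set Y := X - (2 * L * a + 2 * Real.pi * b * Complex.I)
    have hY : Y ∈ Metric.ball (0 : ℂ) R := by
      rw [mem_ball_zero_iff]
      have := Complex.norm_le_abs_re_add_abs_im Y
      simp only [R]; linarith
    have h4 : N Y = ‖Y‖⁻¹ := Set.indicator_of_mem hY _
    have h5 : 2 * N Y ≤ ∑ a ∈ Finset.Icc (-1 : ℤ) 1, ∑ b ∈ Finset.Icc (-1 : ℤ) 1,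
        2 * N (X - (2 * L * a + 2 * Real.pi * b * Complex.I)) :=
      (Finset.single_le_sum (f := fun b : ℤ => 2 * N (X - (2 * L * a + 2 * Real.pi * b * Complex.I)))
        (fun b _ => hsum0 a b) hb).trans (Finset.single_le_sum
        (f := fun a : ℤ => ∑ b ∈ Finset.Icc (-1 : ℤ) 1,
          2 * N (X - (2 * L * a + 2 * Real.pi * b * Complex.I)))
        (fun a _ => Finset.sum_nonneg fun b _ => hsum0 a b) ha)
    have h6 := hM Y h1 h2
    simp only [hG, Set.indicator_of_mem hX]
    linarith
  · rw [kerBox, Set.indicator_of_notMem hX, norm_zero]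
    simp only [hG, Set.indicator_of_notMem hX, zero_add]
    exact Finset.sum_nonneg fun a _ => Finset.sum_nonneg fun b _ => hsum0 a b

/-! ### The area potential as a convolution -/

section

lemma integrable_fun_sub {A : Type*} [MeasurableSpace A] {μ : Measure A} {f g : A → ℂ}
    (hf : Integrable f μ) (hg : Integrable g μ) : Integrable (fun x => f x - g x) μ := hf.sub hg

lemma conjExponent_lt_two {p : ℝ≥0∞} (hp : 2 < p) : p.conjExponent < 2 := by
  rw [ENNReal.conjExponent, ← one_add_one_eq_two]
  refine ENNReal.add_lt_add_left (by simp) ?_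
  rw [ENNReal.inv_lt_one]
  exact lt_tsub_iff_left.mpr (by rwa [one_add_one_eq_two])

lemma continuous_convolution_isometry {p q : ℝ≥0∞} (hpq : p.HolderConjugate q) (hq : q ≠ ⊤)
    {K F : ℂ → ℂ} (hK : MemLp K q volume) (hF : MemLp F p volume) (σ : ℂ ≃ₗᵢ[ℝ] ℂ) :
    Continuous fun u : ℂ => ∫ v, K (u - σ v) * F v := by
  have h1 : MemLp (F ∘ σ.symm) p volume := hF.comp_measurePreserving σ.symm.measurePreserving
  refine (continuous_convolution_of_memLp hpq hq hK h1).congr fun u => ?_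
  have := σ.measurePreserving.integral_comp σ.toHomeomorph.measurableEmbedding
    (fun w => K (u - w) * (F ∘ σ.symm) w)
  rw [← this]; simp

lemma integrable_convolution_isometry {p q : ℝ≥0∞} (hpq : p.HolderConjugate q)
    {K F : ℂ → ℂ} (hK : MemLp K q volume) (hF : MemLp F p volume) (σ : ℂ ≃ₗᵢ[ℝ] ℂ) (u : ℂ) :
    Integrable fun v => K (u - σ v) * F v := by
  have hm : MeasurePreserving (fun v : ℂ => u - v) volume volume :=
    Measure.measurePreserving_sub_left volume u
  exact ((hK.comp_measurePreserving (hm.comp σ.measurePreserving))).integrable_mul hF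

/-- The area integral of the kernel, with the pole reflected by `τ`, against a density. -/
def areaTerm (L : ℝ) (τ : ℂ ≃ₗᵢ[ℝ] ℂ) (F : ℂ → ℂ) (u : ℂ) : ℂ :=
  ∫ v in rectDom L, kerK L u (τ v) * F v

/-- The area potential: it vanishes in the real part on the boundary and has the weak
`z̄`-derivative `F`. -/
def areaPot (L : ℝ) (F : ℂ → ℂ) (u : ℂ) : ℂ :=
  -(1 / Real.pi : ℂ) * ∫ v in rectDom L,
    (kerK L u v * F v - kerK L u (starRingEnd ℂ v) * starRingEnd ℂ (F v))

/-- The isometry keeps real parts on the rectangle and maps it into the strip `|Im| < π`.  The identity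
and the conjugation are the two instances in use. -/
def IsMirror (L : ℝ) (τ : ℂ ≃ₗᵢ[ℝ] ℂ) : Prop :=
  ∀ v ∈ rectDom L, (τ v).re = v.re ∧ |(τ v).im| < Real.pi

lemma isMirror_refl (L : ℝ) : IsMirror L (LinearIsometryEquiv.refl ℝ ℂ) := fun v hv => by
  rw [mem_rectDom] at hv
  exact ⟨rfl, by simpa [abs_of_pos hv.2.1] using hv.2.2⟩

lemma isMirror_conj (L : ℝ) : IsMirror L Complex.conjLIE := fun v hv => by
  rw [mem_rectDom] at hv
  exact ⟨by simp, by simpa [abs_of_pos hv.2.1] using hv.2.2⟩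

/-- The kernel with both of its terms cut off, a jointly measurable function. -/
def kerKBox (L : ℝ) (u w : ℂ) : ℂ := 1 + (kerBox L (u - w) - kerBox L (u + w)) / 2

lemma IsMirror.mem_poleBox {L : ℝ} {τ : ℂ ≃ₗᵢ[ℝ] ℂ} (hτ : IsMirror L τ) {u v : ℂ}
    (hu : u ∈ rectClosed L) (hv : v ∈ rectDom L) :
    u - τ v ∈ poleBox L ∧ u + τ v ∈ poleBox L := by
  obtain ⟨h1, h2⟩ := hτ v hv
  obtain ⟨h3, h4⟩ := abs_lt.mp h2
  rw [mem_rectDom] at hv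
  rw [mem_rectClosed] at hu
  refine ⟨⟨?_, ?_⟩, ⟨?_, ?_⟩⟩ <;> rw [abs_lt] <;>
    simp only [Complex.sub_re, Complex.sub_im, Complex.add_re, Complex.add_im, h1] <;>
    constructor <;> linarith

lemma IsMirror.kerKBox_eq {L : ℝ} {τ : ℂ ≃ₗᵢ[ℝ] ℂ} (hτ : IsMirror L τ) {u v : ℂ}
    (hu : u ∈ rectClosed L) (hv : v ∈ rectDom L) : kerKBox L u (τ v) = kerK L u (τ v) := by
  obtain ⟨h1, h2⟩ := hτ.mem_poleBox hu hv
  rw [kerKBox, kerK, kerBox, Set.indicator_of_mem h1, Set.indicator_of_mem h2]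

lemma measurable_kerKBox {L : ℝ} (hL : 0 < L) :
    Measurable fun x : ℂ × ℂ => kerKBox L x.1 x.2 := by
  have h := measurable_kerBox hL
  unfold kerKBox
  exact measurable_const.add (((h.comp (measurable_fst.sub measurable_snd)).sub
    (h.comp (measurable_fst.add measurable_snd))).div_const 2)

lemma volume_rectDom_ne_top (L : ℝ) : volume (rectDom L) ≠ ⊤ :=
  ((measure_mono (rectDom_subset L)).trans_lt (isCompact_rectClosed L).measure_lt_top).ne

instance (L : ℝ) : IsFiniteMeasure (volume.restrict (rectDom L)) :=
  ⟨by simpa using (volume_rectDom_ne_top L).lt_top⟩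

variable {L : ℝ} {p : ℝ≥0∞} {F : ℂ → ℂ} {τ : ℂ ≃ₗᵢ[ℝ] ℂ}

/-- The area integral against the kernel is a constant and two convolutions, one for each of the terms
`kerBox L (u - τ v)` and `kerBox L (u + τ v)`. -/
lemma setIntegral_kerKBox (hL : 0 < L) (hp : 2 < p)
    (hF : MemLp F p (volume.restrict (rectDom L))) (τ : ℂ ≃ₗᵢ[ℝ] ℂ) (u : ℂ) :
    IntegrableOn (fun v => kerKBox L u (τ v) * F v) (rectDom L) ∧
    ∫ v in rectDom L, kerKBox L u (τ v) * F v = (∫ v, (rectDom L).indicator F v)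
      + ((∫ v, kerBox L (u - τ v) * (rectDom L).indicator F v)
        - ∫ v, kerBox L (u - (τ.trans (LinearIsometryEquiv.neg ℝ)) v) * (rectDom L).indicator F v) / 2 := by
  have hpq : p.HolderConjugate p.conjExponent := .conjExponent (le_trans (by simp) hp.le)
  have hK := memLp_kerBox hL (q := p.conjExponent) (by simp [ENNReal.conjExponent])
    (conjExponent_lt_two hp)
  have hF' : MemLp ((rectDom L).indicator F) p volume :=
    (memLp_indicator_iff_restrict (isOpen_rectDom L).measurableSet).mpr hF
  have h0 : Integrable ((rectDom L).indicator F) :=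
    (integrable_indicator_iff (isOpen_rectDom L).measurableSet).mpr
      (hF.integrable (le_trans (by simp) hp.le))
  -- the two terms of the kernel are convolutions, with `τ` and with `-τ`
  have h1 := integrable_convolution_isometry hpq hK hF' τ u
  have h2 := integrable_convolution_isometry hpq hK hF' (τ.trans (LinearIsometryEquiv.neg ℝ)) u
  have hv : ∀ v, (rectDom L).indicator (fun v => kerKBox L u (τ v) * F v) v
      = (rectDom L).indicator F v + (kerBox L (u - τ v) * (rectDom L).indicator F v
        - kerBox L (u - (τ.trans (LinearIsometryEquiv.neg ℝ)) v) * (rectDom L).indicator F v) / 2 := by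
    intro v
    by_cases h : v ∈ rectDom L
    · simp only [Set.indicator_of_mem h, kerKBox, LinearIsometryEquiv.coe_trans,
        Function.comp, LinearIsometryEquiv.coe_neg, sub_neg_eq_add]
      ring
    · simp [Set.indicator_of_notMem h]
  constructor
  · rw [← integrable_indicator_iff (isOpen_rectDom L).measurableSet]
    exact (h0.add ((h1.sub h2).div_const 2)).congr (Eventually.of_forall fun v => (hv v).symm)
  · rw [← integral_indicator (isOpen_rectDom L).measurableSet]
    simp only [hv]
    rw [integral_add h0 ((integrable_fun_sub h1 h2).div_const 2),
      integral_div, integral_sub h1 h2]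

lemma integrableOn_kerK (hL : 0 < L) (hp : 2 < p)
    (hF : MemLp F p (volume.restrict (rectDom L))) (hτ : IsMirror L τ) {u : ℂ}
    (hu : u ∈ rectClosed L) : IntegrableOn (fun v => kerK L u (τ v) * F v) (rectDom L) :=
  (setIntegral_kerKBox hL hp hF τ u).1.congr_fun
    (fun v hv => by simp only [hτ.kerKBox_eq hu hv]) (isOpen_rectDom L).measurableSet

lemma areaTerm_eq (hτ : IsMirror L τ) {u : ℂ} (hu : u ∈ rectClosed L) :
    areaTerm L τ F u = ∫ v in rectDom L, kerKBox L u (τ v) * F v :=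
  setIntegral_congr_fun (isOpen_rectDom L).measurableSet fun v hv => by
    simp only [hτ.kerKBox_eq hu hv]

lemma continuousOn_areaTerm (hL : 0 < L) (hp : 2 < p)
    (hF : MemLp F p (volume.restrict (rectDom L))) (hτ : IsMirror L τ) :
    ContinuousOn (areaTerm L τ F) (rectClosed L) := by
  have hpq : p.HolderConjugate p.conjExponent := .conjExponent (le_trans (by simp) hp.le)
  have hq2 := conjExponent_lt_two hp
  have hK := memLp_kerBox hL (q := p.conjExponent) (by simp [ENNReal.conjExponent]) hq2
  have hF' : MemLp ((rectDom L).indicator F) p volume :=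
    (memLp_indicator_iff_restrict (isOpen_rectDom L).measurableSet).mpr hF
  have hqt : p.conjExponent ≠ ⊤ := (hq2.trans (by simp)).ne
  have h1 := continuous_convolution_isometry hpq hqt hK hF' τ
  have h2 := continuous_convolution_isometry hpq hqt hK hF' (τ.trans (LinearIsometryEquiv.neg ℝ))
  have h3 := (continuous_const (y := ∫ v, (rectDom L).indicator F v)).add ((h1.sub h2).div_const 2)
  refine h3.continuousOn.congr fun u hu => ?_
  rw [areaTerm_eq hτ hu, (setIntegral_kerKBox hL hp hF τ u).2]
  rfl

/-- The integrals of the absolute value are bounded uniformly in the parameter: they are a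
continuous function of it, being again convolutions of functions in conjugate spaces. -/
lemma exists_integral_norm_kerKBox_le (hL : 0 < L) (hp : 2 < p)
    (hF : MemLp F p (volume.restrict (rectDom L))) (τ : ℂ ≃ₗᵢ[ℝ] ℂ) :
    ∃ C : ℝ, ∀ u ∈ rectClosed L, ∫ v in rectDom L, ‖kerKBox L u (τ v) * F v‖ ≤ C := by
  have hpq : p.HolderConjugate p.conjExponent := .conjExponent (le_trans (by simp) hp.le)
  have hq2 := conjExponent_lt_two hp
  have hK : MemLp (fun X => ((‖kerBox L X‖ : ℝ) : ℂ)) p.conjExponent volume :=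
    (memLp_kerBox hL (q := p.conjExponent) (by simp [ENNReal.conjExponent]) hq2).norm.ofReal
  have hF' : MemLp (fun v => ((‖(rectDom L).indicator F v‖ : ℝ) : ℂ)) p volume :=
    ((memLp_indicator_iff_restrict (isOpen_rectDom L).measurableSet).mpr hF).norm.ofReal
  have hqt : p.conjExponent ≠ ⊤ := (hq2.trans (by simp)).ne
  set S : ℂ → ℂ := fun u => (∫ v, ((‖(rectDom L).indicator F v‖ : ℝ) : ℂ))
      + ((∫ v, ((‖kerBox L (u - τ v)‖ : ℝ) : ℂ) * ((‖(rectDom L).indicator F v‖ : ℝ) : ℂ))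
      + ∫ v, ((‖kerBox L (u - (τ.trans (LinearIsometryEquiv.neg ℝ)) v)‖ : ℝ) : ℂ)
        * ((‖(rectDom L).indicator F v‖ : ℝ) : ℂ)) / 2 with hS
  have hSc : Continuous S := continuous_const.add
    (((continuous_convolution_isometry hpq hqt hK hF' τ).add
    (continuous_convolution_isometry hpq hqt hK hF' (τ.trans (LinearIsometryEquiv.neg ℝ)))).div_const 2)
  obtain ⟨C, hC⟩ := (isCompact_rectClosed L).exists_bound_of_continuousOn hSc.continuousOn
  refine ⟨C, fun u hu => le_trans ?_ (hC u hu)⟩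
  have h0 : Integrable fun v => ((‖(rectDom L).indicator F v‖ : ℝ) : ℂ) :=
    ((integrable_indicator_iff (isOpen_rectDom L).measurableSet).mpr
      (hF.integrable (le_trans (by simp) hp.le))).norm.ofReal
  have h1 := integrable_convolution_isometry hpq hK hF' τ u
  have h2 := integrable_convolution_isometry hpq hK hF' (τ.trans (LinearIsometryEquiv.neg ℝ)) u
  have h3 : S u = ∫ v, (((‖(rectDom L).indicator F v‖ + (‖kerBox L (u - τ v)‖
      * ‖(rectDom L).indicator F v‖ + ‖kerBox L (u - (τ.trans (LinearIsometryEquiv.neg ℝ)) v)‖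
      * ‖(rectDom L).indicator F v‖) / 2 : ℝ)) : ℂ) := by
    push_cast
    rw [integral_add h0 ((h1.fun_add h2).div_const 2),
      integral_div, integral_add h1 h2]
  have h4 : Integrable fun v => (‖(rectDom L).indicator F v‖ + (‖kerBox L (u - τ v)‖
      * ‖(rectDom L).indicator F v‖ + ‖kerBox L (u - (τ.trans (LinearIsometryEquiv.neg ℝ)) v)‖
      * ‖(rectDom L).indicator F v‖) / 2 : ℝ) := by
    have := (h0.add ((h1.add h2).div_const 2)).re
    refine this.congr (Eventually.of_forall fun v => ?_)
    simp
  rw [h3, integral_complex_ofReal, Complex.norm_real, ← integral_indicator (isOpen_rectDom L).measurableSet]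
  refine le_trans (integral_mono_of_nonneg ?_ h4 ?_) (le_abs_self _)
  · exact Eventually.of_forall fun v => Set.indicator_nonneg (fun _ _ => norm_nonneg _) v
  · refine Eventually.of_forall fun v => ?_
    by_cases h : v ∈ rectDom L
    · simp only [Set.indicator_of_mem h, kerKBox, LinearIsometryEquiv.coe_trans,
        Function.comp, LinearIsometryEquiv.coe_neg, sub_neg_eq_add, norm_mul]
      have h5 : ‖1 + (kerBox L (u - τ v) - kerBox L (u + τ v)) / 2‖
          ≤ 1 + (‖kerBox L (u - τ v)‖ + ‖kerBox L (u + τ v)‖) / 2 := by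
        refine (norm_add_le _ _).trans ?_
        rw [norm_one, norm_div, Complex.norm_ofNat]
        gcongr
        exact norm_sub_le _ _
      nlinarith [norm_nonneg (F v)]
    · simp [Set.indicator_of_notMem h]

/-- Fubini's theorem for the kernel against a density and a bounded measurable weight on a finite
measure space mapped to the closed rectangle. -/
lemma integrable_kerKBox_prod (hL : 0 < L) (hp : 2 < p)
    (hF : MemLp F p (volume.restrict (rectDom L))) (τ : ℂ ≃ₗᵢ[ℝ] ℂ)
    {A : Type*} [MeasurableSpace A] {μ : Measure A} [IsFiniteMeasure μ] {ι : A → ℂ}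
    (hι : Measurable ι) (hιmem : ∀ᵐ a ∂μ, ι a ∈ rectClosed L) {g : A → ℂ} (hg : AEStronglyMeasurable g μ)
    {M : ℝ} (hM : ∀ a, ‖g a‖ ≤ M) :
    Integrable (Function.uncurry fun (a : A) (v : ℂ) => kerKBox L (ι a) (τ v) * F v * g a)
      (μ.prod (volume.restrict (rectDom L))) := by
  obtain ⟨C, hC⟩ := exists_integral_norm_kerKBox_le hL hp hF τ
  have hmeas : AEStronglyMeasurable
      (Function.uncurry fun (a : A) (v : ℂ) => kerKBox L (ι a) (τ v) * F v * g a)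
      (μ.prod (volume.restrict (rectDom L))) := by
    refine AEStronglyMeasurable.mul (AEStronglyMeasurable.mul ?_ hF.1.comp_snd) hg.comp_fst
    exact ((measurable_kerKBox hL).comp ((hι.comp measurable_fst).prodMk
      (τ.continuous.measurable.comp measurable_snd))).aestronglyMeasurable
  rw [integrable_prod_iff hmeas]
  refine ⟨Eventually.of_forall fun a => ((setIntegral_kerKBox hL hp hF τ (ι a)).1.mul_const (g a)), ?_⟩
  refine Integrable.of_bound hmeas.norm.integral_prod_right' (C * M) ?_
  filter_upwards [hιmem] with a ha
  have h1 : ∀ v, ‖Function.uncurry (fun (a : A) (v : ℂ) => kerKBox L (ι a) (τ v) * F v * g a) (a, v)‖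
      = ‖kerKBox L (ι a) (τ v) * F v‖ * ‖g a‖ := fun v => by simp [Function.uncurry]
  simp only [h1]
  rw [integral_mul_const, norm_mul, norm_norm, Real.norm_of_nonneg (integral_nonneg fun _ => norm_nonneg _)]
  exact mul_le_mul (hC _ ha) (hM a) (norm_nonneg _)
    (le_trans (integral_nonneg fun _ => norm_nonneg _) (hC _ ha))

end

/-! ### The area potential: equation, boundary values and normalization -/

section

variable {L : ℝ} {p : ℝ≥0∞} {F : ℂ → ℂ} {τ : ℂ ≃ₗᵢ[ℝ] ℂ}

lemma memLp_conj {A : Type*} [MeasurableSpace A] {μ : Measure A} {F : A → ℂ} (hF : MemLp F p μ) :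
    MemLp (fun v => starRingEnd ℂ (F v)) p μ :=
  hF.of_le (Complex.continuous_conj.comp_aestronglyMeasurable hF.1)
    (Eventually.of_forall fun v => by simp)

lemma integrableOn_areaPot (hL : 0 < L) (hp : 2 < p)
    (hF : MemLp F p (volume.restrict (rectDom L))) {u : ℂ} (hu : u ∈ rectClosed L) :
    IntegrableOn (fun v => kerK L u v * F v) (rectDom L) ∧
    IntegrableOn (fun v => kerK L u (starRingEnd ℂ v) * starRingEnd ℂ (F v)) (rectDom L) :=
  ⟨integrableOn_kerK hL hp hF (isMirror_refl L) hu,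
    integrableOn_kerK hL hp (memLp_conj hF) (isMirror_conj L) hu⟩

lemma areaPot_eq (hL : 0 < L) (hp : 2 < p)
    (hF : MemLp F p (volume.restrict (rectDom L))) {u : ℂ} (hu : u ∈ rectClosed L) :
    areaPot L F u = -(1 / Real.pi : ℂ) * (areaTerm L (LinearIsometryEquiv.refl ℝ ℂ) F u
      - areaTerm L Complex.conjLIE (fun v => starRingEnd ℂ (F v)) u) := by
  obtain ⟨h1, h2⟩ := integrableOn_areaPot hL hp hF hu
  rw [areaPot, integral_sub h1 h2]; rfl

lemma continuousOn_areaPot (hL : 0 < L) (hp : 2 < p)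
    (hF : MemLp F p (volume.restrict (rectDom L))) :
    ContinuousOn (areaPot L F) (rectClosed L) :=
  (((continuousOn_areaTerm hL hp hF (isMirror_refl L)).sub
    (continuousOn_areaTerm hL hp (memLp_conj hF) (isMirror_conj L))).const_mul
      (-(1 / Real.pi : ℂ))).congr fun _ hu => areaPot_eq hL hp hF hu

/-- For `u` on the boundary the kernels with poles at `v` and at its conjugate are conjugate to each
other, so the integrand is imaginary. -/
lemma areaPot_re_eq_zero (hL : 0 < L) (F : ℂ → ℂ) {u : ℂ} (hu : u ∈ rectClosed L)
    (hu' : u ∉ rectDom L) : (areaPot L F u).re = 0 := by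
  have h1 : ∀ v ∈ rectDom L, kerK L u v * F v
      - kerK L u (starRingEnd ℂ v) * starRingEnd ℂ (F v)
      = ((2 * (kerK L u v * F v).im : ℝ) : ℂ) * Complex.I := by
    intro v hv
    have h2 : kerK L u (starRingEnd ℂ v) = starRingEnd ℂ (kerK L u v) := by
      rw [← kerK_conj_left hL hu hu' hv, ← kerK_conj_conj, Complex.conj_conj]
    rw [h2, ← map_mul, Complex.sub_conj]
  rw [areaPot, setIntegral_congr_fun (isOpen_rectDom L).measurableSet h1, integral_mul_const,
    integral_complex_ofReal, show (-(1 / Real.pi) : ℂ) = ((-(1 / Real.pi) : ℝ) : ℂ) by push_cast; rfl,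
    ← mul_assoc, ← Complex.ofReal_mul]
  simp

lemma integrable_kerKBox_right (hL : 0 < L) (v : ℂ) {s : Set ℂ} (hs : volume s ≠ ⊤) :
    IntegrableOn (fun u => kerKBox L u v) s := by
  have h := (memLp_one_iff_integrable.mp (memLp_kerBox hL one_ne_zero (by simp)))
  have hc : IntegrableOn (fun _ : ℂ => (1 : ℂ)) s := integrableOn_const hs
  exact hc.add (((h.comp_sub_right v).sub (h.comp_add_right v)).div_const 2).integrableOn

/-- The kernel paired with `∂φ/∂z̄` reproduces the test function: its only pole in the rectangle is
`-1 / (u - v)`. -/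
lemma setIntegral_kerK_mul_dbar (hL : 0 < L) {φ : ℂ → ℂ} (hφ : ContDiff ℝ 1 φ)
    (hc : HasCompactSupport φ) (hs : tsupport φ ⊆ rectDom L) {v : ℂ} (hv : v ∈ rectDom L) :
    ∫ u in rectDom L, kerK L u v * dbar φ u = Real.pi * φ v := by
  have hO := isOpen_rectDom L
  -- the kernel is this holomorphic function minus `1 / (u - v)`
  set h : ℂ → ℂ := fun u => 1 + (kerE L (u - v) - kerP L (u + v)) / 2 with hh
  rw [mem_rectDom] at hv
  have hhd : DifferentiableOn ℂ h (rectDom L) := by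
    intro u hu
    rw [mem_rectDom] at hu
    have hbox : u - v ∈ poleBox L := by
      refine ⟨?_, ?_⟩ <;> rw [abs_lt] <;> simp only [Complex.sub_re, Complex.sub_im] <;>
        constructor <;> linarith
    have h1 : DifferentiableAt ℂ (fun u => kerE L (u - v)) u :=
      ((differentiableOn_kerE hL).differentiableAt ((isOpen_poleBox L).mem_nhds hbox)).comp u
        (differentiableAt_id.sub_const v)
    have h2 : DifferentiableAt ℂ (fun u => kerP L (u + v)) u := by
      refine DifferentiableAt.comp u (differentiableAt_kerP hL ?_ (exp_ne_one_of_re_ne_zero ?_))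
        (differentiableAt_id.add_const v)
      · simp only [Complex.add_re]; rw [abs_lt]; constructor <;> linarith
      · simp only [Complex.add_re]; linarith
    exact (((h1.sub h2).div_const 2).const_add 1).differentiableWithinAt
  have hd0 := continuous_dbar hφ
  have hdc := hasCompactSupport_dbar hc
  have i1 : IntegrableOn (fun u => h u * dbar φ u) (rectDom L) :=
    ((continuous_mul_of_tsupport_subset hO hhd.continuousOn hd0
      ((tsupport_dbar_subset φ).trans hs)).integrable_of_hasCompactSupport hdc.mul_left).integrableOn
  have hkey : ∀ u ∈ rectDom L, u ≠ v →
      kerK L u v * dbar φ u = h u * dbar φ u - dbar φ u / (u - v) := by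
    intro u hu huv
    rw [mem_rectDom] at hu
    have h3 : u - v ≠ 0 := sub_ne_zero.mpr huv
    rw [kerK, kerP_eq_add_kerE L h3 (exp_ne_one_of_abs_im_lt ?_ h3)]
    · simp only [hh]; field_simp; ring
    · simp only [Complex.sub_im]; rw [abs_lt]; constructor <;> linarith
  have hae : ∀ᵐ u ∂(volume.restrict (rectDom L)),
      kerK L u v * dbar φ u = h u * dbar φ u - dbar φ u / (u - v) := by
    have hne : ∀ᵐ u ∂(volume.restrict (rectDom L)), u ≠ v := Measure.ae_ne _ v
    filter_upwards [hne, ae_restrict_mem hO.measurableSet] with u h1 h2 using hkey u h2 h1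
  obtain ⟨M, hM⟩ := hdc.exists_bound_of_continuous hd0
  have i2 : IntegrableOn (fun u => kerK L u v * dbar φ u) (rectDom L) := by
    have h4 := (integrable_kerKBox_right hL v (volume_rectDom_ne_top L)).mul_bdd (c := M)
      hd0.aestronglyMeasurable.restrict (Eventually.of_forall hM)
    refine IntegrableOn.congr_fun h4 (fun u hu => ?_) hO.measurableSet
    have := (isMirror_refl L).kerKBox_eq (rectDom_subset L hu) (mem_rectDom.mpr hv)
    simp only [LinearIsometryEquiv.coe_refl, id] at this
    simp only [this]
  have i3 : IntegrableOn (fun u => dbar φ u / (u - v)) (rectDom L) := by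
    refine (i1.sub i2).congr ?_
    filter_upwards [hae] with u hu
    simp only [Pi.sub_apply, hu]; ring
  rw [integral_congr_ae hae, integral_sub i1 i3,
    setIntegral_mul_dbar_of_differentiableOn hO hhd hφ hc hs,
    setIntegral_eq_integral_of_forall_compl_eq_zero, integral_dbar_div_sub hφ hc]
  · ring
  · intro u hu
    rw [dbar_eq_zero_of_notMem_tsupport fun h' => hu (hs h'), zero_div]

/-- The reflected kernel has no pole in the rectangle. -/
lemma setIntegral_kerK_conj_mul_dbar (hL : 0 < L) {φ : ℂ → ℂ} (hφ : ContDiff ℝ 1 φ)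
    (hc : HasCompactSupport φ) (hs : tsupport φ ⊆ rectDom L) {v : ℂ} (hv : v ∈ rectDom L) :
    ∫ u in rectDom L, kerK L u (starRingEnd ℂ v) * dbar φ u = 0 := by
  have hpi := Real.pi_pos
  rw [mem_rectDom] at hv
  refine setIntegral_mul_dbar_of_differentiableOn (isOpen_rectDom L) (fun u hu => ?_) hφ hc hs
  rw [mem_rectDom] at hu
  have h1 : DifferentiableAt ℂ (fun u => kerP L (u - starRingEnd ℂ v)) u := by
    have him : (u - starRingEnd ℂ v).im ≠ 0 := by
      simp only [Complex.sub_im, Complex.conj_im]; linarith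
    refine DifferentiableAt.comp u (differentiableAt_kerP hL ?_ (exp_ne_one_of_abs_im_lt ?_
      fun h => him (by rw [show u - starRingEnd ℂ v = 0 from h]; rfl)))
      (differentiableAt_id.sub_const _)
    · simp only [Complex.sub_re, Complex.conj_re]; rw [abs_lt]; constructor <;> linarith
    · simp only [Complex.sub_im, Complex.conj_im]; rw [abs_lt]; constructor <;> linarith
  have h2 : DifferentiableAt ℂ (fun u => kerP L (u + starRingEnd ℂ v)) u := by
    refine DifferentiableAt.comp u (differentiableAt_kerP hL ?_ (exp_ne_one_of_re_ne_zero ?_))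
      (differentiableAt_id.add_const _)
    · simp only [Complex.add_re, Complex.conj_re]; rw [abs_lt]; constructor <;> linarith
    · simp only [Complex.add_re, Complex.conj_re]; linarith
  exact (((h1.sub h2).div_const 2).const_add 1).differentiableWithinAt

/-- Pairing an area term with `∂φ/∂z̄`, by Fubini's theorem. -/
lemma setIntegral_areaTerm_mul_dbar (hL : 0 < L) (hp : 2 < p)
    (hF : MemLp F p (volume.restrict (rectDom L))) (hτ : IsMirror L τ) {φ : ℂ → ℂ}
    (hφ : ContDiff ℝ 1 φ) (hc : HasCompactSupport φ) :
    ∫ u in rectDom L, areaTerm L τ F u * dbar φ u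
      = ∫ v in rectDom L, F v * ∫ u in rectDom L, kerK L u (τ v) * dbar φ u := by
  have hm := (isOpen_rectDom L).measurableSet
  obtain ⟨M, hM⟩ := (hasCompactSupport_dbar hc).exists_bound_of_continuous (continuous_dbar hφ)
  have hint := integrable_kerKBox_prod hL hp hF τ (μ := volume.restrict (rectDom L)) (ι := id)
    measurable_id (by filter_upwards [ae_restrict_mem hm] with u hu using rectDom_subset L hu)
    (g := dbar φ) (continuous_dbar hφ).aestronglyMeasurable hM
  have h1 := integral_integral_swap hint
  calc ∫ u in rectDom L, areaTerm L τ F u * dbar φ u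
      = ∫ u in rectDom L, ∫ v in rectDom L, kerKBox L (id u) (τ v) * F v * dbar φ u := by
        refine setIntegral_congr_fun hm fun u hu => ?_
        simp only [areaTerm_eq hτ (rectDom_subset L hu), id, integral_mul_const]
    _ = _ := h1
    _ = _ := by
        refine setIntegral_congr_fun hm fun v hv => ?_
        rw [← integral_const_mul]
        refine setIntegral_congr_fun hm fun u hu => ?_
        simp only [id, hτ.kerKBox_eq (rectDom_subset L hu) hv]
        ring

/-- The area potential solves the inhomogeneous equation. -/
lemma hasWeakDbar_areaPot (hL : 0 < L) (hp : 2 < p)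
    (hF : MemLp F p (volume.restrict (rectDom L))) : HasWeakDbar (rectDom L) (areaPot L F) F := by
  intro φ hφ hc hs
  have hφ1 : ContDiff ℝ 1 φ := hφ.of_le (by exact_mod_cast le_top)
  have hm := (isOpen_rectDom L).measurableSet
  have hcont : ∀ {τ : ℂ ≃ₗᵢ[ℝ] ℂ} {G : ℂ → ℂ}, IsMirror L τ →
      MemLp G p (volume.restrict (rectDom L)) →
      IntegrableOn (fun u => areaTerm L τ G u * dbar φ u) (rectDom L) := fun hτ hG =>
    ((continuous_mul_of_tsupport_subset (isOpen_rectDom L)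
      ((continuousOn_areaTerm hL hp hG hτ).mono (rectDom_subset L)) (continuous_dbar hφ1)
      ((tsupport_dbar_subset φ).trans hs)).integrable_of_hasCompactSupport
      (hasCompactSupport_dbar hc).mul_left).integrableOn
  have h1 : ∀ u ∈ rectDom L, areaPot L F u * dbar φ u = -(1 / Real.pi : ℂ) *
      (areaTerm L (LinearIsometryEquiv.refl ℝ ℂ) F u * dbar φ u
      - areaTerm L Complex.conjLIE (fun v => starRingEnd ℂ (F v)) u * dbar φ u) := fun u hu => by
    rw [areaPot_eq hL hp hF (rectDom_subset L hu)]; ring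
  rw [setIntegral_congr_fun hm h1, integral_const_mul,
    integral_sub (hcont (isMirror_refl L) hF) (hcont (isMirror_conj L) (memLp_conj hF)),
    setIntegral_areaTerm_mul_dbar hL hp hF (isMirror_refl L) hφ1 hc,
    setIntegral_areaTerm_mul_dbar hL hp (memLp_conj hF) (isMirror_conj L) hφ1 hc]
  have h2 : ∫ v in rectDom L, F v * ∫ u in rectDom L,
      kerK L u (LinearIsometryEquiv.refl ℝ ℂ v) * dbar φ u
      = ∫ v in rectDom L, (Real.pi : ℂ) * (F v * φ v) :=
    setIntegral_congr_fun hm fun v hv => by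
      simp only [LinearIsometryEquiv.coe_refl, id, setIntegral_kerK_mul_dbar hL hφ1 hc hs hv]
      ring
  have h3 : ∫ v in rectDom L, starRingEnd ℂ (F v) * ∫ u in rectDom L,
      kerK L u (Complex.conjLIE v) * dbar φ u = 0 :=
    setIntegral_eq_zero_of_forall_eq_zero fun v hv => by
      simp only [Complex.conjLIE_apply, setIntegral_kerK_conj_mul_dbar hL hφ1 hc hs hv, mul_zero]
  rw [h2, h3, integral_const_mul]
  have := Complex.ofReal_ne_zero.mpr Real.pi_ne_zero
  field_simp
  ring

/-- The kernel has mean zero over the right side, so by Fubini's theorem so have the area integrals. -/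
lemma integral_areaTerm (hL : 0 < L) (hp : 2 < p)
    (hF : MemLp F p (volume.restrict (rectDom L))) (hτ : IsMirror L τ) :
    ∫ y in (0:ℝ)..Real.pi, areaTerm L τ F (y * Complex.I) = 0 := by
  have hpi := Real.pi_pos
  have hm := (isOpen_rectDom L).measurableSet
  have hmem : ∀ y ∈ Set.Ioc (0:ℝ) Real.pi, (y : ℂ) * Complex.I ∈ rectClosed L := fun y hy =>
    mem_rectClosed.mpr (by simp; exact ⟨hL.le, hy.1.le, hy.2⟩)
  have hint := integrable_kerKBox_prod hL hp hF τ (μ := volume.restrict (Set.Ioc 0 Real.pi))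
    (ι := fun y : ℝ => (y : ℂ) * Complex.I) (by fun_prop)
    (by filter_upwards [ae_restrict_mem measurableSet_Ioc] with y hy using hmem y hy)
    (g := fun _ => 1) aestronglyMeasurable_const (M := 1) (by simp)
  rw [intervalIntegral.integral_of_le hpi.le]
  calc ∫ y in Set.Ioc 0 Real.pi, areaTerm L τ F (y * Complex.I)
      = ∫ y in Set.Ioc 0 Real.pi, ∫ v in rectDom L,
          kerKBox L (y * Complex.I) (τ v) * F v * 1 := by
        refine setIntegral_congr_fun measurableSet_Ioc fun y hy => ?_
        simp only [areaTerm_eq hτ (hmem y hy), mul_one]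
    _ = _ := integral_integral_swap hint
    _ = 0 := by
        refine setIntegral_eq_zero_of_forall_eq_zero fun v hv => ?_
        have h1 : ∀ y ∈ Set.Ioc 0 Real.pi, kerKBox L (y * Complex.I) (τ v) * F v * 1
            = kerK L (y * Complex.I) (τ v) * F v := fun y hy => by
          rw [hτ.kerKBox_eq (hmem y hy) hv, mul_one]
        rw [setIntegral_congr_fun measurableSet_Ioc h1, integral_mul_const,
          ← intervalIntegral.integral_of_le hpi.le, integral_kerK_left hL, zero_mul]
        · rw [(hτ v hv).1]; exact hv.1.1
        · rw [(hτ v hv).1]; exact hv.1.2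

lemma integral_areaPot (hL : 0 < L) (hp : 2 < p)
    (hF : MemLp F p (volume.restrict (rectDom L))) :
    ∫ y in (0:ℝ)..Real.pi, areaPot L F (y * Complex.I) = 0 := by
  have hmem : ∀ y ∈ Set.uIcc (0:ℝ) Real.pi, (y : ℂ) * Complex.I ∈ rectClosed L := fun y hy => by
    rw [Set.uIcc_of_le Real.pi_pos.le] at hy
    exact mem_rectClosed.mpr (by simp; exact ⟨hL.le, hy.1, hy.2⟩)
  have hi : ∀ {τ : ℂ ≃ₗᵢ[ℝ] ℂ} {G : ℂ → ℂ}, IsMirror L τ →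
      MemLp G p (volume.restrict (rectDom L)) →
      IntervalIntegrable (fun y : ℝ => areaTerm L τ G (y * Complex.I)) volume 0 Real.pi :=
    fun hτ hG => ((continuousOn_areaTerm hL hp hG hτ).comp (by fun_prop)
      fun y hy => hmem y hy).intervalIntegrable
  rw [intervalIntegral.integral_congr fun y hy => areaPot_eq hL hp hF (hmem y hy),
    intervalIntegral.integral_const_mul, intervalIntegral.integral_sub (hi (isMirror_refl L) hF)
    (hi (isMirror_conj L) (memLp_conj hF)), integral_areaTerm hL hp hF (isMirror_refl L),
    integral_areaTerm hL hp (memLp_conj hF) (isMirror_conj L)]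
  simp

end

/-! ### The residue theorem on the rectangle and the Schwarz representation -/

section

/-- The boundary of the rectangle. -/
def rectBdry (L : ℝ) : Set ℂ := rectClosed L \ rectDom L

/-- The counter-clockwise line integral over the boundary of the rectangle. -/
def rectInt (L : ℝ) (f : ℂ → ℂ) : ℂ :=
  (∫ x : ℝ in (-L)..0, f x) - (∫ x : ℝ in (-L)..0, f (x + Real.pi * Complex.I))
    + Complex.I * (∫ y : ℝ in (0:ℝ)..Real.pi, f (y * Complex.I))
    - Complex.I * ∫ y : ℝ in (0:ℝ)..Real.pi, f (-L + y * Complex.I)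

variable {L : ℝ}

lemma bottom_mem {x : ℝ} (hx : x ∈ Set.Icc (-L) 0) : (x : ℂ) ∈ rectBdry L := by
  have := Real.pi_pos
  simp only [rectBdry, Set.mem_sdiff, mem_rectClosed, mem_rectDom]
  simpa [this.le] using hx

lemma top_mem {x : ℝ} (hx : x ∈ Set.Icc (-L) 0) : (x + Real.pi * Complex.I : ℂ) ∈ rectBdry L := by
  have := Real.pi_pos
  simp only [rectBdry, Set.mem_sdiff, mem_rectClosed, mem_rectDom]
  simpa [this.le] using hx

lemma right_mem (hL : 0 < L) {y : ℝ} (hy : y ∈ Set.Icc 0 Real.pi) :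
    (y * Complex.I : ℂ) ∈ rectBdry L := by
  simp only [rectBdry, Set.mem_sdiff, mem_rectClosed, mem_rectDom]
  simpa [hL.le] using hy

lemma left_mem (hL : 0 < L) {y : ℝ} (hy : y ∈ Set.Icc 0 Real.pi) :
    (-L + y * Complex.I : ℂ) ∈ rectBdry L := by
  simp only [rectBdry, Set.mem_sdiff, mem_rectClosed, mem_rectDom]
  simpa [hL.le] using hy

lemma uIcc_horizontal (hL : 0 < L) : Set.uIcc (-L) 0 = Set.Icc (-L) 0 :=
  Set.uIcc_of_le (by linarith)

lemma uIcc_vertical : Set.uIcc 0 Real.pi = Set.Icc 0 Real.pi := Set.uIcc_of_le Real.pi_pos.le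

lemma intervalIntegrable_sides (hL : 0 < L) {f : ℂ → ℂ} (hf : ContinuousOn f (rectBdry L)) :
    IntervalIntegrable (fun x : ℝ => f x) volume (-L) 0 ∧
    IntervalIntegrable (fun x : ℝ => f (x + Real.pi * Complex.I)) volume (-L) 0 ∧
    IntervalIntegrable (fun y : ℝ => f (y * Complex.I)) volume 0 Real.pi ∧
    IntervalIntegrable (fun y : ℝ => f (-L + y * Complex.I)) volume 0 Real.pi := by
  refine ⟨?_, ?_, ?_, ?_⟩
  · exact (hf.comp (by fun_prop) fun x hx => bottom_mem (uIcc_horizontal hL ▸ hx)).intervalIntegrable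
  · exact (hf.comp (by fun_prop) fun x hx => top_mem (uIcc_horizontal hL ▸ hx)).intervalIntegrable
  · exact (hf.comp (by fun_prop) fun x hx => right_mem hL (uIcc_vertical ▸ hx)).intervalIntegrable
  · exact (hf.comp (by fun_prop) fun x hx => left_mem hL (uIcc_vertical ▸ hx)).intervalIntegrable

lemma rectInt_congr (hL : 0 < L) {f g : ℂ → ℂ} (h : ∀ v ∈ rectBdry L, f v = g v) :
    rectInt L f = rectInt L g := by
  rw [rectInt, rectInt,
    intervalIntegral.integral_congr fun x hx => h _ (bottom_mem (uIcc_horizontal hL ▸ hx)),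
    intervalIntegral.integral_congr fun x hx => h _ (top_mem (uIcc_horizontal hL ▸ hx)),
    intervalIntegral.integral_congr fun x hx => h _ (right_mem hL (uIcc_vertical ▸ hx)),
    intervalIntegral.integral_congr fun x hx => h _ (left_mem hL (uIcc_vertical ▸ hx))]

lemma rectInt_add (hL : 0 < L) {f g : ℂ → ℂ} (hf : ContinuousOn f (rectBdry L))
    (hg : ContinuousOn g (rectBdry L)) :
    rectInt L (fun v => f v + g v) = rectInt L f + rectInt L g := by
  obtain ⟨f1, f2, f3, f4⟩ := intervalIntegrable_sides hL hf
  obtain ⟨g1, g2, g3, g4⟩ := intervalIntegrable_sides hL hg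
  simp only [rectInt, intervalIntegral.integral_add f1 g1, intervalIntegral.integral_add f2 g2,
    intervalIntegral.integral_add f3 g3, intervalIntegral.integral_add f4 g4]
  ring

lemma rectInt_const_mul (c : ℂ) (f : ℂ → ℂ) :
    rectInt L (fun v => c * f v) = c * rectInt L f := by
  simp only [rectInt, intervalIntegral.integral_const_mul]
  ring

lemma rectInt_eq_zero (hL : 0 < L) {f : ℂ → ℂ} (hc : ContinuousOn f (rectClosed L))
    (hd : DifferentiableOn ℂ f (rectDom L)) : rectInt L f = 0 := by
  have h1 : -L ≤ 0 := by linarith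
  have h2 := Real.pi_pos.le
  have := Complex.integral_boundary_rect_eq_zero_of_continuousOn_of_differentiableOn f
    ⟨-L, 0⟩ ⟨0, Real.pi⟩ (by simpa only [rectClosed, Set.uIcc_of_le h1, Set.uIcc_of_le h2] using hc)
    (by simp only [min_eq_left h1, max_eq_right h1, min_eq_left h2, max_eq_right h2]; exact hd)
  simpa [rectInt] using this

lemma log_I_mul {w : ℂ} (hw : 0 < w.re) :
    Complex.log (Complex.I * w) = Complex.log w + Real.pi / 2 * Complex.I := by
  have hw0 : w ≠ 0 := fun h => by simp [h] at hw
  have harg : |w.arg| < Real.pi / 2 := Complex.abs_arg_lt_pi_div_two_iff.mpr (Or.inl hw)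
  rw [abs_lt] at harg
  rw [Complex.log_mul_eq_add_log_iff Complex.I_ne_zero hw0 |>.mpr, Complex.log_I]
  · ring
  · rw [Complex.arg_I]; constructor <;> linarith [harg.1, harg.2]

/-- Integral of `1 / w` along a segment whose rotation by `ρ` lies in the right half plane. -/
lemma integral_inv_segment {ρ c d : ℂ} (hρ : ρ ≠ 0) (a b : ℝ)
    (h : ∀ t : ℝ, 0 < (ρ * (c + t * d)).re) :
    d * ∫ t in a..b, (c + t * d)⁻¹
      = Complex.log (ρ * (c + b * d)) - Complex.log (ρ * (c + a * d)) := by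
  have hne : ∀ t : ℝ, c + t * d ≠ 0 := fun t h0 => by
    have := h t; rw [h0] at this; simp at this
  have hd : ∀ t : ℝ, HasDerivAt (fun t : ℝ => Complex.log (ρ * (c + t * d)))
      (d * (c + t * d)⁻¹) t := by
    intro t
    have h1 : HasDerivAt (fun t : ℝ => ρ * (c + t * d)) (ρ * (1 * d)) t :=
      (((Complex.ofRealCLM.hasDerivAt (x := t)).mul_const d).const_add c).const_mul ρ
    have h2 := h1.clog_real (Complex.mem_slitPlane_iff.mpr (Or.inl (h t)))
    convert! h2 using 1
    have := hne t
    field_simp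
  rw [← intervalIntegral.integral_const_mul,
    intervalIntegral.integral_eq_sub_of_hasDerivAt (fun t _ => hd t)]
  refine Continuous.intervalIntegrable (continuous_const.mul (Continuous.inv₀ (by fun_prop) hne)) _ _

/-- The winding number of the boundary of the rectangle is `1`: each corner contributes a quarter
turn. -/
lemma rectInt_inv {u : ℂ} (hu : u ∈ rectDom L) :
    rectInt L (fun v => (v - u)⁻¹) = 2 * Real.pi * Complex.I := by
  rw [mem_rectDom] at hu
  obtain ⟨⟨h1, h2⟩, h3, h4⟩ := hu
  have e1 := integral_inv_segment (ρ := Complex.I) (c := -u) (d := 1) Complex.I_ne_zero (-L) 0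
    (fun t => by simpa using h3)
  have e2 := integral_inv_segment (ρ := -Complex.I) (c := Real.pi * Complex.I - u) (d := 1)
    (neg_ne_zero.mpr Complex.I_ne_zero) (-L) 0 (fun t => by simpa using h4)
  have e3 := integral_inv_segment (ρ := 1) (c := -u) (d := Complex.I) one_ne_zero 0 Real.pi
    (fun t => by simpa using h2)
  have e4 := integral_inv_segment (ρ := -1) (c := -L - u) (d := Complex.I)
    (neg_ne_zero.mpr one_ne_zero) 0 Real.pi (fun t => by simp; linarith)
  have l1 := log_I_mul (w := -u) (by simpa using h2)
  have l2 := log_I_mul (w := Complex.I * (-u + -L)) (by simpa using h3)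
  have l3 := log_I_mul (w := -Complex.I * (-u + Real.pi * Complex.I)) (by simpa using h4)
  have l4 := log_I_mul (w := -(-L + Real.pi * Complex.I - u)) (by simp; linarith)
  have r1 : ∫ x : ℝ in (-L)..0, ((x : ℂ) - u)⁻¹ = 1 * ∫ t : ℝ in (-L)..0, (-u + t * 1)⁻¹ := by
    rw [one_mul]; exact intervalIntegral.integral_congr fun x _ => by congr 1; ring
  have r2 : ∫ x : ℝ in (-L)..0, ((x : ℂ) + Real.pi * Complex.I - u)⁻¹
      = 1 * ∫ t : ℝ in (-L)..0, (Real.pi * Complex.I - u + t * 1)⁻¹ := by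
    rw [one_mul]; exact intervalIntegral.integral_congr fun x _ => by congr 1; ring
  have r3 : ∫ y : ℝ in (0:ℝ)..Real.pi, ((y : ℂ) * Complex.I - u)⁻¹
      = ∫ y : ℝ in (0:ℝ)..Real.pi, (-u + y * Complex.I)⁻¹ :=
    intervalIntegral.integral_congr fun x _ => by congr 1; ring
  have r4 : ∫ y : ℝ in (0:ℝ)..Real.pi, (-L + (y : ℂ) * Complex.I - u)⁻¹
      = ∫ y : ℝ in (0:ℝ)..Real.pi, (-L - u + y * Complex.I)⁻¹ :=
    intervalIntegral.integral_congr fun x _ => by congr 1; ring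
  rw [rectInt, r1, r2, r3, r4, e1, e2, e3, e4]
  have hI := Complex.I_mul_I
  rw [show Complex.I * (Complex.I * (-u + -(L:ℂ))) = u + L by linear_combination (-u - L) * hI] at l2
  rw [show Complex.I * (-Complex.I * (-u + Real.pi * Complex.I)) = -u + Real.pi * Complex.I by
    linear_combination (u - Real.pi * Complex.I) * hI] at l3
  rw [show Complex.I * -(-(L:ℂ) + Real.pi * Complex.I - u)
    = -Complex.I * (-(L:ℂ) + Real.pi * Complex.I - u) by ring] at l4
  push_cast
  simp only [zero_mul, mul_one, add_zero, one_mul, neg_mul, neg_add_rev] at *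
  ring_nf at *
  linear_combination l1 + l2 + l3 + l4


lemma kerP_mem_of_add {u v : ℂ} (hu : u ∈ rectDom L) (hv : v ∈ rectClosed L) :
    |(u + v).re| < 2 * L ∧ Complex.exp (u + v) ≠ 1 := by
  rw [mem_rectDom] at hu
  rw [mem_rectClosed] at hv
  refine ⟨abs_lt.mpr ⟨by simp; linarith, by simp; linarith⟩, exp_ne_one_of_re_ne_zero ?_⟩
  simp; linarith

lemma sub_mem_poleBox {u v : ℂ} (hu : u ∈ rectDom L) (hv : v ∈ rectClosed L) :
    u - v ∈ poleBox L := by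
  have := Real.pi_pos
  rw [mem_rectDom] at hu
  rw [mem_rectClosed] at hv
  exact ⟨abs_lt.mpr ⟨by simp; linarith, by simp; linarith⟩,
    abs_lt.mpr ⟨by simp; linarith, by simp; linarith⟩⟩

lemma differentiableAt_kerK_right (hL : 0 < L) {u v : ℂ} (hu : u ∈ rectDom L)
    (hv : v ∈ rectClosed L) (h : u ≠ v) : DifferentiableAt ℂ (kerK L u) v := by
  have h1 := kerP_mem_of_add hu hv
  have h2 := sub_mem_poleBox hu hv
  have h3 := differentiableAt_kerP hL h1.1 h1.2
  have h4 := differentiableAt_kerP hL h2.1 (exp_ne_one_of_abs_im_lt h2.2 (sub_ne_zero.mpr h))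
  unfold kerK
  exact ((h4.comp v (differentiableAt_id.const_sub u)).sub
    (h3.comp v (differentiableAt_id.const_add u))).div_const 2 |>.const_add 1

lemma differentiableAt_kerK_conj (hL : 0 < L) {u v : ℂ} (hu : u ∈ rectDom L)
    (hv : v ∈ rectClosed L) : DifferentiableAt ℂ (kerK L (starRingEnd ℂ u)) v := by
  rw [mem_rectDom] at hu
  rw [mem_rectClosed] at hv
  have hpi := Real.pi_pos
  have h3 := differentiableAt_kerP hL (X := starRingEnd ℂ u + v)
    (abs_lt.mpr ⟨by simp; linarith, by simp; linarith⟩)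
    (exp_ne_one_of_re_ne_zero (by simp; linarith))
  have h4 := differentiableAt_kerP hL (X := starRingEnd ℂ u - v)
    (abs_lt.mpr ⟨by simp; linarith, by simp; linarith⟩)
    (exp_ne_one_of_abs_im_lt (abs_lt.mpr ⟨by simp; linarith, by simp; linarith⟩)
      (fun h => by have := congrArg Complex.im h; simp at this; linarith))
  unfold kerK
  exact ((h4.comp v (differentiableAt_id.const_sub _)).sub
    (h3.comp v (differentiableAt_id.const_add _))).div_const 2 |>.const_add 1

lemma continuousOn_kerK_rectBdry (hL : 0 < L) {u : ℂ} (hu : u ∈ rectDom L) :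
    ContinuousOn (kerK L u) (rectBdry L) := fun _ hv =>
  (differentiableAt_kerK_right hL hu hv.1 fun h => hv.2 (h ▸ hu)).continuousAt.continuousWithinAt

/-- The residue theorem for the kernel, whose only pole in the rectangle is at `v = u`. -/
lemma rectInt_kerK_mul (hL : 0 < L) {u : ℂ} (hu : u ∈ rectDom L) {D : ℂ → ℂ}
    (hc : ContinuousOn D (rectClosed L)) (hd : DifferentiableOn ℂ D (rectDom L)) :
    rectInt L (fun v => kerK L u v * D v) = 2 * Real.pi * Complex.I * D u := by
  have hnhds : rectDom L ∈ 𝓝 u := (isOpen_rectDom L).mem_nhds hu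
  -- the kernel is this holomorphic function plus `1 / (v - u)`
  set h : ℂ → ℂ := fun v => 1 + (kerE L (u - v) - kerP L (u + v)) / 2 with hh
  have hhd : ∀ v ∈ rectClosed L, DifferentiableAt ℂ h v := by
    intro v hv
    have h1 := kerP_mem_of_add hu hv
    have h2 := sub_mem_poleBox hu hv
    have h3 := differentiableAt_kerP hL h1.1 h1.2
    have h4 := (differentiableOn_kerE hL).differentiableAt ((isOpen_poleBox L).mem_nhds h2)
    exact ((h4.comp v (differentiableAt_id.const_sub u)).sub
      (h3.comp v (differentiableAt_id.const_add u))).div_const 2 |>.const_add 1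
  have hsub : rectDom L ⊆ rectClosed L := rectDom_subset L
  have hcl : rectClosed L ∈ 𝓝 u := Filter.mem_of_superset hnhds hsub
  have hreg1 : ContinuousOn (fun v => h v * D v + dslope D u v) (rectClosed L) :=
    (ContinuousOn.mul (fun v hv => (hhd v hv).continuousAt.continuousWithinAt) hc).add
      ((continuousOn_dslope hcl).mpr ⟨hc, hd.differentiableAt hnhds⟩)
  have hreg2 : DifferentiableOn ℂ (fun v => h v * D v + dslope D u v) (rectDom L) :=
    (DifferentiableOn.mul (fun v hv => (hhd v (hsub hv)).differentiableWithinAt) hd).add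
      ((Complex.differentiableOn_dslope hnhds).mpr hd)
  have hne : ∀ v ∈ rectBdry L, v - u ≠ 0 := fun v hv h0 => hv.2 (sub_eq_zero.mp h0 ▸ hu)
  have hdec : ∀ v ∈ rectBdry L,
      kerK L u v * D v = (h v * D v + dslope D u v) + D u * (v - u)⁻¹ := by
    intro v hv
    have h0 := hne v hv
    have h0' : u - v ≠ 0 := fun h => h0 (by linear_combination -h)
    rw [dslope_of_ne D (sub_ne_zero.mp h0), slope_def_field, kerK,
      kerP_eq_add_kerE L h0' (exp_ne_one_of_abs_im_lt (sub_mem_poleBox hu hv.1).2 h0')]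
    simp only [hh]
    rw [← neg_sub v u]
    field_simp
    ring
  rw [rectInt_congr hL hdec, rectInt_add hL (hreg1.mono Set.sdiff_subset)
    (show ContinuousOn (fun v => D u * (v - u)⁻¹) _ from
      continuousOn_const.mul ((continuousOn_id.sub continuousOn_const).inv₀ hne)),
    rectInt_eq_zero hL hreg1 hreg2, rectInt_const_mul, rectInt_inv hu]
  ring

/-- With the point reflected out of the rectangle the kernel has no pole, so the integral vanishes. -/
lemma rectInt_kerK_conj_mul (hL : 0 < L) {u : ℂ} (hu : u ∈ rectDom L) {D : ℂ → ℂ}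
    (hc : ContinuousOn D (rectClosed L)) (hd : DifferentiableOn ℂ D (rectDom L)) :
    rectInt L (fun v => kerK L (starRingEnd ℂ u) v * D v) = 0 :=
  rectInt_eq_zero hL
    (ContinuousOn.mul (fun _ hv =>
      (differentiableAt_kerK_conj hL hu hv).continuousAt.continuousWithinAt) hc)
    (DifferentiableOn.mul (fun _ hv =>
      (differentiableAt_kerK_conj hL hu (rectDom_subset L hv)).differentiableWithinAt) hd)

/-- The boundary operator of the Schwarz problem in the rectangle. -/
def bdOp (L : ℝ) (g : ℂ → ℝ) (u : ℂ) : ℂ :=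
  1 / (Real.pi * Complex.I) * (rectInt L (fun v => g v * kerK L u v)
    - Complex.I * ∫ y : ℝ in (0:ℝ)..Real.pi, (g (y * Complex.I) : ℂ))

lemma intervalIntegral_conj (f : ℝ → ℂ) (a b : ℝ) :
    starRingEnd ℂ (∫ t in a..b, f t) = ∫ t in a..b, starRingEnd ℂ (f t) := by
  simp only [intervalIntegral, map_sub, integral_conj]

lemma rectInt_conj (f : ℂ → ℂ) : starRingEnd ℂ (rectInt L f)
    = (∫ x : ℝ in (-L)..0, starRingEnd ℂ (f x))
      - (∫ x : ℝ in (-L)..0, starRingEnd ℂ (f (x + Real.pi * Complex.I)))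
      - Complex.I * (∫ y : ℝ in (0:ℝ)..Real.pi, starRingEnd ℂ (f (y * Complex.I)))
      + Complex.I * ∫ y : ℝ in (0:ℝ)..Real.pi, starRingEnd ℂ (f (-L + y * Complex.I)) := by
  simp only [rectInt, map_add, map_sub, map_mul, Complex.conj_I, intervalIntegral_conj]
  ring

/-- The Schwarz representation: a holomorphic function is recovered from the boundary values of its
real part and the mean of its imaginary part over the right side. -/
theorem eq_bdOp_add (hL : 0 < L) {u : ℂ} (hu : u ∈ rectDom L) {D : ℂ → ℂ}
    (hc : ContinuousOn D (rectClosed L)) (hd : DifferentiableOn ℂ D (rectDom L)) :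
    D u = bdOp L (fun v => (D v).re) u
      + Complex.I / Real.pi * ∫ y : ℝ in (0:ℝ)..Real.pi, ((D (y * Complex.I)).im : ℂ) := by
  have hu' := mem_rectDom.mp hu
  have h1 := rectInt_kerK_mul hL hu hc hd
  have h2 := congrArg (starRingEnd ℂ) (rectInt_kerK_conj_mul hL hu hc hd)
  rw [rectInt_conj, map_zero] at h2
  rw [rectInt] at h1
  have hcb : ContinuousOn D (rectBdry L) := hc.mono Set.sdiff_subset
  have hk := continuousOn_kerK_rectBdry hL hu
  have hkc : ContinuousOn (fun v => kerK L (starRingEnd ℂ u) v) (rectBdry L) := fun v hv =>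
    (differentiableAt_kerK_conj hL hu hv.1).continuousAt.continuousWithinAt
  have hre : ContinuousOn (fun v => ((D v).re : ℂ)) (rectBdry L) :=
    Complex.continuous_ofReal.comp_continuousOn (Complex.continuous_re.comp_continuousOn hcb)
  have him : ContinuousOn (fun v => ((D v).im : ℂ)) (rectBdry L) :=
    Complex.continuous_ofReal.comp_continuousOn (Complex.continuous_im.comp_continuousOn hcb)
  obtain ⟨a1, a2, a3, a4⟩ := intervalIntegrable_sides hL (hk.fun_mul hcb)
  obtain ⟨b1, b2, b3, b4⟩ := intervalIntegrable_sides hL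
    (show ContinuousOn (fun v => starRingEnd ℂ (kerK L (starRingEnd ℂ u) v * D v)) _ from
      Complex.continuous_conj.comp_continuousOn (hkc.fun_mul hcb))
  obtain ⟨c1, c2, c3, c4⟩ := intervalIntegrable_sides hL (hre.fun_mul hk)
  obtain ⟨-, -, d3, -⟩ := intervalIntegrable_sides hL hre
  obtain ⟨-, -, e3, -⟩ := intervalIntegrable_sides hL him
  -- the reflected kernel, side by side
  have hconj : ∀ v : ℂ, starRingEnd ℂ (kerK L (starRingEnd ℂ u) v)
      = kerK L u (starRingEnd ℂ v) := fun v => by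
    rw [← kerK_conj_conj, Complex.conj_conj]
  have hD : ∀ v : ℂ, D v = ((D v).re : ℂ) + (D v).im * Complex.I := fun v => (Complex.re_add_im _).symm
  have hD' : ∀ v : ℂ, starRingEnd ℂ (D v) = ((D v).re : ℂ) - (D v).im * Complex.I := fun v => by
    apply Complex.ext <;> simp
  have s1 := intervalIntegral.integral_add a1 b1
  have s2 := intervalIntegral.integral_add a2 b2
  have s3 := intervalIntegral.integral_sub a3 b3
  have s4 := intervalIntegral.integral_sub a4 b4
  have t1 : ∀ v : ℂ, (v.im = 0 ∨ v.im = Real.pi) → kerK L u v * D v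
      + starRingEnd ℂ (kerK L (starRingEnd ℂ u) v * D v) = 2 * ((D v).re * kerK L u v) := by
    intro v hv
    rw [map_mul, hconj, kerK_conj_right_of_im L u hv, hD']
    linear_combination kerK L u v * hD v
  have t3 : ∀ v : ℂ, v.re = 0 → kerK L u v * D v
      - starRingEnd ℂ (kerK L (starRingEnd ℂ u) v * D v)
      = 2 * ((D v).re * kerK L u v) - 2 * (D v).re + 2 * Complex.I * (D v).im := by
    intro v hv
    rw [map_mul, hconj, kerK_conj_right_of_re_zero L u hv, hD']
    linear_combination kerK L u v * hD v
  have t4 : ∀ v : ℂ, v.re = -L → kerK L u v * D v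
      - starRingEnd ℂ (kerK L (starRingEnd ℂ u) v * D v) = 2 * ((D v).re * kerK L u v) := by
    intro v hv
    rw [map_mul, hconj, kerK_conj_right_of_re hL hu'.1.1 hu'.1.2 hv, hD']
    linear_combination kerK L u v * hD v
  have s1' : ∫ x : ℝ in (-L)..0, (kerK L u x * D x + starRingEnd ℂ (kerK L (starRingEnd ℂ u) x * D x))
      = 2 * ∫ x : ℝ in (-L)..0, ((D x).re * kerK L u x : ℂ) := by
    rw [← intervalIntegral.integral_const_mul]
    exact intervalIntegral.integral_congr fun x _ => t1 _ (by simp)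
  have s2' : ∫ x : ℝ in (-L)..0, (kerK L u (x + Real.pi * Complex.I) * D (x + Real.pi * Complex.I)
        + starRingEnd ℂ (kerK L (starRingEnd ℂ u) (x + Real.pi * Complex.I)
          * D (x + Real.pi * Complex.I)))
      = 2 * ∫ x : ℝ in (-L)..0, ((D (x + Real.pi * Complex.I)).re
          * kerK L u (x + Real.pi * Complex.I) : ℂ) := by
    rw [← intervalIntegral.integral_const_mul]
    exact intervalIntegral.integral_congr fun x _ => t1 _ (by simp)
  have s3' : ∫ y : ℝ in (0:ℝ)..Real.pi, (kerK L u (y * Complex.I) * D (y * Complex.I)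
        - starRingEnd ℂ (kerK L (starRingEnd ℂ u) (y * Complex.I) * D (y * Complex.I)))
      = 2 * (∫ y : ℝ in (0:ℝ)..Real.pi, ((D (y * Complex.I)).re * kerK L u (y * Complex.I) : ℂ))
        - 2 * (∫ y : ℝ in (0:ℝ)..Real.pi, ((D (y * Complex.I)).re : ℂ))
        + 2 * Complex.I * ∫ y : ℝ in (0:ℝ)..Real.pi, ((D (y * Complex.I)).im : ℂ) := by
    rw [← intervalIntegral.integral_const_mul, ← intervalIntegral.integral_const_mul,
      ← intervalIntegral.integral_const_mul,
      ← intervalIntegral.integral_sub (c3.const_mul 2) (d3.const_mul 2),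
      ← intervalIntegral.integral_add ((c3.const_mul 2).sub (d3.const_mul 2)) (e3.const_mul _)]
    exact intervalIntegral.integral_congr fun x _ => t3 _ (by simp)
  have s4' : ∫ y : ℝ in (0:ℝ)..Real.pi, (kerK L u (-L + y * Complex.I) * D (-L + y * Complex.I)
        - starRingEnd ℂ (kerK L (starRingEnd ℂ u) (-L + y * Complex.I) * D (-L + y * Complex.I)))
      = 2 * ∫ y : ℝ in (0:ℝ)..Real.pi, ((D (-L + y * Complex.I)).re
          * kerK L u (-L + y * Complex.I) : ℂ) := by
    rw [← intervalIntegral.integral_const_mul]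
    exact intervalIntegral.integral_congr fun x _ => t4 _ (by simp)
  have u1 := s1'.symm.trans s1
  have u2 := s2'.symm.trans s2
  have u3 := s3'.symm.trans s3
  have u4 := s4'.symm.trans s4
  have hpi : (Real.pi : ℂ) ≠ 0 := Complex.ofReal_ne_zero.mpr Real.pi_ne_zero
  rw [bdOp, rectInt]
  have hI := Complex.I_ne_zero
  have hred : ∀ X V : ℂ, 1 / (Real.pi * Complex.I) * X + Complex.I / Real.pi * V
      = (2 * X - 2 * V) / (2 * Real.pi * Complex.I) := fun X V => by
    field_simp
    linear_combination V * Complex.I_sq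
  rw [hred, eq_div_iff (mul_ne_zero (mul_ne_zero two_ne_zero hpi) hI)]
  linear_combination -h1 - h2 - (u1 - u2 + Complex.I * u3 - Complex.I * u4)
    + 2 * (∫ y : ℝ in (0:ℝ)..Real.pi, ((D (y * Complex.I)).im : ℂ)) * Complex.I_sq

end

/-! ### Boundary values of the boundary operator -/

section

variable {L : ℝ}

lemma closure_rectDom (hL : 0 < L) : closure (rectDom L) = rectClosed L := by
  rw [rectDom, Complex.closure_reProdIm, closure_Ioo (by linarith), closure_Ioo Real.pi_pos.ne,
    rectClosed]

lemma frontier_rectDom (hL : 0 < L) : frontier (rectDom L) = rectBdry L := by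
  rw [frontier, closure_rectDom hL, (isOpen_rectDom L).interior_eq, rectBdry]

lemma isCompact_rectBdry (L : ℝ) : IsCompact (rectBdry L) :=
  (isCompact_rectClosed L).diff (isOpen_rectDom L)

/-- The maximum principle for the real part of a holomorphic function, from the maximum modulus
principle for its exponential. -/
lemma re_le_of_rectBdry (hL : 0 < L) {D : ℂ → ℂ} (hc : ContinuousOn D (rectClosed L))
    (hd : DifferentiableOn ℂ D (rectDom L)) {M : ℝ} (hM : ∀ v ∈ rectBdry L, (D v).re ≤ M)
    {u : ℂ} (hu : u ∈ rectDom L) : (D u).re ≤ M := by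
  have hcl : DiffContOnCl ℂ (fun v => Complex.exp (D v)) (rectDom L) :=
    ⟨hd.cexp, by rw [closure_rectDom hL]; exact hc.cexp⟩
  have hb : Bornology.IsBounded (rectDom L) :=
    (isCompact_rectClosed L).isBounded.subset (rectDom_subset L)
  have := Complex.norm_le_of_forall_mem_frontier_norm_le hb hcl (C := Real.exp M)
    (fun z hz => by
      rw [frontier_rectDom hL] at hz
      rw [Complex.norm_exp]
      exact Real.exp_le_exp.mpr (hM z hz)) (subset_closure hu)
  rwa [Complex.norm_exp, Real.exp_le_exp] at this

lemma abs_re_le_of_rectBdry (hL : 0 < L) {D : ℂ → ℂ} (hc : ContinuousOn D (rectClosed L))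
    (hd : DifferentiableOn ℂ D (rectDom L)) {M : ℝ} (hM : ∀ v ∈ rectBdry L, |(D v).re| ≤ M)
    {u : ℂ} (hu : u ∈ rectDom L) : |(D u).re| ≤ M := by
  refine abs_le.mpr ⟨?_, re_le_of_rectBdry hL hc hd (fun v hv => (abs_le.mp (hM v hv)).2) hu⟩
  have := re_le_of_rectBdry hL hc.fun_neg hd.fun_neg (M := M)
    (fun v hv => by simpa using neg_le.mp (abs_le.mp (hM v hv)).1) hu
  simp only [Complex.neg_re] at this
  linarith

/-- Continuous data on a compact set are uniformly approximated by smooth functions on the plane. -/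
lemma exists_contDiff_abs_sub_le {K : Set ℂ} (hK : IsCompact K) {g : ℂ → ℝ}
    (hg : ContinuousOn g K) {ε : ℝ} (hε : 0 < ε) :
    ∃ G : ℂ → ℝ, ContDiff ℝ ∞ G ∧ ∀ v ∈ K, |G v - g v| ≤ ε := by
  obtain ⟨f, hf⟩ := ContinuousMap.exists_restrict_eq hK.isClosed ⟨_, hg.domRestrict⟩
  have hfg : ∀ v ∈ K, f v = g v := fun v hv => by
    simpa using congrArg (fun F => F ⟨v, hv⟩) hf
  have hun := hK.uniformContinuousAt_of_continuousAt f (fun v _ => f.continuous.continuousAt)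
    (Metric.dist_mem_uniformity hε)
  obtain ⟨δ, hδ, hδ'⟩ := Metric.mem_uniformity_dist.mp hun
  obtain ⟨G, hG, hG'⟩ := f.continuous.exists_contDiff_dist_le_of_forall_mem_ball_dist_le hδ
  refine ⟨G, hG, fun v hv => ?_⟩
  rw [← hfg v hv, ← Real.dist_eq]
  refine hG' v ε fun x hx => ?_
  have := hδ' (Metric.mem_ball'.mp hx) hv
  rw [dist_comm]
  exact le_of_lt this

lemma bdOp_congr (hL : 0 < L) {g h : ℂ → ℝ} (hgh : ∀ v ∈ rectBdry L, g v = h v) (u : ℂ) :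
    bdOp L g u = bdOp L h u := by
  rw [bdOp, bdOp, rectInt_congr hL fun v hv => by rw [hgh v hv]]
  rw [intervalIntegral.integral_congr fun y hy => by
    rw [hgh _ (right_mem hL (uIcc_vertical ▸ hy))]]

lemma bdOp_sub (hL : 0 < L) {g h : ℂ → ℝ} (hg : ContinuousOn g (rectBdry L))
    (hh : ContinuousOn h (rectBdry L)) {u : ℂ} (hu : u ∈ rectDom L) :
    bdOp L (fun v => g v - h v) u = bdOp L g u - bdOp L h u := by
  have hk := continuousOn_kerK_rectBdry hL hu
  have hg' : ContinuousOn (fun v => (g v : ℂ)) (rectBdry L) :=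
    Complex.continuous_ofReal.comp_continuousOn hg
  have hh' : ContinuousOn (fun v => (h v : ℂ)) (rectBdry L) :=
    Complex.continuous_ofReal.comp_continuousOn hh
  have h1 := rectInt_add hL (hg'.fun_mul hk) ((hh'.fun_neg).fun_mul hk)
  have h2 : rectInt L (fun v => -(h v : ℂ) * kerK L u v) = -rectInt L (fun v => h v * kerK L u v) := by
    simpa using rectInt_const_mul (L := L) (-1) fun v => h v * kerK L u v
  have h3 := intervalIntegral.integral_sub (intervalIntegrable_sides hL hg').2.2.1
    (intervalIntegrable_sides hL hh').2.2.1
  simp only [bdOp, Complex.ofReal_sub, h3]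
  rw [h2] at h1
  rw [show (fun v => ((g v : ℂ) - h v) * kerK L u v)
    = fun v => (g v : ℂ) * kerK L u v + -(h v : ℂ) * kerK L u v by ext; ring, h1]
  ring

lemma norm_rectInt_le (hL : 0 < L) {f : ℂ → ℂ} {M : ℝ} (hM : ∀ v ∈ rectBdry L, ‖f v‖ ≤ M) :
    ‖rectInt L f‖ ≤ M * (2 * L + 2 * Real.pi) := by
  have hπ := Real.pi_pos
  have h1 : ‖∫ x : ℝ in (-L)..0, f x‖ ≤ M * |0 - -L| :=
    intervalIntegral.norm_integral_le_of_norm_le_const fun x hx =>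
      hM _ (bottom_mem (uIcc_horizontal hL ▸ Set.uIoc_subset_uIcc hx))
  have h2 : ‖∫ x : ℝ in (-L)..0, f (x + Real.pi * Complex.I)‖ ≤ M * |0 - -L| :=
    intervalIntegral.norm_integral_le_of_norm_le_const fun x hx =>
      hM _ (top_mem (uIcc_horizontal hL ▸ Set.uIoc_subset_uIcc hx))
  have h3 : ‖∫ y : ℝ in (0:ℝ)..Real.pi, f (y * Complex.I)‖ ≤ M * |Real.pi - 0| :=
    intervalIntegral.norm_integral_le_of_norm_le_const fun x hx =>
      hM _ (right_mem hL (uIcc_vertical ▸ Set.uIoc_subset_uIcc hx))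
  have h4 : ‖∫ y : ℝ in (0:ℝ)..Real.pi, f (-L + y * Complex.I)‖ ≤ M * |Real.pi - 0| :=
    intervalIntegral.norm_integral_le_of_norm_le_const fun x hx =>
      hM _ (left_mem hL (uIcc_vertical ▸ Set.uIoc_subset_uIcc hx))
  rw [zero_sub, neg_neg, abs_of_pos hL] at h1 h2
  rw [sub_zero, abs_of_pos hπ] at h3 h4
  rw [rectInt]
  calc _ ≤ _ := norm_sub_le _ _
    _ ≤ _ := add_le_add_left (norm_add_le _ _) _
    _ ≤ _ := add_le_add_left (add_le_add_left (norm_sub_le _ _) _) _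
    _ ≤ M * L + M * L + M * Real.pi + M * Real.pi := by
      rw [norm_mul, norm_mul, Complex.norm_I, one_mul, one_mul]; gcongr
    _ = _ := by ring

lemma exists_norm_bdOp_le (hL : 0 < L) {u : ℂ} (hu : u ∈ rectDom L) :
    ∃ C : ℝ, 0 ≤ C ∧ ∀ (g : ℂ → ℝ) (M : ℝ), 0 ≤ M → (∀ v ∈ rectBdry L, |g v| ≤ M) →
      ‖bdOp L g u‖ ≤ C * M := by
  obtain ⟨K, hK⟩ := (isCompact_rectBdry L).exists_bound_of_continuousOn
    (continuousOn_kerK_rectBdry hL hu)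
  have hπ := Real.pi_pos
  refine ⟨1 / Real.pi * (|K| * (2 * L + 2 * Real.pi) + Real.pi), by positivity, fun g M hM0 hM => ?_⟩
  have h1 := norm_rectInt_le hL (f := fun v => g v * kerK L u v) (M := M * |K|) fun v hv => by
    rw [norm_mul, Complex.norm_real, Real.norm_eq_abs]
    exact mul_le_mul (hM v hv) ((hK v hv).trans (le_abs_self K)) (norm_nonneg _) hM0
  have h2 : ‖∫ y : ℝ in (0:ℝ)..Real.pi, (g (y * Complex.I) : ℂ)‖ ≤ M * |Real.pi - 0| :=
    intervalIntegral.norm_integral_le_of_norm_le_const fun x hx => by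
      rw [Complex.norm_real, Real.norm_eq_abs]
      exact hM _ (right_mem hL (uIcc_vertical ▸ Set.uIoc_subset_uIcc hx))
  rw [sub_zero, abs_of_pos hπ] at h2
  rw [bdOp, norm_mul]
  have h3 : ‖(1 / (Real.pi * Complex.I) : ℂ)‖ = 1 / Real.pi := by
    rw [norm_div, norm_mul, Complex.norm_I, Complex.norm_real, Real.norm_eq_abs, abs_of_pos hπ]; simp
  rw [h3, mul_assoc]
  gcongr
  refine (norm_sub_le _ _).trans ?_
  rw [norm_mul, Complex.norm_I, one_mul]
  linarith

/-- For smooth boundary data the boundary operator differs from the data by an area potential, so it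
extends continuously to the closed rectangle. -/
lemma exists_extension_bdOp (hL : 0 < L) {G : ℂ → ℝ} (hG : ContDiff ℝ ∞ G) :
    ∃ D : ℂ → ℂ, ContinuousOn D (rectClosed L) ∧ DifferentiableOn ℂ D (rectDom L) ∧
      (∀ v ∈ rectBdry L, (D v).re = G v) ∧ (∀ u ∈ rectDom L, D u = bdOp L G u) ∧
      ∫ y : ℝ in (0:ℝ)..Real.pi, (D (y * Complex.I)).im = 0 := by
  set H : ℂ → ℂ := fun v => (G v : ℂ) with hH
  have hHs : ContDiff ℝ 1 H :=
    Complex.ofRealCLM.contDiff.comp (hG.of_le (by exact_mod_cast le_top))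
  have hF : MemLp (dbar H) ⊤ (volume.restrict (rectDom L)) := by
    obtain ⟨K, hK⟩ := (isCompact_rectClosed L).exists_bound_of_continuousOn
      (continuous_dbar hHs).continuousOn
    refine memLp_top_of_bound (continuous_dbar hHs).aestronglyMeasurable K ?_
    exact (ae_restrict_iff' (isOpen_rectDom L).measurableSet).mpr
      (ae_of_all _ fun v hv => hK v (rectDom_subset L hv))
  have hp : (2 : ℝ≥0∞) < ⊤ := ENNReal.ofNat_lt_top
  have hA := continuousOn_areaPot hL hp hF
  -- `H` and the area potential have the same `z̄`-derivative, so `D` is holomorphic by Weyl's lemma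
  set D : ℂ → ℂ := fun v => H v - areaPot L (dbar H) v with hD
  have hc : ContinuousOn D (rectClosed L) := hHs.continuous.continuousOn.sub hA
  have hd : DifferentiableOn ℂ D (rectDom L) := by
    refine HasWeakDbar.differentiableOn (isOpen_rectDom L) (hc.mono (rectDom_subset L)) ?_
    intro φ hφ hφc hφs
    have hφ1 : ContDiff ℝ 1 φ := hφ.of_le (by exact_mod_cast le_top)
    have h1 := setIntegral_mul_dbar (isOpen_rectDom L) hHs.contDiffOn hφ1 hφc hφs
    have h2 := hasWeakDbar_areaPot hL hp hF φ hφ hφc hφs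
    have i1 : Integrable (fun z => H z * dbar φ z) (volume.restrict (rectDom L)) :=
      ((hHs.continuous.mul (continuous_dbar hφ1)).integrable_of_hasCompactSupport
        ((hasCompactSupport_dbar hφc).mul_left)).restrict
    have i2 : Integrable (fun z => areaPot L (dbar H) z * dbar φ z)
        (volume.restrict (rectDom L)) := by
      have : IntegrableOn (fun z => areaPot L (dbar H) z * dbar φ z) (rectClosed L) :=
        (hA.mul (continuous_dbar hφ1).continuousOn).integrableOn_compact (isCompact_rectClosed L)
      exact this.mono_set (rectDom_subset L)
    simp only [hD, sub_mul, Pi.zero_apply, zero_mul, integral_zero, neg_zero]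
    rw [integral_sub i1 i2, h1, h2]
    ring
  have hre : ∀ v ∈ rectBdry L, (D v).re = G v := fun v hv => by
    simp [hD, hH, areaPot_re_eq_zero hL _ hv.1 hv.2]
  have him : ∫ y : ℝ in (0:ℝ)..Real.pi, (D (y * Complex.I)).im = 0 := by
    have h0 := integral_areaPot hL hp hF
    have hint : IntervalIntegrable (fun y : ℝ => areaPot L (dbar H) (y * Complex.I)) volume 0 Real.pi :=
      (intervalIntegrable_sides hL (hA.mono Set.sdiff_subset)).2.2.1
    have h1 : ∫ y : ℝ in (0:ℝ)..Real.pi, (areaPot L (dbar H) (y * Complex.I)).im = 0 := by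
      have := Complex.imCLM.intervalIntegral_comp_comm hint
      simp only [Complex.imCLM_apply] at this
      rw [this, h0, Complex.zero_im]
    simpa [hD, hH] using h1
  refine ⟨D, hc, hd, hre, fun u hu => ?_, him⟩
  have := eq_bdOp_add hL hu hc hd
  rw [intervalIntegral.integral_ofReal, him, Complex.ofReal_zero, mul_zero, add_zero,
    bdOp_congr hL hre] at this
  exact this

/-- The real part of the boundary operator is bounded by its boundary data. -/
lemma abs_re_bdOp_le (hL : 0 < L) {g : ℂ → ℝ} (hg : ContinuousOn g (rectBdry L)) {M : ℝ}
    (hM : ∀ v ∈ rectBdry L, |g v| ≤ M) {u : ℂ} (hu : u ∈ rectDom L) : |(bdOp L g u).re| ≤ M := by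
  obtain ⟨C, hC0, hC⟩ := exists_norm_bdOp_le hL hu
  have key : ∀ δ > 0, |(bdOp L g u).re| ≤ M + (1 + C) * δ := by
    intro δ hδ
    obtain ⟨G, hG, hGg⟩ := exists_contDiff_abs_sub_le (isCompact_rectBdry L) hg hδ
    obtain ⟨D, hc, hd, hre, hDu, -⟩ := exists_extension_bdOp hL hG
    have h1 := abs_re_le_of_rectBdry hL hc hd (M := M + δ) (fun v hv => by
      rw [hre v hv]
      have h1 := abs_le.mp (hM v hv)
      have h2 := abs_le.mp (hGg v hv)
      exact abs_le.mpr ⟨by linarith, by linarith⟩) hu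
    have h2 := hC (fun v => G v - g v) δ hδ.le hGg
    rw [bdOp_sub hL hG.continuous.continuousOn hg hu] at h2
    have h3 := (Complex.abs_re_le_norm _).trans h2
    rw [Complex.sub_re] at h3
    rw [hDu u hu] at h1
    have h4 := abs_le.mp h1
    have h5 := abs_le.mp h3
    exact abs_le.mpr ⟨by linarith, by linarith⟩
  refine le_of_forall_pos_le_add fun ε hε => ?_
  have h1C : 0 < 1 + C := by linarith
  have := key (ε / (1 + C)) (by positivity)
  rwa [mul_div_cancel₀ _ h1C.ne'] at this

/-- The boundary operator attains its data: for smooth data it extends continuously, and the maximum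
principle makes the approximation by smooth data uniform. -/
theorem tendsto_re_bdOp (hL : 0 < L) {g : ℂ → ℝ} (hg : ContinuousOn g (rectBdry L)) {t : ℂ}
    (ht : t ∈ rectBdry L) :
    Tendsto (fun u => (bdOp L g u).re) (𝓝[rectDom L] t) (𝓝 (g t)) := by
  rw [Metric.tendsto_nhds]
  intro ε hε
  obtain ⟨G, hG, hGg⟩ := exists_contDiff_abs_sub_le (isCompact_rectBdry L) hg
    (show 0 < ε / 4 by positivity)
  obtain ⟨D, hc, -, hre, hDu, -⟩ := exists_extension_bdOp hL hG
  have h1 : Tendsto (fun u => (D u).re) (𝓝[rectDom L] t) (𝓝 (D t).re) :=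
    (Complex.continuous_re.continuousAt.tendsto.comp (hc t ht.1)).mono_left
      (nhdsWithin_mono t (rectDom_subset L))
  filter_upwards [Metric.tendsto_nhds.mp h1 (ε / 4) (by positivity), self_mem_nhdsWithin] with u h2 hu
  have h3 := abs_re_bdOp_le hL (hG.continuous.continuousOn.fun_sub hg) hGg hu
  rw [bdOp_sub hL hG.continuous.continuousOn hg hu, Complex.sub_re, ← hDu u hu] at h3
  rw [Real.dist_eq, hre t ht] at h2
  rw [Real.dist_eq]
  have h4 := hGg t ht
  have h2 := abs_lt.mp h2
  have h3 := abs_le.mp h3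
  have h4 := abs_le.mp h4
  exact abs_lt.mpr ⟨by linarith, by linarith⟩

lemma differentiableOn_kerK_side (hL : 0 < L) {g : ℂ → ℝ} (hg : ContinuousOn g (rectBdry L))
    {σ : ℝ → ℂ} {a b : ℝ} (hσ : ContinuousOn σ (Set.uIcc a b))
    (hmem : ∀ s ∈ Set.uIcc a b, σ s ∈ rectBdry L) :
    DifferentiableOn ℂ (fun u => ∫ s in a..b, (g (σ s) : ℂ) * kerK L u (σ s)) (rectDom L) := by
  have hgσ : ContinuousOn (fun s => (g (σ s) : ℂ)) (Set.uIcc a b) :=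
    Complex.continuous_ofReal.comp_continuousOn (hg.comp hσ hmem)
  have hreg : ∀ u ∈ rectDom L, ∀ s ∈ Set.uIcc a b,
      u + -σ s ∈ {X : ℂ | |X.re| < 2 * L ∧ Complex.exp X ≠ 1} := fun u hu s hs => by
    have h := sub_mem_poleBox hu (hmem s hs).1
    rw [← sub_eq_add_neg]
    exact ⟨h.1, exp_ne_one_of_abs_im_lt h.2 (sub_ne_zero.mpr fun h0 =>
      (hmem s hs).2 (h0 ▸ hu))⟩
  have h1 := differentiableOn_intervalIntegral (isOpen_kerP_regular L) (isOpen_rectDom L)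
    (differentiableOn_kerP hL) hgσ hσ.fun_neg hreg
  have h2 := differentiableOn_intervalIntegral (isOpen_kerP_regular L) (isOpen_rectDom L)
    (differentiableOn_kerP hL) hgσ hσ (fun u hu s hs => kerP_mem_of_add hu (hmem s hs).1)
  have hK := differentiableOn_kerP hL
  refine (((h1.fun_sub h2).div_const 2).const_add (∫ s in a..b, (g (σ s) : ℂ))).congr fun u hu => ?_
  have i1 : IntervalIntegrable (fun s => (g (σ s) : ℂ) * kerP L (u + -σ s)) volume a b :=
    (hgσ.mul (hK.continuousOn.comp (continuousOn_const.add hσ.fun_neg) (hreg u hu))).intervalIntegrable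
  have i2 : IntervalIntegrable (fun s => (g (σ s) : ℂ) * kerP L (u + σ s)) volume a b :=
    (hgσ.mul (hK.continuousOn.comp (continuousOn_const.add hσ)
      fun s hs => kerP_mem_of_add hu (hmem s hs).1)).intervalIntegrable
  rw [← intervalIntegral.integral_sub i1 i2, ← intervalIntegral.integral_div,
    ← intervalIntegral.integral_add hgσ.intervalIntegrable ((i1.sub i2).div_const 2)]
  refine intervalIntegral.integral_congr fun s _ => ?_
  simp only [kerK, sub_eq_add_neg]
  ring

lemma differentiableOn_bdOp (hL : 0 < L) {g : ℂ → ℝ} (hg : ContinuousOn g (rectBdry L)) :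
    DifferentiableOn ℂ (bdOp L g) (rectDom L) := by
  have h1 := differentiableOn_kerK_side hL hg (σ := fun x : ℝ => (x : ℂ)) (a := -L) (b := 0)
    (by fun_prop) fun x hx => bottom_mem (uIcc_horizontal hL ▸ hx)
  have h2 := differentiableOn_kerK_side hL hg (σ := fun x : ℝ => (x : ℂ) + Real.pi * Complex.I)
    (a := -L) (b := 0) (by fun_prop) fun x hx => top_mem (uIcc_horizontal hL ▸ hx)
  have h3 := differentiableOn_kerK_side hL hg (σ := fun y : ℝ => (y : ℂ) * Complex.I)
    (a := 0) (b := Real.pi) (by fun_prop) fun x hx => right_mem hL (uIcc_vertical ▸ hx)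
  have h4 := differentiableOn_kerK_side hL hg (σ := fun y : ℝ => -L + (y : ℂ) * Complex.I)
    (a := 0) (b := Real.pi) (by fun_prop) fun x hx => left_mem hL (uIcc_vertical ▸ hx)
  unfold bdOp rectInt
  exact ((((h1.sub h2).add (h3.const_mul _)).sub (h4.const_mul _)).sub_const _).const_mul _

end

/-! ### Bounds for the kernel, and the horizontal sides -/

section

variable {L : ℝ}

lemma exists_norm_kerA_le (hL : 0 < L) {b : ℝ} (hb : b < 2 * L) :
    ∃ C : ℝ, 0 ≤ C ∧ ∀ X : ℂ, X.re ≤ b → ‖kerA L X‖ ≤ C := by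
  have h0 : 0 ≤ Real.exp (b - 2 * L) / (1 - Real.exp (b - 2 * L)) :=
    div_nonneg (Real.exp_nonneg _) (by
      have : Real.exp (b - 2 * L) < 1 := Real.exp_lt_one_iff.mpr (by linarith)
      linarith)
  exact ⟨_, tsum_nonneg fun n => mul_nonneg h0 (by positivity), fun X hX =>
    tsum_of_norm_bounded (summable_bound hL _).hasSum (norm_psi_sub_le hL hb hX)⟩

/-- Away from its poles the kernel is bounded on vertical strips. -/
lemma exists_norm_kerP_le_of_re (hL : 0 < L) :
    ∃ C : ℝ, 0 ≤ C ∧ ∀ X : ℂ, L / 2 ≤ |X.re| → |X.re| ≤ 3 * L / 2 → ‖kerP L X‖ ≤ C := by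
  obtain ⟨A, hA0, hA⟩ := exists_norm_kerA_le hL (b := 3 * L / 2) (by linarith)
  set B := 1 / (1 - Real.exp (-(L / 2)))
  have hneg : ∀ X : ℂ, X.re ≤ -(L / 2) → -(3 * L / 2) ≤ X.re →
      ‖kerP L X‖ ≤ 1 + 2 * B + 2 * A + 2 * A := by
    intro X h1 h2
    have h3 := norm_psi_le (b := -(L / 2)) (by linarith) h1
    have h4 : Real.exp (-(L / 2)) < 1 := Real.exp_lt_one_iff.mpr (by linarith)
    have h5 : ‖psi X‖ ≤ B := h3.trans (by
      have : Real.exp X.re ≤ 1 := Real.exp_le_one_iff.mpr (by linarith)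
      have h6 : 0 < 1 - Real.exp (-(L / 2)) := by linarith
      simp only [B]; gcongr)
    have h6 := hA X (by linarith)
    have h7 := hA (-X) (by simp; linarith)
    rw [kerP]
    calc _ ≤ _ := norm_sub_le _ _
      _ ≤ _ := add_le_add_left (norm_add_le _ _) _
      _ ≤ _ := add_le_add_left (add_le_add_left (norm_add_le _ _) _) _
      _ ≤ _ := by
        simp only [norm_mul, norm_one, RCLike.norm_ofNat]
        gcongr
  refine ⟨1 + 2 * B + 2 * A + 2 * A, ?_, fun X h1 h2 => ?_⟩
  · have h4 : Real.exp (-(L / 2)) < 1 := Real.exp_lt_one_iff.mpr (by linarith)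
    have : 0 ≤ B := div_nonneg zero_le_one (by linarith)
    positivity
  · rcases le_or_gt 0 X.re with h | h
    · rw [abs_of_nonneg h] at h1 h2
      have := hneg (-X) (by simp; linarith) (by simp; linarith)
      rwa [kerP_neg L (exp_ne_one_of_re_ne_zero (by linarith)), norm_neg] at this
    · rw [abs_of_neg h] at h1 h2
      exact hneg X (by linarith) (by linarith)

lemma re_one_add_two_psi_nonneg {X : ℂ} (h : X.re < 0) : 0 ≤ (1 + 2 * psi X).re := by
  have h1 : Complex.exp X ≠ 1 := exp_ne_one_of_re_ne_zero h.ne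
  have h2 : 1 - Complex.exp X ≠ 0 := sub_ne_zero.mpr h1.symm
  have h3 : 1 + 2 * psi X = (1 + Complex.exp X) / (1 - Complex.exp X) := by
    rw [psi]; field_simp; ring
  have h4 : ‖Complex.exp X‖ < 1 := by rw [Complex.norm_exp]; exact Real.exp_lt_one_iff.mpr h
  have h5 : Complex.normSq (Complex.exp X) < 1 := by
    rw [Complex.normSq_eq_norm_sq]; nlinarith [norm_nonneg (Complex.exp X)]
  rw [h3, Complex.div_re, ← add_div]
  refine div_nonneg ?_ (Complex.normSq_nonneg _)
  rw [Complex.normSq_apply] at h5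
  simp only [Complex.add_re, Complex.one_re, Complex.sub_re, Complex.add_im, Complex.one_im,
    Complex.sub_im]
  nlinarith

/-- To the left of its pole the real part of the kernel is bounded below: its singular part is the
Poisson kernel. -/
lemma exists_re_kerP_ge (hL : 0 < L) :
    ∃ C : ℝ, 0 ≤ C ∧ ∀ X : ℂ, -L ≤ X.re → X.re < 0 → -C ≤ (kerP L X).re := by
  obtain ⟨A, hA0, hA⟩ := exists_norm_kerA_le hL (b := L) (by linarith)
  refine ⟨4 * A, by positivity, fun X h1 h2 => ?_⟩
  have h3 := re_one_add_two_psi_nonneg h2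
  have h4 := (abs_le.mp ((Complex.abs_re_le_norm _).trans (hA X (by linarith)))).1
  have h5 := (abs_le.mp ((Complex.abs_re_le_norm _).trans (hA (-X) (by simp; linarith)))).2
  have h6 : (kerP L X).re = (1 + 2 * psi X).re + 2 * (kerA L X).re - 2 * (kerA L (-X)).re := by
    simp [kerP]
  rw [h6]; linarith

lemma lintegral_horizontal_le {Φ : ℂ → ℝ≥0∞} (hΦ : Measurable Φ) (x y : ℝ) (S T : Set ℝ) :
    ∫⁻ θ in S, ∫⁻ s in T, Φ ((x + s : ℝ) + (y + θ : ℝ) * Complex.I) ≤ ∫⁻ z, Φ z := by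
  have h1 : ∫⁻ z, Φ z = ∫⁻ θ : ℝ, ∫⁻ s : ℝ, Φ ((s : ℝ) + (θ : ℝ) * Complex.I) := by
    rw [← (Complex.volume_preserving_equiv_real_prod.symm).lintegral_comp hΦ]
    rw [Measure.volume_eq_prod, lintegral_prod_symm]
    · refine lintegral_congr fun θ => lintegral_congr fun s => ?_
      congr 1
      apply Complex.ext <;> simp
    · exact (hΦ.comp (Complex.measurableEquivRealProd.symm.measurable)).aemeasurable
  rw [h1, ← lintegral_add_left_eq_self (μ := volume)
    (fun θ : ℝ => ∫⁻ s : ℝ, Φ ((s : ℝ) + (θ : ℝ) * Complex.I)) y]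
  refine (setLIntegral_le_lintegral _ _).trans (lintegral_mono fun θ => ?_)
  rw [← lintegral_add_left_eq_self (μ := volume)
    (fun s : ℝ => Φ ((s : ℝ) + ((y + θ : ℝ) : ℂ) * Complex.I)) x]
  exact setLIntegral_le_lintegral _ _

lemma lintegral_horizontal_le' {Φ : ℂ → ℝ≥0∞} (hΦ : Measurable Φ) (x y : ℝ) (S T : Set ℝ) :
    ∫⁻ θ in S, ∫⁻ s in T, Φ ((x - s : ℝ) + (y + θ : ℝ) * Complex.I) ≤ ∫⁻ z, Φ z := by
  refine le_trans ?_ (lintegral_horizontal_le hΦ 0 y S Set.univ)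
  refine lintegral_mono fun θ => ?_
  simp only [zero_add, Measure.restrict_univ]
  rw [← lintegral_sub_left_eq_self (μ := volume)
    (fun s : ℝ => Φ ((s : ℝ) + ((y + θ : ℝ) : ℂ) * Complex.I)) x]
  exact setLIntegral_le_lintegral _ _

lemma lintegral_lintegral_add {μ ν : Measure ℝ} [SFinite μ] [SFinite ν] {f g : ℝ → ℝ → ℝ≥0∞}
    (hf : Measurable (Function.uncurry f)) :
    ∫⁻ θ, ∫⁻ s, (f θ s + g θ s) ∂ν ∂μ = (∫⁻ θ, ∫⁻ s, f θ s ∂ν ∂μ) + ∫⁻ θ, ∫⁻ s, g θ s ∂ν ∂μ := by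
  rw [← lintegral_add_left hf.lintegral_prod_right]
  exact lintegral_congr fun θ => lintegral_add_left (hf.comp measurable_prodMk_left) _

/-- The kernel is integrable along the horizontal sides, on average over a vertical segment. -/
lemma exists_lintegral_kerK_le (hL : 0 < L) :
    ∃ C : ℝ≥0∞, C ≠ ⊤ ∧ ∀ x : ℝ, -L < x → x < 0 → ∀ q : ℝ, q = 0 ∨ q = Real.pi →
      ∃ Ψ : ℝ → ℝ≥0∞, Measurable Ψ ∧ ∫⁻ θ in Set.Ioo 0 Real.pi, Ψ θ ≤ C ∧
        ∀ θ ∈ Set.Ioo 0 Real.pi, ∫⁻ s in Set.Ioc (-L) 0,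
          ‖kerK L (x + θ * Complex.I) (s + q * Complex.I)‖ₑ ≤ Ψ θ := by
  have hb := memLp_one_iff_integrable.mp (memLp_kerBox hL one_ne_zero (by norm_num : (1 : ℝ≥0∞) < 2))
  have hm : Measurable fun z => ‖kerBox L z‖ₑ := (measurable_kerBox hL).enorm
  set J := ∫⁻ z, ‖kerBox L z‖ₑ with hJ
  have hJ' : J ≠ ⊤ := hb.hasFiniteIntegral.ne
  set V : ℝ≥0∞ := ∫⁻ _ in Set.Ioo 0 Real.pi, ∫⁻ _ in Set.Ioc (-L) 0, (1 : ℝ≥0∞) with hV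
  have hV' : V ≠ ⊤ := by
    simp only [hV, lintegral_const, one_mul, Measure.restrict_apply_univ, Real.volume_Ioo,
      Real.volume_Ioc]
    exact ENNReal.mul_ne_top ENNReal.ofReal_ne_top ENNReal.ofReal_ne_top
  -- the constant `1` contributes `V`, and each of the two terms of the kernel contributes at most `J`
  refine ⟨V + J + J, by simp [hV', hJ'], fun x hx hx0 q hq => ?_⟩
  have hpi := Real.pi_pos
  have hq' : 0 ≤ q ∧ q ≤ Real.pi := by rcases hq with rfl | rfl <;> constructor <;> linarith
  have hpt : ∀ θ ∈ Set.Ioo 0 Real.pi, ∀ s ∈ Set.Ioc (-L) 0,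
      ‖kerK L (x + θ * Complex.I) (s + q * Complex.I)‖ₑ
        ≤ 1 + ‖kerBox L ((x - s : ℝ) + (-q + θ : ℝ) * Complex.I)‖ₑ
          + ‖kerBox L ((x + s : ℝ) + (q + θ : ℝ) * Complex.I)‖ₑ := by
    intro θ hθ s hs
    have e1 : (x + θ * Complex.I) - (s + q * Complex.I)
        = ((x - s : ℝ) + (-q + θ : ℝ) * Complex.I : ℂ) := by push_cast; ring
    have e2 : (x + θ * Complex.I) + (s + q * Complex.I)
        = ((x + s : ℝ) + (q + θ : ℝ) * Complex.I : ℂ) := by push_cast; ring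
    have m1 : ((x - s : ℝ) + (-q + θ : ℝ) * Complex.I : ℂ) ∈ poleBox L := by
      constructor
      · simpa using abs_lt.mpr ⟨by linarith [hs.2], by linarith [hs.1]⟩
      · simpa using abs_lt.mpr ⟨by linarith [hθ.1], by linarith [hθ.2]⟩
    have m2 : ((x + s : ℝ) + (q + θ : ℝ) * Complex.I : ℂ) ∈ poleBox L := by
      constructor
      · simpa using abs_lt.mpr ⟨by linarith [hs.1], by linarith [hs.2]⟩
      · simpa using abs_lt.mpr ⟨by linarith [hθ.1], by linarith [hθ.2]⟩
    rw [kerK, e1, e2, kerBox, Set.indicator_of_mem m1, Set.indicator_of_mem m2,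
      ← enorm_one (G := ℂ), add_assoc]
    refine (enorm_add_le _ _).trans (add_le_add_right ?_ _)
    simp only [enorm_eq_nnnorm]
    norm_cast
    rw [← NNReal.coe_le_coe]
    push_cast
    rw [norm_div, RCLike.norm_ofNat]
    have := norm_sub_le (kerP L ((x - s : ℝ) + (-q + θ : ℝ) * Complex.I))
      (kerP L ((x + s : ℝ) + (q + θ : ℝ) * Complex.I))
    push_cast at this ⊢
    linarith [norm_nonneg (kerP L ((x - s) + (-q + θ) * Complex.I)),
      norm_nonneg (kerP L ((x + s) + (q + θ) * Complex.I))]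
  have hm1 : Measurable (Function.uncurry fun θ s : ℝ =>
      ‖kerBox L ((x - s : ℝ) + (-q + θ : ℝ) * Complex.I)‖ₑ) := by
    refine hm.comp (g := fun z => ‖kerBox L z‖ₑ)
      (f := fun p : ℝ × ℝ => ((x - p.2 : ℝ) + (-q + p.1 : ℝ) * Complex.I : ℂ)) ?_
    fun_prop
  have hm2 : Measurable (Function.uncurry fun θ s : ℝ =>
      ‖kerBox L ((x + s : ℝ) + (q + θ : ℝ) * Complex.I)‖ₑ) := by
    refine hm.comp (g := fun z => ‖kerBox L z‖ₑ)
      (f := fun p : ℝ × ℝ => ((x + p.2 : ℝ) + (q + p.1 : ℝ) * Complex.I : ℂ)) ?_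
    fun_prop
  have hm0 : Measurable (Function.uncurry fun _ _ : ℝ => (1 : ℝ≥0∞)) := measurable_const
  refine ⟨fun θ => ∫⁻ s in Set.Ioc (-L) 0,
    (1 + ‖kerBox L ((x - s : ℝ) + (-q + θ : ℝ) * Complex.I)‖ₑ
      + ‖kerBox L ((x + s : ℝ) + (q + θ : ℝ) * Complex.I)‖ₑ),
    ((hm0.add hm1).add hm2).lintegral_prod_right, ?_, fun θ hθ =>
      setLIntegral_mono' measurableSet_Ioc fun s hs => hpt θ hθ s hs⟩
  rw [lintegral_lintegral_add (f := fun θ s => 1 + ‖kerBox L ((x - s : ℝ) + (-q + θ : ℝ) * Complex.I)‖ₑ)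
    (hm0.add hm1), lintegral_lintegral_add hm0]
  exact add_le_add (add_le_add le_rfl (lintegral_horizontal_le' hm x (-q) _ _))
    (lintegral_horizontal_le hm x q _ _)

/-- The contribution of the horizontal sides to the boundary operator. -/
def rayOp (L : ℝ) (g : ℂ → ℝ) (u : ℂ) : ℂ :=
  1 / (Real.pi * Complex.I) * ((∫ s : ℝ in (-L)..0, g s * kerK L u s)
    - ∫ s : ℝ in (-L)..0, g (s + Real.pi * Complex.I) * kerK L u (s + Real.pi * Complex.I))

lemma exists_lintegral_rayOp_le (hL : 0 < L) :
    ∃ C : ℝ≥0∞, C ≠ ⊤ ∧ ∀ (g : ℂ → ℝ) (M : ℝ), (∀ v ∈ rectBdry L, |g v| ≤ M) →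
      ∀ x : ℝ, -L < x → x < 0 →
        ∫⁻ θ in Set.Ioo 0 Real.pi, ‖rayOp L g (x + θ * Complex.I)‖ₑ ≤ C * ENNReal.ofReal M := by
  obtain ⟨C, hC, h⟩ := exists_lintegral_kerK_le hL
  refine ⟨C + C, by simp [hC], fun g M hM x hx hx0 => ?_⟩
  have hside : ∀ q : ℝ, q = 0 ∨ q = Real.pi → ∀ θ : ℝ,
      ‖∫ s : ℝ in (-L)..0, (g (s + q * Complex.I) : ℂ) * kerK L (x + θ * Complex.I) (s + q * Complex.I)‖ₑ
        ≤ ENNReal.ofReal M * ∫⁻ s in Set.Ioc (-L) 0,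
          ‖kerK L (x + θ * Complex.I) (s + q * Complex.I)‖ₑ := by
    intro q hq θ
    rw [intervalIntegral.integral_of_le (by linarith)]
    refine (enorm_integral_le_lintegral_enorm _).trans ?_
    rw [← lintegral_const_mul' _ _ ENNReal.ofReal_ne_top]
    refine setLIntegral_mono' measurableSet_Ioc fun s hs => ?_
    rw [enorm_mul]
    gcongr
    have hmem : (s + q * Complex.I : ℂ) ∈ rectBdry L := by
      rcases hq with rfl | rfl
      · simpa using bottom_mem (Set.Ioc_subset_Icc_self hs)
      · exact top_mem (Set.Ioc_subset_Icc_self hs)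
    rw [← ofReal_norm, Complex.norm_real, Real.norm_eq_abs]
    exact ENNReal.ofReal_le_ofReal (hM _ hmem)
  have hpi : ‖(1 / (Real.pi * Complex.I) : ℂ)‖ₑ ≤ 1 := by
    rw [← ofReal_norm, ENNReal.ofReal_le_one, norm_div, norm_mul, Complex.norm_I,
      Complex.norm_real, Real.norm_eq_abs, abs_of_pos Real.pi_pos, mul_one, norm_one,
      div_le_one Real.pi_pos]
    linarith [Real.pi_gt_three]
  obtain ⟨Ψ₀, hΨ₀, hi₀, hk₀⟩ := h x hx hx0 0 (Or.inl rfl)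
  obtain ⟨Ψ₁, hΨ₁, hi₁, hk₁⟩ := h x hx hx0 _ (Or.inr rfl)
  have hpt : ∀ θ ∈ Set.Ioo 0 Real.pi, ‖rayOp L g (x + θ * Complex.I)‖ₑ
      ≤ ENNReal.ofReal M * (Ψ₀ θ + Ψ₁ θ) := by
    intro θ hθ
    have h0 := (hside 0 (Or.inl rfl) θ).trans (mul_le_mul_right (hk₀ θ hθ) _)
    have h1 := (hside _ (Or.inr rfl) θ).trans (mul_le_mul_right (hk₁ θ hθ) _)
    simp only [Complex.ofReal_zero, zero_mul, add_zero] at h0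
    rw [rayOp, enorm_mul, mul_add]
    calc _ ≤ 1 * _ := mul_le_mul_left hpi _
      _ ≤ _ := by
        rw [one_mul]
        exact (enorm_sub_le).trans (add_le_add h0 h1)
  calc _ ≤ _ := setLIntegral_mono' measurableSet_Ioo hpt
    _ = ENNReal.ofReal M * ((∫⁻ θ in Set.Ioo 0 Real.pi, Ψ₀ θ) + ∫⁻ θ in Set.Ioo 0 Real.pi, Ψ₁ θ) := by
        rw [lintegral_const_mul' _ _ ENNReal.ofReal_ne_top, lintegral_add_left hΨ₀]
    _ ≤ ENNReal.ofReal M * (C + C) := by gcongr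
    _ = _ := mul_comm _ _

end

/-! ### The vertical sides, and M. Riesz' bound for the imaginary part -/

section

variable {L : ℝ}

/-- The contribution of the right side to the boundary operator, as a function on the whole strip
`-2L < Re u < 0`, where it is `2πi`-periodic. -/
def arcOp (L : ℝ) (g : ℂ → ℝ) (u : ℂ) : ℂ :=
  1 / (2 * Real.pi) * ∫ y : ℝ in (0:ℝ)..Real.pi,
    (g (y * Complex.I) : ℂ) * (kerP L (u - y * Complex.I) - kerP L (u + y * Complex.I))

/-- The contribution of the left side to the boundary operator. -/
def leftOp (L : ℝ) (g : ℂ → ℝ) (u : ℂ) : ℂ :=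
  -(1 / Real.pi) * ∫ y : ℝ in (0:ℝ)..Real.pi,
    (g (-L + y * Complex.I) : ℂ) * kerK L u (-L + y * Complex.I)

lemma bdOp_eq_add (hL : 0 < L) {g : ℂ → ℝ} (hg : ContinuousOn g (rectBdry L)) {u : ℂ}
    (hu : u ∈ rectDom L) : bdOp L g u = rayOp L g u + leftOp L g u + arcOp L g u := by
  have hg' : ContinuousOn (fun v => (g v : ℂ)) (rectBdry L) :=
    Complex.continuous_ofReal.comp_continuousOn hg
  have i1 := (intervalIntegrable_sides hL (hg'.fun_mul (continuousOn_kerK_rectBdry hL hu))).2.2.1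
  have i2 := (intervalIntegrable_sides hL hg').2.2.1
  have h1 : ∫ y : ℝ in (0:ℝ)..Real.pi,
      (g (y * Complex.I) : ℂ) * (kerP L (u - y * Complex.I) - kerP L (u + y * Complex.I))
      = 2 * ((∫ y : ℝ in (0:ℝ)..Real.pi, (g (y * Complex.I) : ℂ) * kerK L u (y * Complex.I))
        - ∫ y : ℝ in (0:ℝ)..Real.pi, (g (y * Complex.I) : ℂ)) := by
    rw [← intervalIntegral.integral_sub i1 i2, ← intervalIntegral.integral_const_mul]
    refine intervalIntegral.integral_congr fun y _ => ?_
    simp only [kerK]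
    ring
  have hpi : (Real.pi : ℂ) ≠ 0 := Complex.ofReal_ne_zero.mpr Real.pi_ne_zero
  have hred : ∀ X Y : ℂ, 1 / (Real.pi * Complex.I) * (X + Complex.I * Y)
      = 1 / (Real.pi * Complex.I) * X + 1 / Real.pi * Y := fun X Y => by
    have := Complex.I_ne_zero
    field_simp
  rw [bdOp, rayOp, leftOp, arcOp, h1, rectInt]
  have e : ∀ a b c d e : ℂ, a - b + Complex.I * c - Complex.I * d - Complex.I * e
      = (a - b) + Complex.I * (c - d - e) := fun a b c d e => by ring
  rw [e, hred]
  ring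

lemma exists_norm_leftOp_le (hL : 0 < L) :
    ∃ C : ℝ, 0 ≤ C ∧ ∀ (g : ℂ → ℝ) (M : ℝ), (∀ v ∈ rectBdry L, |g v| ≤ M) →
      ∀ u : ℂ, -(L / 2) ≤ u.re → u.re < 0 → ‖leftOp L g u‖ ≤ C * M := by
  obtain ⟨C, hC0, hC⟩ := exists_norm_kerP_le_of_re hL
  refine ⟨1 + C, by positivity, fun g M hM u h1 h2 => ?_⟩
  have hπ := Real.pi_pos
  have h3 : ‖∫ y : ℝ in (0:ℝ)..Real.pi,
      (g (-L + y * Complex.I) : ℂ) * kerK L u (-L + y * Complex.I)‖ ≤ M * (1 + C) * |Real.pi - 0| := by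
    refine intervalIntegral.norm_integral_le_of_norm_le_const fun y hy => ?_
    have hm := hM _ (left_mem hL (uIcc_vertical ▸ Set.uIoc_subset_uIcc hy))
    have k1 := hC (u - (-L + y * Complex.I)) (by simp; rw [abs_of_pos] <;> linarith)
      (by simp; rw [abs_of_pos] <;> linarith)
    have k2 := hC (u + (-L + y * Complex.I)) (by simp; rw [abs_of_neg] <;> linarith)
      (by simp; rw [abs_of_neg] <;> linarith)
    rw [norm_mul, Complex.norm_real, Real.norm_eq_abs]
    refine mul_le_mul hm ?_ (norm_nonneg _) ((abs_nonneg _).trans hm)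
    rw [kerK]
    refine (norm_add_le _ _).trans ?_
    rw [norm_one, norm_div, RCLike.norm_ofNat]
    have := norm_sub_le (kerP L (u - (-L + y * Complex.I))) (kerP L (u + (-L + y * Complex.I)))
    linarith
  rw [leftOp, norm_mul, norm_neg, norm_div, norm_one, Complex.norm_real, Real.norm_eq_abs,
    abs_of_pos hπ]
  rw [sub_zero, abs_of_pos hπ] at h3
  calc _ ≤ 1 / Real.pi * (M * (1 + C) * Real.pi) := by gcongr
    _ = _ := by field_simp

lemma isOpen_strip (L : ℝ) : IsOpen {X : ℂ | -(2 * L) < X.re ∧ X.re < 0} :=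
  (isOpen_lt continuous_const Complex.continuous_re).inter
    (isOpen_lt Complex.continuous_re continuous_const)

lemma differentiableOn_kerP_strip (hL : 0 < L) :
    DifferentiableOn ℂ (kerP L) {X : ℂ | -(2 * L) < X.re ∧ X.re < 0} := fun _ hX =>
  (differentiableAt_kerP hL (abs_lt.mpr ⟨hX.1, by linarith [hX.2]⟩)
    (exp_ne_one_of_re_ne_zero hX.2.ne)).differentiableWithinAt

lemma continuous_kerP_vertical (hL : 0 < L) {u : ℂ} (h1 : -(2 * L) < u.re) (h2 : u.re < 0) (a : ℝ) :
    Continuous fun y : ℝ => kerP L (u + (a * y : ℝ) * Complex.I) :=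
  (differentiableOn_kerP_strip hL).continuousOn.comp_continuous (by fun_prop)
    fun y => by simpa using ⟨h1, h2⟩

lemma differentiableOn_arcOp (hL : 0 < L) {g : ℂ → ℝ} (hg : ContinuousOn g (rectBdry L)) :
    DifferentiableOn ℂ (arcOp L g) {X : ℂ | -(2 * L) < X.re ∧ X.re < 0} := by
  have hgσ : ContinuousOn (fun y : ℝ => (g (y * Complex.I) : ℂ)) (Set.uIcc 0 Real.pi) :=
    Complex.continuous_ofReal.comp_continuousOn
      (hg.comp (by fun_prop) fun y hy => right_mem hL (uIcc_vertical ▸ hy))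
  have h1 := differentiableOn_intervalIntegral (isOpen_strip L) (isOpen_strip L)
    (differentiableOn_kerP_strip hL) hgσ (σ := fun y => ((-1 * y : ℝ) : ℂ) * Complex.I) (by fun_prop)
    fun u hu y _ => by simpa using hu
  have h2 := differentiableOn_intervalIntegral (isOpen_strip L) (isOpen_strip L)
    (differentiableOn_kerP_strip hL) hgσ (σ := fun y => ((1 * y : ℝ) : ℂ) * Complex.I) (by fun_prop)
    fun u hu y _ => by simpa using hu
  refine ((h1.fun_sub h2).const_mul (1 / (2 * Real.pi) : ℂ)).congr fun u hu => ?_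
  rw [arcOp, ← intervalIntegral.integral_sub
    (hgσ.fun_mul (continuous_kerP_vertical hL hu.1 hu.2 (-1)).continuousOn).intervalIntegrable
    (hgσ.fun_mul (continuous_kerP_vertical hL hu.1 hu.2 1).continuousOn).intervalIntegrable]
  congr 1
  refine intervalIntegral.integral_congr fun y _ => ?_
  simp only [neg_mul, one_mul, Complex.ofReal_neg, ← sub_eq_add_neg]
  ring

lemma arcOp_add_two_pi_I (g : ℂ → ℝ) (u : ℂ) :
    arcOp L g (u + 2 * Real.pi * Complex.I) = arcOp L g u := by
  rw [arcOp, arcOp]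
  congr 1
  refine intervalIntegral.integral_congr fun y _ => ?_
  rw [add_sub_right_comm, add_right_comm, kerP_add_two_pi_I, kerP_add_two_pi_I]

/-- The two translates of the kernel in `arcOp` together run over a full period. -/
lemma integral_kerP_add (hL : 0 < L) {u : ℂ} (h1 : -(2 * L) < u.re) (h2 : u.re < 0) :
    ∫ y : ℝ in (0:ℝ)..Real.pi, ((kerP L (u - y * Complex.I)).re + (kerP L (u + y * Complex.I)).re)
      = 2 * Real.pi := by
  have hc : ∀ a : ℝ, Continuous fun y : ℝ => (kerP L (u + (a * y : ℝ) * Complex.I)).re := fun a =>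
    Complex.continuous_re.comp (continuous_kerP_vertical hL h1 h2 a)
  have h3 := integral_kerP hL (X := -u) (by simpa using h2) (by simp; linarith)
  have h4 : ∫ y : ℝ in (-Real.pi)..Real.pi, (kerP L (u + ((1 * y : ℝ) : ℂ) * Complex.I)).re
      = 2 * Real.pi := by
    have h5 := Complex.reCLM.intervalIntegral_comp_comm
      ((continuous_kerP_vertical hL h1 h2 1).intervalIntegrable (μ := volume) (-Real.pi) Real.pi)
    simp only [Complex.reCLM_apply] at h5
    rw [h5]
    have h6 : ∫ y : ℝ in (-Real.pi)..Real.pi, kerP L (u + ((1 * y : ℝ) : ℂ) * Complex.I)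
        = ∫ y : ℝ in (-Real.pi)..Real.pi, kerP L (u + ((1 * (-y) : ℝ) : ℂ) * Complex.I) := by
      rw [intervalIntegral.integral_comp_neg
        (fun y : ℝ => kerP L (u + ((1 * y : ℝ) : ℂ) * Complex.I)), neg_neg]
    have h7 : ∀ y : ℝ, kerP L (u + ((1 * (-y) : ℝ) : ℂ) * Complex.I)
        = -kerP L (y * Complex.I + -u) := fun y => by
      rw [← kerP_neg L (exp_ne_one_of_re_ne_zero (by simpa using h2.ne))]
      congr 1; push_cast; ring
    rw [h6]
    simp only [h7]
    rw [intervalIntegral.integral_neg, h3]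
    simp
  rw [← intervalIntegral.integral_add_adjacent_intervals ((hc 1).intervalIntegrable _ 0)
    ((hc 1).intervalIntegrable _ _)] at h4
  have h8 := intervalIntegral.integral_comp_neg (a := 0) (b := Real.pi)
    (fun y : ℝ => (kerP L (u + ((1 * y : ℝ) : ℂ) * Complex.I)).re)
  rw [neg_zero] at h8
  rw [← h8, ← intervalIntegral.integral_add
    ((by simpa using hc (-1) : Continuous fun y : ℝ =>
      (kerP L (u + ((1 * -y : ℝ) : ℂ) * Complex.I)).re).intervalIntegrable _ _)
    ((hc 1).intervalIntegrable _ _)] at h4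
  rw [← h4]
  refine intervalIntegral.integral_congr fun y _ => ?_
  simp [sub_eq_add_neg]

/-- The kernel is positive up to a bounded error, and its integral is known, so the real part of `arcOp`
is bounded by the data. -/
lemma exists_abs_re_arcOp_le (hL : 0 < L) :
    ∃ C : ℝ, 0 ≤ C ∧ ∀ (g : ℂ → ℝ) (M : ℝ), ContinuousOn g (rectBdry L) →
      (∀ v ∈ rectBdry L, |g v| ≤ M) →
      ∀ u : ℂ, -L ≤ u.re → u.re < 0 → |(arcOp L g u).re| ≤ C * M := by
  obtain ⟨C, hC0, hC⟩ := exists_re_kerP_ge hL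
  refine ⟨1 + 2 * C, by positivity, fun g M hg hM u h1 h2 => ?_⟩
  have hπ := Real.pi_pos
  have h1' : -(2 * L) < u.re := by linarith
  have c1 := continuous_kerP_vertical hL h1' h2 (-1)
  have c2 := continuous_kerP_vertical hL h1' h2 1
  simp only [neg_mul, one_mul, Complex.ofReal_neg, ← sub_eq_add_neg] at c1 c2
  have hgσ : ContinuousOn (fun y : ℝ => (g (y * Complex.I) : ℂ)) (Set.uIcc 0 Real.pi) :=
    Complex.continuous_ofReal.comp_continuousOn
      (hg.comp (by fun_prop) fun y hy => right_mem hL (uIcc_vertical ▸ hy))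
  have hre : (arcOp L g u).re = 1 / (2 * Real.pi) * ∫ y : ℝ in (0:ℝ)..Real.pi,
      g (y * Complex.I) * ((kerP L (u - y * Complex.I)).re - (kerP L (u + y * Complex.I)).re) := by
    have h5 := Complex.reCLM.intervalIntegral_comp_comm
      ((hgσ.mul (c1.sub c2).continuousOn).intervalIntegrable (μ := volume))
    simp only [Complex.reCLM_apply, Pi.mul_apply, Complex.re_ofReal_mul, Pi.sub_apply,
      Complex.sub_re] at h5
    rw [h5, arcOp, show (1 / (2 * Real.pi) : ℂ) = ((1 / (2 * Real.pi) : ℝ) : ℂ) by push_cast; rfl,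
      Complex.re_ofReal_mul]
  have r1 : Continuous fun y : ℝ => (kerP L (u - y * Complex.I)).re := Complex.continuous_re.comp c1
  have r2 : Continuous fun y : ℝ => (kerP L (u + y * Complex.I)).re := Complex.continuous_re.comp c2
  have hb : ‖∫ y : ℝ in (0:ℝ)..Real.pi,
      g (y * Complex.I) * ((kerP L (u - y * Complex.I)).re - (kerP L (u + y * Complex.I)).re)‖
      ≤ ∫ y : ℝ in (0:ℝ)..Real.pi, M * (((kerP L (u - y * Complex.I)).re
        + (kerP L (u + y * Complex.I)).re) + 4 * C) := by
    refine intervalIntegral.norm_integral_le_of_norm_le hπ.le (ae_of_all _ fun y hy => ?_)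
      (Continuous.intervalIntegrable (by fun_prop) _ _)
    have hm := hM _ (right_mem hL (Set.Ioc_subset_Icc_self hy))
    -- `|a - b| ≤ a + b + 4C` for `a, b ≥ -C`
    have k1 := hC (u - y * Complex.I) (by simpa using h1) (by simpa using h2)
    have k2 := hC (u + y * Complex.I) (by simpa using h1) (by simpa using h2)
    rw [norm_mul, Real.norm_eq_abs, Real.norm_eq_abs]
    refine mul_le_mul hm ?_ (abs_nonneg _) ((abs_nonneg _).trans hm)
    rw [abs_le]
    constructor <;> linarith
  rw [intervalIntegral.integral_const_mul, intervalIntegral.integral_add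
    (Continuous.intervalIntegrable (by fun_prop) _ _) intervalIntegrable_const,
    integral_kerP_add hL h1' h2, intervalIntegral.integral_const, Real.norm_eq_abs] at hb
  rw [hre, abs_mul, abs_of_pos (by positivity)]
  calc _ ≤ _ := mul_le_mul_of_nonneg_left hb (by positivity)
    _ = _ := by rw [smul_eq_mul]; field_simp; ring

lemma exists_norm_arcOp_le (hL : 0 < L) :
    ∃ C : ℝ, 0 ≤ C ∧ ∀ (g : ℂ → ℝ) (M : ℝ), (∀ v ∈ rectBdry L, |g v| ≤ M) →
      ∀ u : ℂ, u.re = -(L / 2) → ‖arcOp L g u‖ ≤ C * M := by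
  obtain ⟨C, hC0, hC⟩ := exists_norm_kerP_le_of_re hL
  refine ⟨C, hC0, fun g M hM u hu => ?_⟩
  have hπ := Real.pi_pos
  have habs : |u.re| = L / 2 := by rw [hu, abs_neg, abs_of_pos (by positivity)]
  have h3 : ‖∫ y : ℝ in (0:ℝ)..Real.pi, (g (y * Complex.I) : ℂ)
      * (kerP L (u - y * Complex.I) - kerP L (u + y * Complex.I))‖ ≤ M * (2 * C) * |Real.pi - 0| := by
    refine intervalIntegral.norm_integral_le_of_norm_le_const fun y hy => ?_
    have hm := hM _ (right_mem hL (uIcc_vertical ▸ Set.uIoc_subset_uIcc hy))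
    have k1 := hC (u - y * Complex.I) (by simp [habs]) (by simp [habs]; linarith)
    have k2 := hC (u + y * Complex.I) (by simp [habs]) (by simp [habs]; linarith)
    rw [norm_mul, Complex.norm_real, Real.norm_eq_abs]
    refine mul_le_mul hm ?_ (norm_nonneg _) ((abs_nonneg _).trans hm)
    refine (norm_sub_le _ _).trans ?_
    linarith
  rw [arcOp, norm_mul, norm_div, norm_one, norm_mul, RCLike.norm_ofNat, Complex.norm_real,
    Real.norm_eq_abs, abs_of_pos hπ]
  rw [sub_zero, abs_of_pos hπ] at h3
  calc _ ≤ 1 / (2 * Real.pi) * (M * (2 * C) * Real.pi) := by gcongr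
    _ = _ := by field_simp

/-- M. Riesz' argument: the mean of the square of a periodic holomorphic function does not depend on
the vertical line, so the mean square of the imaginary part is controlled by the real part. -/
lemma exists_integral_im_arcOp_sq_le (hL : 0 < L) :
    ∃ C : ℝ, 0 ≤ C ∧ ∀ (g : ℂ → ℝ) (M : ℝ), ContinuousOn g (rectBdry L) →
      (∀ v ∈ rectBdry L, |g v| ≤ M) →
      ∀ x : ℝ, -(L / 2) ≤ x → x < 0 →
        ∫ θ in (-Real.pi)..Real.pi, (arcOp L g (x + θ * Complex.I)).im ^ 2 ≤ C * M ^ 2 := by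
  obtain ⟨C1, hC1, h1⟩ := exists_abs_re_arcOp_le hL
  obtain ⟨C2, hC2, h2⟩ := exists_norm_arcOp_le hL
  have hπ := Real.pi_pos
  refine ⟨2 * Real.pi * (C1 ^ 2 + C2 ^ 2), by positivity, fun g M hg hM x hx hx0 => ?_⟩
  have hd := differentiableOn_arcOp hL hg
  have hcont : ∀ t : ℝ, -(L / 2) ≤ t → t < 0 →
      Continuous fun θ : ℝ => arcOp L g (t + θ * Complex.I) := fun t h h0 =>
    hd.continuousOn.comp_continuous (by fun_prop) fun θ => by
      simp only [Set.mem_ofPred_eq, Complex.add_re, Complex.ofReal_re, Complex.mul_re,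
        Complex.I_re, Complex.ofReal_im, Complex.I_im]
      constructor <;> linarith
  -- Cauchy's theorem on a rectangle of height `2π`: by periodicity the horizontal sides cancel
  have hconst : ∫ θ in (-Real.pi)..Real.pi, arcOp L g (x + θ * Complex.I) ^ 2
      = ∫ θ in (-Real.pi)..Real.pi, arcOp L g ((-(L / 2) : ℝ) + θ * Complex.I) ^ 2 := by
    have := Complex.integral_boundary_rect_eq_zero_of_differentiableOn (fun u => arcOp L g u ^ 2)
      ⟨x, -Real.pi⟩ ⟨-(L / 2), Real.pi⟩ ((hd.pow 2).mono fun Y hY => by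
        have h1 : Y.re ∈ Set.uIcc x (-(L / 2)) := hY.1
        rw [Set.uIcc_of_ge hx] at h1
        exact ⟨by linarith [h1.1], by linarith [h1.2]⟩)
    have hper : ∀ x : ℝ, arcOp L g (x + ((-Real.pi : ℝ) : ℂ) * Complex.I)
        = arcOp L g (x + (Real.pi : ℂ) * Complex.I) := by
      intro x
      rw [← arcOp_add_two_pi_I]; congr 1; push_cast; ring
    simp only at this
    simp only [hper, sub_self, zero_add] at this
    rw [← smul_sub, smul_eq_zero_iff_right Complex.I_ne_zero, sub_eq_zero] at this
    exact this.symm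
  have hL2 : -(L / 2) < 0 := by linarith
  have cx := hcont x hx hx0
  have cre : Continuous fun θ : ℝ => (arcOp L g (x + θ * Complex.I)).re :=
    Complex.continuous_re.comp cx
  have csq : Continuous fun θ : ℝ => (arcOp L g (x + θ * Complex.I) ^ 2).re :=
    Complex.continuous_re.comp (cx.pow 2)
  have hre := Complex.reCLM.intervalIntegral_comp_comm
    ((cx.pow 2).intervalIntegrable (μ := volume) (-Real.pi) Real.pi)
  simp only [Complex.reCLM_apply, Pi.pow_apply] at hre
  have hR : |(∫ θ in (-Real.pi)..Real.pi, arcOp L g (x + θ * Complex.I) ^ 2).re|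
      ≤ (C2 * M) ^ 2 * (2 * Real.pi) := by
    refine (Complex.abs_re_le_norm _).trans ?_
    rw [hconst]
    refine (intervalIntegral.norm_integral_le_of_norm_le_const (C := (C2 * M) ^ 2)
      fun θ _ => ?_).trans_eq ?_
    · rw [norm_pow]
      gcongr
      exact h2 g M hM _ (by simp)
    · rw [show Real.pi - -Real.pi = 2 * Real.pi by ring, abs_of_pos (by positivity)]
  -- `(Im a)² = (Re a)² - Re (a²)`
  have hsq : ∀ θ : ℝ, (arcOp L g (x + θ * Complex.I)).im ^ 2
      = (arcOp L g (x + θ * Complex.I)).re ^ 2 - (arcOp L g (x + θ * Complex.I) ^ 2).re := fun θ => by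
    rw [sq (arcOp L g (x + θ * Complex.I)), Complex.mul_re]; ring
  have hU : ∫ θ in (-Real.pi)..Real.pi, (arcOp L g (x + θ * Complex.I)).re ^ 2
      ≤ (C1 * M) ^ 2 * (2 * Real.pi) := by
    have := intervalIntegral.integral_mono_on (μ := volume) (a := -Real.pi) (b := Real.pi)
      (f := fun θ : ℝ => (arcOp L g (x + θ * Complex.I)).re ^ 2) (g := fun _ => (C1 * M) ^ 2)
      (by linarith) (Continuous.intervalIntegrable (by fun_prop) _ _) intervalIntegrable_const
      fun θ _ => by
        rw [← sq_abs]
        gcongr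
        exact h1 g M hg hM _ (by simp; linarith) (by simpa using hx0)
    rw [intervalIntegral.integral_const, smul_eq_mul] at this
    linarith
  simp only [hsq]
  rw [intervalIntegral.integral_sub (Continuous.intervalIntegrable (by fun_prop) _ _)
    (Continuous.intervalIntegrable (by fun_prop) _ _), hre]
  have := (abs_le.mp hR).1
  nlinarith

/-- The imaginary part of the boundary operator is bounded in `L¹` on vertical lines, uniformly near
the right side. -/
theorem exists_eLpNorm_im_bdOp_le (hL : 0 < L) :
    ∃ C : ℝ≥0∞, C ≠ ⊤ ∧ ∀ (g : ℂ → ℝ) (M : ℝ), 0 < M → ContinuousOn g (rectBdry L) →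
      (∀ v ∈ rectBdry L, |g v| ≤ M) → ∀ x : ℝ, -(L / 2) ≤ x → x < 0 →
        eLpNorm (fun θ : ℝ => (bdOp L g (x + θ * Complex.I)).im) 1
          (volume.restrict (Set.Ioo 0 Real.pi)) ≤ C * ENNReal.ofReal M := by
  obtain ⟨C1, hC1, h1⟩ := exists_lintegral_rayOp_le hL
  obtain ⟨C2, hC2, h2⟩ := exists_norm_leftOp_le hL
  obtain ⟨C3, hC3, h3⟩ := exists_integral_im_arcOp_sq_le hL
  have hπ := Real.pi_pos
  refine ⟨C1 + ENNReal.ofReal (C2 * Real.pi) + ENNReal.ofReal (C3 + 2 * Real.pi), by simp [hC1],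
    fun g M hM0 hg hM x hx hx0 => ?_⟩
  have hmem : ∀ θ ∈ Set.Ioo 0 Real.pi, (x + θ * Complex.I : ℂ) ∈ rectDom L := fun θ hθ => by
    rw [mem_rectDom]
    simp only [Complex.add_re, Complex.ofReal_re, Complex.mul_re, Complex.I_re, Complex.ofReal_im,
      Complex.I_im, Complex.add_im, Complex.mul_im]
    refine ⟨⟨by linarith, by linarith⟩, by linarith [hθ.1], by linarith [hθ.2]⟩
  have ca : Continuous fun θ : ℝ => arcOp L g (x + θ * Complex.I) :=
    (differentiableOn_arcOp hL hg).continuousOn.comp_continuous (by fun_prop) fun θ => by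
      simp only [Set.mem_ofPred_eq, Complex.add_re, Complex.ofReal_re, Complex.mul_re,
        Complex.I_re, Complex.ofReal_im, Complex.I_im]
      constructor <;> linarith
  have cim : Continuous fun θ : ℝ => (arcOp L g (x + θ * Complex.I)).im :=
    Complex.continuous_im.comp ca
  have harc : ∫⁻ θ in Set.Ioo 0 Real.pi, ‖(arcOp L g (x + θ * Complex.I)).im‖ₑ
      ≤ ENNReal.ofReal ((C3 + 2 * Real.pi) * M) := by
    -- from the mean square to the mean, by `t ≤ t² / M + M`
    have k1 : ∫ θ in (-Real.pi)..Real.pi, |(arcOp L g (x + θ * Complex.I)).im|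
        ≤ (C3 + 2 * Real.pi) * M := by
      have := intervalIntegral.integral_mono_on (μ := volume) (a := -Real.pi) (b := Real.pi)
        (f := fun θ : ℝ => |(arcOp L g (x + θ * Complex.I)).im|)
        (g := fun θ : ℝ => (arcOp L g (x + θ * Complex.I)).im ^ 2 * M⁻¹ + M)
        (by linarith) (Continuous.intervalIntegrable (by fun_prop) _ _)
        (Continuous.intervalIntegrable (by fun_prop) _ _) fun θ _ => by
          rw [← sq_abs, ← sub_nonneg]
          set t := |(arcOp L g (x + θ * Complex.I)).im|
          have : t ^ 2 * M⁻¹ + M - t = ((t - M / 2) ^ 2 + 3 * M ^ 2 / 4) * M⁻¹ := by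
            field_simp; ring
          rw [this]; positivity
      refine this.trans ?_
      rw [intervalIntegral.integral_add (Continuous.intervalIntegrable (by fun_prop) _ _)
        intervalIntegrable_const, intervalIntegral.integral_mul_const,
        intervalIntegral.integral_const, smul_eq_mul]
      have h4 := h3 g M hg hM x hx hx0
      have h5 : (∫ θ in (-Real.pi)..Real.pi, (arcOp L g (x + θ * Complex.I)).im ^ 2) * M⁻¹
          ≤ C3 * M ^ 2 * M⁻¹ := by gcongr
      have h6 : C3 * M ^ 2 * M⁻¹ = C3 * M := by field_simp
      linarith
    refine (lintegral_mono_set (t := Set.Ioc (-Real.pi) Real.pi) fun θ hθ =>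
      ⟨by linarith [hθ.1], hθ.2.le⟩).trans ?_
    rw [intervalIntegral.integral_of_le (by linarith)] at k1
    simp only [← Real.norm_eq_abs] at k1
    have hint : IntegrableOn (fun θ : ℝ => (arcOp L g (x + θ * Complex.I)).im)
        (Set.Ioc (-Real.pi) Real.pi) :=
      (cim.intervalIntegrable (μ := volume) (-Real.pi) Real.pi).1
    rw [← ofReal_integral_norm_eq_lintegral_enorm hint]
    exact ENNReal.ofReal_le_ofReal k1
  have hleft : ∫⁻ _ in Set.Ioo 0 Real.pi, ENNReal.ofReal (C2 * M) = ENNReal.ofReal (C2 * Real.pi * M) := by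
    rw [setLIntegral_const, Real.volume_Ioo, sub_zero, ← ENNReal.ofReal_mul (by positivity)]
    congr 1; ring
  rw [eLpNorm_one_eq_lintegral_enorm]
  calc _ ≤ ∫⁻ θ in Set.Ioo 0 Real.pi, ((‖rayOp L g (x + θ * Complex.I)‖ₑ + ENNReal.ofReal (C2 * M))
          + ‖(arcOp L g (x + θ * Complex.I)).im‖ₑ) := by
        refine setLIntegral_mono' measurableSet_Ioo fun θ hθ => ?_
        rw [bdOp_eq_add hL hg (hmem θ hθ), Complex.add_im, Complex.add_im]
        refine (enorm_add_le _ _).trans (add_le_add_left ((enorm_add_le _ _).trans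
          (add_le_add ?_ ?_)) _)
        · rw [← ofReal_norm, ← ofReal_norm]
          exact ENNReal.ofReal_le_ofReal (Complex.abs_im_le_norm _)
        · rw [← ofReal_norm]
          exact ENNReal.ofReal_le_ofReal ((Complex.abs_im_le_norm _).trans
            (h2 g M hM _ (by simpa using hx) (by simpa using hx0)))
    _ = _ := by
        rw [lintegral_add_right _ cim.enorm.measurable, lintegral_add_right _ measurable_const]
    _ ≤ C1 * ENNReal.ofReal M + ENNReal.ofReal (C2 * Real.pi * M)
          + ENNReal.ofReal ((C3 + 2 * Real.pi) * M) := by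
        rw [hleft]
        gcongr
        exact h1 g M hM x (by linarith) hx0
    _ = _ := by
        rw [ENNReal.ofReal_mul (p := C2 * Real.pi) (by positivity),
          ENNReal.ofReal_mul (p := C3 + 2 * Real.pi) (by positivity)]
        ring

end

/-! ### The trace of the imaginary part on the right side -/

section

variable {L : ℝ}

lemma add_mul_I_mem_rectDom {x θ : ℝ} (hx : -L < x) (hx0 : x < 0) (hθ : θ ∈ Set.Ioo 0 Real.pi) :
    (x + θ * Complex.I : ℂ) ∈ rectDom L := by
  rw [mem_rectDom]
  simpa using ⟨⟨hx, hx0⟩, hθ⟩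

lemma aestronglyMeasurable_im_vertical {D : ℂ → ℂ} (hD : ContinuousOn D (rectDom L)) {x : ℝ}
    (hx : -L < x) (hx0 : x < 0) :
    AEStronglyMeasurable (fun θ : ℝ => (D (x + θ * Complex.I)).im)
      (volume.restrict (Set.Ioo 0 Real.pi)) := by
  refine ContinuousOn.aestronglyMeasurable ?_ measurableSet_Ioo
  exact Complex.continuous_im.comp_continuousOn
    (hD.comp (by fun_prop) fun θ hθ => add_mul_I_mem_rectDom hx hx0 hθ)

lemma eventually_nhdsLT_zero {a : ℝ} (ha : a < 0) : ∀ᶠ x : ℝ in 𝓝[<] 0, a < x ∧ x < 0 := by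
  filter_upwards [Ioo_mem_nhdsLT ha] with x hx using hx

/-- A function which is continuous on the closed rectangle takes its boundary values on the right
side in `L¹`. -/
lemma tendsto_eLpNorm_im_of_continuousOn (hL : 0 < L) {D : ℂ → ℂ}
    (hD : ContinuousOn D (rectClosed L)) :
    Tendsto (fun x : ℝ => eLpNorm (fun θ : ℝ => (D (x + θ * Complex.I)).im - (D (θ * Complex.I)).im) 1
      (volume.restrict (Set.Ioo 0 Real.pi))) (𝓝[<] 0) (𝓝 0) := by
  have hun := (isCompact_rectClosed L).uniformContinuousOn_of_continuous hD
  have key : ∀ ε : ℝ, 0 < ε → ∀ᶠ x : ℝ in 𝓝[<] 0,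
      eLpNorm (fun θ : ℝ => (D (x + θ * Complex.I)).im - (D (θ * Complex.I)).im) 1
      (volume.restrict (Set.Ioo 0 Real.pi)) ≤ ENNReal.ofReal ε := by
    intro ε hε
    have hπ := Real.pi_pos
    obtain ⟨δ, hδ, h⟩ := Metric.uniformContinuousOn_iff.mp hun (ε / Real.pi) (by positivity)
    filter_upwards [eventually_nhdsLT_zero (neg_lt_zero.mpr hL),
      eventually_nhdsLT_zero (neg_lt_zero.mpr hδ)] with x hx hx'
    rw [eLpNorm_one_eq_lintegral_enorm]
    calc _ ≤ ∫⁻ _ in Set.Ioo 0 Real.pi, ENNReal.ofReal (ε / Real.pi) := by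
          refine setLIntegral_mono' measurableSet_Ioo fun θ hθ => ?_
          have h1 := h _ (rectDom_subset L (add_mul_I_mem_rectDom hx.1 hx.2 hθ)) _
            (right_mem hL (Set.Ioo_subset_Icc_self hθ)).1 (by
              rw [dist_eq_norm, add_sub_cancel_right, Complex.norm_real, Real.norm_eq_abs, abs_of_neg hx.2]
              linarith [hx'.1])
          rw [← ofReal_norm, ← Complex.sub_im]
          refine ENNReal.ofReal_le_ofReal ((Complex.abs_im_le_norm _).trans ?_)
          rw [← dist_eq_norm]; exact h1.le
      _ = ENNReal.ofReal ε := by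
          rw [setLIntegral_const, Real.volume_Ioo, sub_zero, ← ENNReal.ofReal_mul (by positivity),
            div_mul_cancel₀ _ hπ.ne']
  rw [ENNReal.tendsto_nhds_zero]
  intro ε hε
  by_cases hε' : ε = ⊤
  · simp [hε']
  · have := key ε.toReal (ENNReal.toReal_pos hε.ne' hε')
    rwa [ENNReal.ofReal_toReal hε'] at this

lemma memLp_im_right (hL : 0 < L) {D : ℂ → ℂ} (hD : ContinuousOn D (rectClosed L)) :
    MemLp (fun θ : ℝ => (D (θ * Complex.I)).im) 1 (volume.restrict (Set.Ioo 0 Real.pi)) := by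
  rw [memLp_one_iff_integrable]
  have h : ContinuousOn (fun θ : ℝ => (D (θ * Complex.I)).im) (Set.Icc 0 Real.pi) :=
    Complex.continuous_im.comp_continuousOn (hD.comp (by fun_prop) fun θ hθ => (right_mem hL hθ).1)
  exact (h.integrableOn_Icc).mono_set Set.Ioo_subset_Icc_self

/-- The imaginary part of the boundary operator has an `L¹` trace with mean zero on the right side:
this holds for smooth data, and the `L¹` bound is uniform in the data. -/
theorem exists_trace_bdOp (hL : 0 < L) {g : ℂ → ℝ} (hg : ContinuousOn g (rectBdry L)) :
    ∃ v : ℝ → ℝ, IntegrableOn v (Set.Ioo 0 Real.pi) ∧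
      Tendsto (fun x : ℝ => eLpNorm (fun θ : ℝ => (bdOp L g (x + θ * Complex.I)).im - v θ) 1
        (volume.restrict (Set.Ioo 0 Real.pi))) (𝓝[<] 0) (𝓝 0) ∧
      ∫ θ in Set.Ioo 0 Real.pi, v θ = 0 := by
  set μ := volume.restrict (Set.Ioo 0 Real.pi) with hμ
  obtain ⟨C, hC, hbound⟩ := exists_eLpNorm_im_bdOp_le hL
  have hε : ∀ n : ℕ, (0 : ℝ) < (1 / 2) ^ n := fun n => by positivity
  choose G hG hGg using fun n => exists_contDiff_abs_sub_le (isCompact_rectBdry L) hg (hε n)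
  choose D hDc hDd hDre hDeq hDim using fun n => exists_extension_bdOp hL (hG n)
  set v : ℕ → ℝ → ℝ := fun n θ => (D n (θ * Complex.I)).im with hv
  have hvm : ∀ n, MemLp (v n) 1 μ := fun n => memLp_im_right hL (hDc n)
  have hT : ∀ n, Tendsto (fun x : ℝ => eLpNorm (fun θ : ℝ => (D n (x + θ * Complex.I)).im - v n θ) 1 μ)
      (𝓝[<] 0) (𝓝 0) := fun n => tendsto_eLpNorm_im_of_continuousOn hL (hDc n)
  have hB := differentiableOn_bdOp hL hg
  have hL2 : -(L / 2) < 0 := by linarith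
  have hmD : ∀ n x, -L < x → x < 0 →
      AEStronglyMeasurable (fun θ : ℝ => (D n (x + θ * Complex.I)).im) μ := fun n x hx hx0 =>
    aestronglyMeasurable_im_vertical (hDd n).continuousOn hx hx0
  have hmB : ∀ x, -L < x → x < 0 →
      AEStronglyMeasurable (fun θ : ℝ => (bdOp L g (x + θ * Complex.I)).im) μ := fun x hx hx0 =>
    aestronglyMeasurable_im_vertical hB.continuousOn hx hx0
  -- on vertical lines near the right side the approximations are uniformly good in `L¹`
  have hclose : ∀ n x, -(L / 2) < x → x < 0 →
      eLpNorm (fun θ : ℝ => (bdOp L g (x + θ * Complex.I)).im - (D n (x + θ * Complex.I)).im) 1 μ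
        ≤ C * ENNReal.ofReal ((1 / 2) ^ n) := by
    intro n x hx hx0
    have h1 := hbound (fun v => g v - G n v) _ (hε n)
      (hg.fun_sub (hG n).continuous.continuousOn)
      (fun v hv => by rw [abs_sub_comm]; exact hGg n v hv) x hx.le hx0
    refine (eLpNorm_congr_ae ?_).trans_le h1
    refine (ae_restrict_iff' measurableSet_Ioo).mpr (ae_of_all _ fun θ hθ => ?_)
    have hmem := add_mul_I_mem_rectDom (L := L) (by linarith) hx0 hθ
    beta_reduce
    rw [bdOp_sub hL hg (hG n).continuous.continuousOn hmem, hDeq n _ hmem, Complex.sub_im]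
  have hvn : ∀ n x, -(L / 2) < x → x < 0 →
      eLpNorm (fun θ : ℝ => (bdOp L g (x + θ * Complex.I)).im - v n θ) 1 μ
        ≤ C * ENNReal.ofReal ((1 / 2) ^ n)
          + eLpNorm (fun θ : ℝ => (D n (x + θ * Complex.I)).im - v n θ) 1 μ := by
    intro n x hx hx0
    have h1 := eLpNorm_add_le ((hmB x (by linarith) hx0).sub (hmD n x (by linarith) hx0))
      ((hmD n x (by linarith) hx0).sub (hvm n).1) le_rfl
    refine le_trans (le_of_eq ?_) (h1.trans (add_le_add (hclose n x hx hx0) le_rfl))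
    congr 1
    ext θ
    simp
  -- hence the traces of the approximations are a Cauchy sequence
  have hcauchy : ∀ N n m : ℕ, N ≤ n → N ≤ m →
      eLpNorm (v n - v m) 1 μ ≤ 2 * (C * ENNReal.ofReal ((1 / 2) ^ N)) := by
    intro N n m hn hm
    have hpow : ∀ k, N ≤ k → C * ENNReal.ofReal ((1 / 2) ^ k) ≤ C * ENNReal.ofReal ((1 / 2) ^ N) := by
      intro k hk
      gcongr C * ENNReal.ofReal ?_
      exact pow_le_pow_of_le_one (by norm_num) (by norm_num) hk
    have hlim : Tendsto (fun x : ℝ => 2 * (C * ENNReal.ofReal ((1 / 2) ^ N))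
        + (eLpNorm (fun θ : ℝ => (D n (x + θ * Complex.I)).im - v n θ) 1 μ
          + eLpNorm (fun θ : ℝ => (D m (x + θ * Complex.I)).im - v m θ) 1 μ)) (𝓝[<] 0)
        (𝓝 (2 * (C * ENNReal.ofReal ((1 / 2) ^ N)))) := by
      have := ((hT n).add (hT m)).const_add (2 * (C * ENNReal.ofReal ((1 / 2) ^ N)))
      simpa using this
    refine ge_of_tendsto hlim ?_
    filter_upwards [eventually_nhdsLT_zero hL2] with x hx
    have hmb := hmB x (by linarith [hx.1]) hx.2
    have h1 := eLpNorm_sub_le (hmb.sub (hvm m).1) (hmb.sub (hvm n).1) (le_refl (1 : ℝ≥0∞))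
    have h2 : v n - v m = ((fun θ : ℝ => (bdOp L g (x + θ * Complex.I)).im) - v m)
        - ((fun θ : ℝ => (bdOp L g (x + θ * Complex.I)).im) - v n) := by ext; simp
    rw [h2]
    refine h1.trans ?_
    have h3 := hvn n x hx.1 hx.2
    have h4 := hvn m x hx.1 hx.2
    refine (add_le_add (h4.trans (add_le_add (hpow m hm) le_rfl))
      (h3.trans (add_le_add (hpow n hn) le_rfl))).trans_eq ?_
    ring
  -- `C + 1` in place of `C` makes the bound strict, also for `C = 0`
  set B : ℕ → ℝ≥0∞ := fun N => 2 * ((C + 1) * ENNReal.ofReal ((1 / 2) ^ N)) with hBdef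
  have hBsum : ∑' N, B N ≠ ⊤ := by
    simp only [hBdef, ENNReal.tsum_mul_left]
    refine ENNReal.mul_ne_top (by norm_num) (ENNReal.mul_ne_top (by simp [hC]) ?_)
    rw [← ENNReal.ofReal_tsum_of_nonneg (fun n => (hε n).le)
      (summable_geometric_of_lt_one (by norm_num) (by norm_num))]
    exact ENNReal.ofReal_ne_top
  obtain ⟨w, hw, hwlim⟩ := Lp.cauchy_complete_eLpNorm (p := 1) le_rfl hvm hBsum
    fun N n m hn hm => (hcauchy N n m hn hm).trans_lt (by
      simp only [hBdef]
      gcongr 2 * ?_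
      · norm_num
      · rw [add_mul, one_mul]
        exact ENNReal.lt_add_right (ENNReal.mul_ne_top hC ENNReal.ofReal_ne_top) (by simp))
  -- the limit of the traces is the trace, and it inherits the mean zero
  refine ⟨w, memLp_one_iff_integrable.mp hw, ?_, ?_⟩
  · rw [ENNReal.tendsto_nhds_zero]
    intro ε hε0
    have hlim : Tendsto (fun n : ℕ => C * ENNReal.ofReal ((1 / 2) ^ n) + eLpNorm (v n - w) 1 μ) atTop
        (𝓝 0) := by
      have h1 : Tendsto (fun n : ℕ => ENNReal.ofReal ((1 / 2) ^ n)) atTop (𝓝 0) := by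
        rw [← ENNReal.ofReal_zero]
        exact ENNReal.tendsto_ofReal (tendsto_pow_atTop_nhds_zero_of_lt_one (by norm_num) (by norm_num))
      simpa using (ENNReal.Tendsto.const_mul h1 (Or.inr hC)).add hwlim
    have hε2 : ε / 2 > 0 := ENNReal.half_pos hε0.ne'
    obtain ⟨n, hn⟩ := (ENNReal.tendsto_nhds_zero.mp hlim _ hε2).exists
    filter_upwards [eventually_nhdsLT_zero hL2, ENNReal.tendsto_nhds_zero.mp (hT n) _ hε2] with x hx hx2
    have h1 := eLpNorm_add_le ((hmB x (by linarith [hx.1]) hx.2).sub (hvm n).1)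
      ((hvm n).1.sub hw.1) (le_refl (1 : ℝ≥0∞))
    have h2 : (fun θ : ℝ => (bdOp L g (x + θ * Complex.I)).im - w θ)
        = ((fun θ : ℝ => (bdOp L g (x + θ * Complex.I)).im) - v n) + (v n - w) := by ext; simp
    rw [h2]
    calc _ ≤ _ := h1
      _ ≤ _ := add_le_add (hvn n x hx.1 hx.2) le_rfl
      _ = (C * ENNReal.ofReal ((1 / 2) ^ n) + eLpNorm (v n - w) 1 μ) + _ := add_right_comm _ _ _
      _ ≤ ε / 2 + ε / 2 := add_le_add hn hx2
      _ = ε := ENNReal.add_halves ε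
  · have h1 := tendsto_integral_of_L1' w hw.1
      (Eventually.of_forall fun n => memLp_one_iff_integrable.mp (hvm n)) hwlim
    have h2 : ∀ n, ∫ θ, v n θ ∂μ = 0 := fun n => by
      have := hDim n
      rwa [intervalIntegral.integral_of_le Real.pi_pos.le, integral_Ioc_eq_integral_Ioo] at this
    simp only [h2] at h1
    exact tendsto_nhds_unique h1 tendsto_const_nhds

end

/-! ### The conformal map from the rectangle onto the sector ring -/

section

/-- The width of the rectangle onto which the sector ring is mapped. -/
def logWidth (r α : ℝ) : ℝ := -(α * Real.log r)

/-- The conformal map from the rectangle onto the sector ring. -/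
def expMap (α : ℝ) (u : ℂ) : ℂ := Complex.exp (u / α)

/-- The inverse of `expMap`; writing `log (-z) + iπ` puts the cut of the logarithm on the positive
real axis. -/
def logMap (α : ℝ) (z : ℂ) : ℂ := α * (Complex.log (-z) + Real.pi * Complex.I)

variable {r α : ℝ}

lemma logWidth_pos (hr0 : 0 < r) (hr1 : r < 1) (hα : 0 < α) : 0 < logWidth r α := by
  have := mul_neg_of_pos_of_neg hα (Real.log_neg hr0 hr1)
  rw [logWidth]; linarith

lemma argPos_exp {w : ℂ} (h0 : 0 < w.im) (h1 : w.im < 2 * Real.pi) :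
    argPos (Complex.exp w) = w.im := by
  have harg : (Complex.exp w).arg = toIocMod Real.two_pi_pos (-Real.pi) w.im := by
    rw [Complex.arg_exp]
  rcases le_or_gt w.im Real.pi with h | h
  · have : toIocMod Real.two_pi_pos (-Real.pi) w.im = w.im :=
      (toIocMod_eq_self Real.two_pi_pos).mpr ⟨by linarith, by linarith⟩
    rw [argPos, harg, this, if_pos h0.le]
  · have : toIocMod Real.two_pi_pos (-Real.pi) w.im = w.im - 2 * Real.pi := by
      rw [← toIocMod_sub]
      exact (toIocMod_eq_self Real.two_pi_pos).mpr ⟨by linarith, by linarith⟩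
    rw [argPos, harg, this, if_neg (by linarith)]
    ring

lemma expMap_ne_zero (α : ℝ) (u : ℂ) : expMap α u ≠ 0 := Complex.exp_ne_zero _

lemma expMap_logMap (hα : 0 < α) {z : ℂ} (hz : z ≠ 0) : expMap α (logMap α z) = z := by
  have : (α : ℂ) ≠ 0 := Complex.ofReal_ne_zero.mpr hα.ne'
  rw [expMap, logMap, mul_div_cancel_left₀ _ this, Complex.exp_add, Complex.exp_log (neg_ne_zero.mpr hz),
    Complex.exp_pi_mul_I]
  ring

lemma norm_expMap (α : ℝ) (u : ℂ) : ‖expMap α u‖ = Real.exp (u.re / α) := by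
  rw [expMap, Complex.norm_exp, Complex.div_ofReal_re]

/-- Angles stay in `[0, 2π]`: this is where `α ≥ 1 / 2` enters. -/
lemma div_lt_two_pi (hα : 1 / 2 ≤ α) {t : ℝ} (ht : t < Real.pi) (ht0 : 0 ≤ t) :
    t / α < 2 * Real.pi := by
  rw [div_lt_iff₀ (by linarith)]
  nlinarith [Real.pi_pos]

lemma argPos_expMap (hα : 1 / 2 ≤ α) {u : ℂ} (h0 : 0 < u.im) (h1 : u.im < Real.pi) :
    argPos (expMap α u) = u.im / α := by
  have hα0 : 0 < α := by linarith
  rw [expMap, argPos_exp, Complex.div_ofReal_im]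
  · rw [Complex.div_ofReal_im]; positivity
  · rw [Complex.div_ofReal_im]; exact div_lt_two_pi hα h1 h0.le

lemma logMap_expMap (hα : 1 / 2 ≤ α) {u : ℂ} (h0 : 0 < u.im) (h1 : u.im < Real.pi) :
    logMap α (expMap α u) = u := by
  have hα0 : 0 < α := by linarith
  have hα' : (α : ℂ) ≠ 0 := Complex.ofReal_ne_zero.mpr hα0.ne'
  have h2 := div_lt_two_pi hα h1 h0.le
  have h3 : 0 < u.im / α := by positivity
  have : -expMap α u = Complex.exp (u / α - Real.pi * Complex.I) := by
    rw [Complex.exp_sub, Complex.exp_pi_mul_I, expMap]; ring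
  rw [logMap, this, Complex.log_exp]
  · field_simp; ring
  · simp only [Complex.sub_im, Complex.div_ofReal_im, Complex.mul_im, Complex.ofReal_re,
      Complex.I_im, Complex.ofReal_im, Complex.I_re]
    linarith
  · simp only [Complex.sub_im, Complex.div_ofReal_im, Complex.mul_im, Complex.ofReal_re,
      Complex.I_im, Complex.ofReal_im, Complex.I_re]
    linarith

lemma neg_mem_slitPlane {z : ℂ} (h : 0 < argPos z) : -z ∈ Complex.slitPlane := by
  rw [Complex.mem_slitPlane_iff]
  by_contra hcon
  push Not at hcon
  obtain ⟨h1, h2⟩ := hcon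
  simp only [Complex.neg_re, Complex.neg_im, neg_nonpos, neg_eq_zero] at h1 h2
  have : z.arg = 0 := Complex.arg_eq_zero_iff.mpr ⟨h1, h2⟩
  simp [argPos, this] at h

lemma logMap_re (α : ℝ) (z : ℂ) : (logMap α z).re = α * Real.log ‖z‖ := by
  simp [logMap, Complex.log_re]

lemma logMap_im {z : ℂ} (h : 0 < argPos z) : (logMap α z).im = α * argPos z := by
  have hz := neg_mem_slitPlane h
  have hz0 : z ≠ 0 := neg_ne_zero.mp (Complex.slitPlane_ne_zero hz)
  have h1 : Complex.exp (Complex.log (-z) + Real.pi * Complex.I) = z := by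
    rw [Complex.exp_add, Complex.exp_log (neg_ne_zero.mpr hz0), Complex.exp_pi_mul_I]; ring
  have h2 : (Complex.log (-z) + Real.pi * Complex.I).im = (-z).arg + Real.pi := by
    simp [Complex.log_im]
  have h3 := argPos_exp (w := Complex.log (-z) + Real.pi * Complex.I)
    (by rw [h2]; linarith [Complex.neg_pi_lt_arg (-z)])
    (by rw [h2]; linarith [lt_of_le_of_ne (Complex.arg_le_pi (-z))
          (Complex.mem_slitPlane_iff_arg.mp hz).1])
  rw [h1] at h3
  rw [logMap, Complex.im_ofReal_mul, h3]

lemma mem_domain_iff (hr0 : 0 < r) (hα : 0 < α) {z : ℂ} :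
    z ∈ domain r α ↔ 0 < argPos z ∧ logMap α z ∈ rectDom (logWidth r α) := by
  have key : ∀ h : 0 < argPos z, (logMap α z ∈ rectDom (logWidth r α) ↔
      (r < ‖z‖ ∧ ‖z‖ < 1) ∧ argPos z < Real.pi / α) := by
    intro h
    have hz0 : 0 < ‖z‖ := norm_pos_iff.mpr
      (neg_ne_zero.mp (Complex.slitPlane_ne_zero (neg_mem_slitPlane h)))
    rw [mem_rectDom, logMap_re, logMap_im h, logWidth, neg_neg, mul_lt_mul_iff_right₀ hα,
      Real.log_lt_log_iff hr0 hz0, lt_div_iff₀' hα, ← Real.log_neg_iff hz0]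
    constructor
    · rintro ⟨⟨h1, h2⟩, -, h3⟩
      exact ⟨⟨h1, neg_of_mul_neg_right h2 hα.le⟩, h3⟩
    · rintro ⟨⟨h1, h2⟩, h3⟩
      exact ⟨⟨h1, mul_neg_of_pos_of_neg hα h2⟩, by positivity, h3⟩
  constructor
  · rintro ⟨h1, h2, h3, h4⟩
    exact ⟨h3, (key h3).mpr ⟨⟨h1, h2⟩, h4⟩⟩
  · rintro ⟨h1, h2⟩
    obtain ⟨⟨h3, h4⟩, h5⟩ := (key h1).mp h2
    exact ⟨h3, h4, h1, h5⟩

lemma logMap_mem (hr0 : 0 < r) (hα : 0 < α) {z : ℂ} (hz : z ∈ domain r α) :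
    logMap α z ∈ rectDom (logWidth r α) := ((mem_domain_iff hr0 hα).mp hz).2

lemma ne_zero_of_mem_domain (hr0 : 0 < r) {z : ℂ} (hz : z ∈ domain r α) : z ≠ 0 :=
  norm_pos_iff.mp (hr0.trans hz.1)

lemma expMap_mem (hr0 : 0 < r) (hα : 1 / 2 ≤ α) {u : ℂ} (hu : u ∈ rectDom (logWidth r α)) :
    expMap α u ∈ domain r α := by
  have hα0 : 0 < α := by linarith
  rw [mem_domain_iff hr0 hα0, logMap_expMap hα hu.2.1 hu.2.2, argPos_expMap hα hu.2.1 hu.2.2]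
  exact ⟨div_pos hu.2.1 hα0, hu⟩

lemma differentiableAt_logMap {z : ℂ} (h : 0 < argPos z) :
    DifferentiableAt ℂ (logMap α) z := by
  unfold logMap
  exact ((differentiableAt_id.neg.clog (neg_mem_slitPlane h)).add_const _).const_mul _

lemma hasDerivAt_logMap {z : ℂ} (h : 0 < argPos z) : HasDerivAt (logMap α) (α / z) z := by
  have h1 := (((hasDerivAt_id z).neg.clog (neg_mem_slitPlane h)).add_const
    (Real.pi * Complex.I)).const_mul (α : ℂ)
  convert! h1 using 1
  simp [div_eq_mul_inv]

lemma hasDerivAt_expMap (α : ℝ) (u : ℂ) : HasDerivAt (expMap α) (expMap α u / α) u := by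
  have := ((hasDerivAt_id u).div_const (α : ℂ)).cexp
  convert! this using 1
  simp [expMap, div_eq_mul_inv]

lemma continuous_expMap (α : ℝ) : Continuous (expMap α) :=
  continuous_iff_continuousAt.mpr fun u => (hasDerivAt_expMap α u).continuousAt

lemma continuousOn_logMap (r α : ℝ) : ContinuousOn (logMap α) (domain r α) := fun _ hz =>
  (differentiableAt_logMap hz.2.2.1).continuousAt.continuousWithinAt

lemma argPos_pos_of_neg_mem_slitPlane {z : ℂ} (h : -z ∈ Complex.slitPlane) : 0 < argPos z := by
  rw [argPos]
  split_ifs with h0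
  · refine lt_of_le_of_ne h0 fun h1 => ?_
    obtain ⟨h2, h3⟩ := Complex.arg_eq_zero_iff.mp h1.symm
    rcases Complex.mem_slitPlane_iff.mp h with h4 | h4 <;> simp at h4 <;> [linarith; exact h4 h3]
  · linarith [Complex.neg_pi_lt_arg z, Real.pi_pos]

lemma isOpen_domain (hr0 : 0 < r) (hα : 0 < α) : IsOpen (domain r α) := by
  have hS : IsOpen {z : ℂ | -z ∈ Complex.slitPlane} := Complex.isOpen_slitPlane.preimage continuous_neg
  have hc : ContinuousOn (logMap α) {z : ℂ | -z ∈ Complex.slitPlane} := fun z hz =>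
    (differentiableAt_logMap (argPos_pos_of_neg_mem_slitPlane hz)).continuousAt.continuousWithinAt
  convert! hc.isOpen_inter_preimage hS (isOpen_rectDom (logWidth r α)) using 1
  ext z
  rw [mem_domain_iff hr0 hα]
  exact ⟨fun h => ⟨neg_mem_slitPlane h.1, h.2⟩, fun h => ⟨argPos_pos_of_neg_mem_slitPlane h.1, h.2⟩⟩

lemma image_expMap (hr0 : 0 < r) (hα : 1 / 2 ≤ α) :
    expMap α '' rectDom (logWidth r α) = domain r α := by
  have hα0 : 0 < α := by linarith
  refine Set.Subset.antisymm (Set.image_subset_iff.mpr fun u hu => expMap_mem hr0 hα hu) fun z hz => ?_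
  exact ⟨logMap α z, logMap_mem hr0 hα0 hz, expMap_logMap hα0 (ne_zero_of_mem_domain hr0 hz)⟩

lemma injOn_expMap (hα : 1 / 2 ≤ α) (L : ℝ) : Set.InjOn (expMap α) (rectDom L) := fun u hu v hv h => by
  rw [← logMap_expMap hα hu.2.1 hu.2.2, h, logMap_expMap hα hv.2.1 hv.2.2]

lemma closure_domain (hr0 : 0 < r) (hr1 : r < 1) (hα : 1 / 2 ≤ α) :
    closure (domain r α) = expMap α '' rectClosed (logWidth r α) := by
  have hL := logWidth_pos hr0 hr1 (by linarith : 0 < α)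
  rw [← image_expMap hr0 hα, ← closure_rectDom hL]
  refine Set.Subset.antisymm ?_ (image_closure_subset_closure_image (continuous_expMap α))
  refine closure_minimal (Set.image_mono subset_closure) ?_
  rw [closure_rectDom hL]
  exact ((isCompact_rectClosed _).image (continuous_expMap α)).isClosed

lemma expMap_notMem_domain (hr0 : 0 < r) (hα : 1 / 2 ≤ α) {v : ℂ}
    (hv : v ∈ rectBdry (logWidth r α)) : expMap α v ∉ domain r α := by
  have hα0 : 0 < α := by linarith
  have hα' : (α : ℂ) ≠ 0 := Complex.ofReal_ne_zero.mpr hα0.ne'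
  intro h
  have hu := logMap_mem hr0 hα0 h
  set u := logMap α (expMap α v) with hu_def
  have he : expMap α u = expMap α v := expMap_logMap hα0 (expMap_ne_zero α v)
  obtain ⟨n, hn⟩ := Complex.exp_eq_exp_iff_exists_int.mp he
  have h1 : u = v + n * (2 * Real.pi * α) * Complex.I := by
    field_simp at hn
    linear_combination hn
  have h2 := congrArg Complex.im h1
  simp at h2
  have h3 := mem_rectClosed.mp hv.1
  have h4 := mem_rectDom.mp hu
  have h5 : (n : ℝ) = 0 := by
    have hπ := Real.pi_pos
    have hc : Real.pi ≤ 2 * Real.pi * α := by nlinarith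
    rcases lt_trichotomy n 0 with h | h | h
    · have : (n : ℝ) ≤ -1 := by exact_mod_cast Int.le_sub_one_of_lt h
      nlinarith
    · exact_mod_cast h
    · have : (1 : ℝ) ≤ n := by exact_mod_cast h
      nlinarith
  have h6 : u = v := by
    rw [h1]
    have : (n : ℂ) = 0 := by exact_mod_cast h5
    rw [this]; ring
  exact hv.2 (h6 ▸ hu)

lemma expMap_mem_frontier (hr0 : 0 < r) (hr1 : r < 1) (hα : 1 / 2 ≤ α) {v : ℂ}
    (hv : v ∈ rectBdry (logWidth r α)) : expMap α v ∈ frontier (domain r α) := by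
  rw [(isOpen_domain hr0 (by linarith)).frontier_eq, closure_domain hr0 hr1 hα]
  exact ⟨⟨v, hv.1, rfl⟩, expMap_notMem_domain hr0 hα hv⟩

/-- A limit at the boundary of the rectangle transfers to the boundary of the sector ring.  When
`α = 1 / 2` a boundary point has two preimages, and the limits along both have to agree. -/
lemma tendsto_comp_logMap (hr0 : 0 < r) (hα : 1 / 2 ≤ α) {Φ : ℂ → ℝ} {γ : ℂ → ℝ}
    (h : ∀ v ∈ rectBdry (logWidth r α),
      Tendsto Φ (𝓝[rectDom (logWidth r α)] v) (𝓝 (γ (expMap α v))))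
    {t : ℂ} (ht : t ∈ frontier (domain r α)) :
    Tendsto (fun z => Φ (logMap α z)) (𝓝[domain r α] t) (𝓝 (γ t)) := by
  have hα0 : 0 < α := by linarith
  -- along an ultrafilter the preimages converge, by compactness of the closed rectangle
  rw [tendsto_iff_ultrafilter]
  intro F hF
  have hFd : domain r α ∈ F := hF self_mem_nhdsWithin
  have hFt : (F : Filter ℂ) ≤ 𝓝 t := hF.trans nhdsWithin_le_nhds
  have hmap : rectDom (logWidth r α) ∈ F.map (logMap α) := by
    rw [Ultrafilter.mem_map]
    exact Filter.mem_of_superset hFd fun z hz => logMap_mem hr0 hα0 hz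
  obtain ⟨v, hv, hvF⟩ := (isCompact_rectClosed (logWidth r α)).ultrafilter_le_nhds (F.map (logMap α))
    (le_principal_iff.mpr (Filter.mem_of_superset hmap (rectDom_subset _)))
  have hlim : Tendsto (logMap α) F (𝓝 v) := hvF
  have hvt : expMap α v = t := by
    have h1 : Tendsto (fun z => expMap α (logMap α z)) F (𝓝 (expMap α v)) :=
      (continuous_expMap α).continuousAt.tendsto.comp hlim
    have h2 : Tendsto (fun z => expMap α (logMap α z)) F (𝓝 t) :=
      Tendsto.congr' (Filter.mem_of_superset hFd fun z hz =>
        (expMap_logMap hα0 (ne_zero_of_mem_domain hr0 hz)).symm) (hFt : Tendsto id F (𝓝 t))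
    exact tendsto_nhds_unique h1 h2
  have hvb : v ∈ rectBdry (logWidth r α) := by
    refine ⟨hv, fun hvd => ?_⟩
    rw [(isOpen_domain hr0 hα0).frontier_eq] at ht
    exact ht.2 (hvt ▸ expMap_mem hr0 hα hvd)
  rw [← hvt]
  exact (h v hvb).comp (tendsto_nhdsWithin_iff.mpr ⟨hlim, hmap⟩)

lemma continuousOn_comp_expMap (hr0 : 0 < r) (hr1 : r < 1) (hα : 1 / 2 ≤ α) {γ : ℂ → ℝ}
    (hγ : ContinuousOn γ (frontier (domain r α))) :
    ContinuousOn (fun v => γ (expMap α v)) (rectBdry (logWidth r α)) :=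
  hγ.comp (continuous_expMap α).continuousOn fun _ hv => expMap_mem_frontier hr0 hr1 hα hv

end

/-! ### The kernels of the formula in logarithmic coordinates -/

section

variable {r α : ℝ}

lemma psi_of_exp_eq {Y a b : ℂ} (h : Complex.exp Y = a / b) (hb : b ≠ 0) : psi Y = a / (b - a) := by
  rw [psi, h, one_sub_div hb, div_div_div_cancel_right₀ hb]

lemma rpow_two_mul (hr0 : 0 < r) (m : ℕ) :
    ((r ^ (2 * α * m) : ℝ) : ℂ) = Complex.exp (-(2 * logWidth r α * m : ℝ)) := by
  rw [← Complex.ofReal_neg, ← Complex.ofReal_exp, Real.rpow_def_of_pos hr0, logWidth]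
  congr 2; ring

lemma psi_translates (U V t : ℂ) :
    psi (U - V - t) = Complex.exp (-t) * Complex.exp U
        / (Complex.exp V - Complex.exp (-t) * Complex.exp U) ∧
    psi (U + V - t) = Complex.exp (-t) * Complex.exp U * Complex.exp V
        / (1 - Complex.exp (-t) * Complex.exp U * Complex.exp V) ∧
    psi (-(U + V) - t) = Complex.exp (-t)
        / (Complex.exp U * Complex.exp V - Complex.exp (-t)) := by
  refine ⟨psi_of_exp_eq ?_ (Complex.exp_ne_zero V), psi_of_exp_eq ?_ one_ne_zero,
    psi_of_exp_eq ?_ (mul_ne_zero (Complex.exp_ne_zero U) (Complex.exp_ne_zero V))⟩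
  · rw [eq_div_iff (Complex.exp_ne_zero V), ← Complex.exp_add, ← Complex.exp_add]; congr 1; ring
  · rw [div_one, ← Complex.exp_add, ← Complex.exp_add]; congr 1; ring
  · rw [← Complex.exp_add, eq_div_iff (Complex.exp_ne_zero _), ← Complex.exp_add]; congr 1; ring

/-- In logarithmic coordinates each term of the series in `H₂` is a combination of translates of
`psi`. -/
lemma H2term_exp (hr0 : 0 < r) (U V : ℂ) (m : ℕ) :
    H2term r α (Complex.exp U) (Complex.exp V) m
      = (Complex.exp V)⁻¹ * (psi (U - V - (2 * logWidth r α * m : ℝ))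
        - psi (-(U - V) - (2 * logWidth r α * m : ℝ)) - psi (U + V - (2 * logWidth r α * m : ℝ))
        + psi (-(U + V) - (2 * logWidth r α * m : ℝ))) := by
  obtain ⟨h1, h2, h3⟩ := psi_translates U V (2 * logWidth r α * m : ℝ)
  obtain ⟨h4, -, -⟩ := psi_translates V U (2 * logWidth r α * m : ℝ)
  rw [neg_sub, h1, h2, h3, h4, H2term, rpow_two_mul hr0]
  have hb := Complex.exp_ne_zero V
  set a := Complex.exp U
  set b := Complex.exp V
  set k := Complex.exp (-(2 * logWidth r α * m : ℝ))
  rw [← neg_sub a (k * b), ← neg_sub b (k * a), ← neg_sub (a * b) k, ← neg_sub 1 (k * a * b)]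
  generalize a - k * b = p
  generalize b - k * a = q
  generalize a * b - k = s
  have hbb : b * b⁻¹ = 1 := mul_inv_cancel₀ hb
  simp only [div_eq_mul_inv, mul_inv, inv_neg, mul_neg]
  linear_combination (k * p⁻¹ + k * a * (1 - k * a * b)⁻¹) * hbb

lemma H1term_exp (hr0 : 0 < r) (U V : ℂ) (m : ℕ) :
    H1term r α (Complex.exp U) (Complex.exp V) m
      = psi (U - V - (2 * logWidth r α * m : ℝ)) - psi (-(U - V) - (2 * logWidth r α * m : ℝ))
        - (psi (U - starRingEnd ℂ V - (2 * logWidth r α * m : ℝ))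
          - psi (-(U - starRingEnd ℂ V) - (2 * logWidth r α * m : ℝ))) := by
  obtain ⟨h1, -, -⟩ := psi_translates U V (2 * logWidth r α * m : ℝ)
  obtain ⟨h2, -, -⟩ := psi_translates V U (2 * logWidth r α * m : ℝ)
  obtain ⟨h3, -, -⟩ := psi_translates U (starRingEnd ℂ V) (2 * logWidth r α * m : ℝ)
  obtain ⟨h4, -, -⟩ := psi_translates (starRingEnd ℂ V) U (2 * logWidth r α * m : ℝ)
  rw [neg_sub, neg_sub, h1, h2, h3, h4, H1term, rpow_two_mul hr0, ← Complex.exp_conj]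
  set a := Complex.exp U
  set b := Complex.exp V
  set b' := Complex.exp (starRingEnd ℂ V)
  set k := Complex.exp (-(2 * logWidth r α * m : ℝ))
  rw [← neg_sub a (k * b), ← neg_sub b (k * a), ← neg_sub a (k * b'), ← neg_sub b' (k * a)]
  simp only [div_eq_mul_inv, inv_neg, mul_neg]
  ring

lemma hasSum_psi {L : ℝ} (hL : 0 < L) {X : ℂ} (h : X.re < 2 * L) :
    HasSum (fun n : ℕ => psi (X - (2 * L * (n + 1 : ℕ) : ℝ))) (kerA L X) := by
  have := (summable_psi hL h).hasSum
  simpa [kerA] using this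

lemma hasSum_H2term (hr0 : 0 < r) (hr1 : r < 1) (hα : 0 < α) {U V : ℂ}
    (h1 : |(U - V).re| < 2 * logWidth r α) (h2 : |(U + V).re| < 2 * logWidth r α) :
    HasSum (fun n : ℕ => H2term r α (Complex.exp U) (Complex.exp V) (n + 1))
      ((Complex.exp V)⁻¹ * (kerA (logWidth r α) (U - V) - kerA (logWidth r α) (-(U - V))
        - kerA (logWidth r α) (U + V) + kerA (logWidth r α) (-(U + V)))) := by
  have hL := logWidth_pos hr0 hr1 hα
  have h1 := abs_lt.mp h1
  have h2 := abs_lt.mp h2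
  simp only [H2term_exp hr0]
  exact ((((hasSum_psi hL h1.2).sub (hasSum_psi hL (by rw [Complex.neg_re]; linarith))).sub
    (hasSum_psi hL h2.2)).add (hasSum_psi hL (by rw [Complex.neg_re]; linarith))).mul_left _

lemma hasSum_H1term (hr0 : 0 < r) (hr1 : r < 1) (hα : 0 < α) {U V : ℂ}
    (h1 : |(U - V).re| < 2 * logWidth r α) :
    HasSum (fun n : ℕ => H1term r α (Complex.exp U) (Complex.exp V) (n + 1))
      (kerA (logWidth r α) (U - V) - kerA (logWidth r α) (-(U - V))
        - (kerA (logWidth r α) (U - starRingEnd ℂ V)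
          - kerA (logWidth r α) (-(U - starRingEnd ℂ V)))) := by
  have hL := logWidth_pos hr0 hr1 hα
  have h1 := abs_lt.mp h1
  have h2 : (U - starRingEnd ℂ V).re = (U - V).re := by simp
  simp only [H1term_exp hr0]
  exact ((hasSum_psi hL h1.2).sub (hasSum_psi hL (by rw [Complex.neg_re]; linarith))).sub
    ((hasSum_psi hL (by rw [h2]; exact h1.2)).sub
      (hasSum_psi hL (by rw [Complex.neg_re, h2]; linarith)))

lemma H2_exp (hr0 : 0 < r) (hr1 : r < 1) (hα : 0 < α) {U V : ℂ}
    (h1 : |(U - V).re| < 2 * logWidth r α) (h2 : |(U + V).re| < 2 * logWidth r α)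
    (h3 : Complex.exp (U - V) ≠ 1) :
    H2 r α (Complex.exp U) (Complex.exp V)
      = (Complex.exp V)⁻¹ * kerK (logWidth r α) U V := by
  rw [H2, (hasSum_H2term hr0 hr1 hα h1 h2).tsum_eq, kerK, kerP, kerP]
  have hb := Complex.exp_ne_zero V
  have e1 : psi (U - V) = Complex.exp U / (Complex.exp V - Complex.exp U) :=
    psi_of_exp_eq (Complex.exp_sub U V) hb
  have e2 : psi (U + V) = Complex.exp U * Complex.exp V / (1 - Complex.exp U * Complex.exp V) :=
    psi_of_exp_eq (by rw [div_one, Complex.exp_add]) one_ne_zero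
  have e3 : Complex.exp V - Complex.exp U ≠ 0 := fun h => h3 (by
    rw [Complex.exp_sub, ← sub_eq_zero.mp h, div_self hb])
  rw [e1, e2]
  generalize hd : 1 - Complex.exp U * Complex.exp V = d
  have e4 : 1 / (Complex.exp V - Complex.exp U)
      = (Complex.exp V)⁻¹ * (1 + Complex.exp U / (Complex.exp V - Complex.exp U)) := by
    field_simp; ring
  have e5 : Complex.exp U / d = (Complex.exp V)⁻¹ * (Complex.exp U * Complex.exp V / d) := by
    field_simp
  rw [e4, e5]
  ring

lemma H1_exp (hr0 : 0 < r) (hr1 : r < 1) (hα : 0 < α) {U V : ℂ}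
    (h1 : |(U - V).re| < 2 * logWidth r α)
    (h3 : Complex.exp (U - V) ≠ 1) (h4 : Complex.exp (U - starRingEnd ℂ V) ≠ 1) :
    H1 r α (Complex.exp U) (Complex.exp V)
      = kerP (logWidth r α) (U - V) - kerP (logWidth r α) (U - starRingEnd ℂ V) := by
  rw [H1, (hasSum_H1term hr0 hr1 hα h1).tsum_eq, kerP, kerP, ← Complex.exp_conj]
  have key : ∀ W : ℂ, Complex.exp (U - W) ≠ 1 →
      (Complex.exp W + Complex.exp U) / (Complex.exp W - Complex.exp U) = 1 + 2 * psi (U - W) := by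
    intro W hW
    have hb := Complex.exp_ne_zero W
    have e3 : Complex.exp W - Complex.exp U ≠ 0 := fun h => hW (by
      rw [Complex.exp_sub, ← sub_eq_zero.mp h, div_self hb])
    rw [psi_of_exp_eq (Complex.exp_sub U W) hb]
    field_simp
    ring
  rw [key V h3, key _ h4]
  ring

/-- On the outer arc `H₁` is the boundary kernel up to its mean. -/
lemma H1_exp_of_re_zero (hr0 : 0 < r) (hr1 : r < 1) (hα : 0 < α) {U V : ℂ}
    (hU : U ∈ rectDom (logWidth r α)) (hV : V.re = 0) :
    H1 r α (Complex.exp U) (Complex.exp V) = 2 * (kerK (logWidth r α) U V - 1) := by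
  have hU := (mem_rectDom.mp hU).1
  rw [H1_exp hr0 hr1 hα (by simp [hV]; exact abs_lt.mpr ⟨by linarith, by linarith⟩)
    (exp_ne_one_of_re_ne_zero (by simp [hV]; linarith))
    (exp_ne_one_of_re_ne_zero (by simp [hV]; linarith)), conj_eq_neg_of_re hV, sub_neg_eq_add, kerK]
  ring

lemma H1_exp_of_re (hr0 : 0 < r) (hr1 : r < 1) (hα : 0 < α) {U V : ℂ}
    (hU : U ∈ rectDom (logWidth r α)) (hV : V.re = -logWidth r α) :
    H1 r α (Complex.exp U) (Complex.exp V) = 2 * kerK (logWidth r α) U V := by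
  have hL := logWidth_pos hr0 hr1 hα
  have hU := (mem_rectDom.mp hU).1
  have hP := kerP_add_two_mul hL (X := U + V) (by simp [hV]; linarith) (by simp [hV]; linarith)
  rw [H1_exp hr0 hr1 hα (by simp [hV]; exact abs_lt.mpr ⟨by linarith, by linarith⟩)
    (exp_ne_one_of_re_ne_zero (by simp [hV]; linarith))
    (exp_ne_one_of_re_ne_zero (by simp [hV]; linarith)), conj_eq_of_re hV,
    show U - (-V - ((2 * logWidth r α : ℝ) : ℂ)) = U + V + (2 * logWidth r α : ℝ) by ring, hP, kerK]
  ring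

lemma polarPow_eq (β : ℝ) {s : ℝ} (hs : 0 < s) (τ : ℝ) :
    polarPow β s τ = Complex.exp (β * (Real.log s + τ * Complex.I)) := by
  rw [polarPow, Real.rpow_def_of_pos hs, Complex.ofReal_exp, ← Complex.exp_add]
  congr 1; push_cast; ring

lemma polarPt_eq (hα : 0 < α) {s : ℝ} (hs : 0 < s) (τ : ℝ) :
    polarPt s τ = expMap α (α * (Real.log s + τ * Complex.I)) := by
  have : (α : ℂ) ≠ 0 := Complex.ofReal_ne_zero.mpr hα.ne'
  rw [polarPt, expMap, mul_div_cancel_left₀ _ this, Complex.exp_add, ← Complex.ofReal_exp,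
    Real.exp_log hs]

lemma branchPow_expMap (hα : 1 / 2 ≤ α) (β : ℝ) {u : ℂ} (h0 : 0 < u.im) (h1 : u.im < Real.pi) :
    branchPow β (expMap α u) = Complex.exp (β * (u / α)) := by
  have hz : 0 < ‖expMap α u‖ := norm_pos_iff.mpr (expMap_ne_zero α u)
  rw [branchPow, polarPow_eq β hz, norm_expMap, Real.log_exp, argPos_expMap hα h0 h1]
  congr 2
  apply Complex.ext <;> simp

lemma branchPow_self (hα : 1 / 2 ≤ α) {u : ℂ} (h0 : 0 < u.im) (h1 : u.im < Real.pi) :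
    branchPow α (expMap α u) = Complex.exp u := by
  have : (α : ℂ) ≠ 0 := Complex.ofReal_ne_zero.mpr (by linarith : (0:ℝ) < α).ne'
  rw [branchPow_expMap hα α h0 h1, mul_div_cancel₀ _ this]

lemma abs_det_smul_one (c : ℂ) : |(c • (1 : ℂ →L[ℝ] ℂ)).det| = ‖c‖ ^ 2 := by
  have h : (c • (1 : ℂ →L[ℝ] ℂ)).det = Algebra.norm ℝ c := by
    rw [Algebra.norm_apply, ContinuousLinearMap.det]
    congr 1
  rw [h, Algebra.norm_complex_apply, Complex.normSq_eq_norm_sq, abs_of_nonneg (by positivity)]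

lemma hasFDerivWithinAt_expMap (α : ℝ) (S : Set ℂ) (u : ℂ) :
    HasFDerivWithinAt (expMap α) ((expMap α u / α) • (1 : ℂ →L[ℝ] ℂ)) S u :=
  (hasDerivAt_expMap α u).complexToReal_fderiv.hasFDerivWithinAt

/-- The change of variables from the sector ring to the rectangle. -/
lemma setIntegral_domain (hr0 : 0 < r) (hα : 1 / 2 ≤ α) (h : ℂ → ℂ) :
    ∫ z in domain r α, h z
      = ∫ u in rectDom (logWidth r α), (‖expMap α u / α‖ ^ 2 : ℝ) • h (expMap α u) := by
  rw [← image_expMap hr0 hα, integral_image_eq_integral_abs_det_fderiv_smul volume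
    (isOpen_rectDom _).measurableSet (fun u _ => hasFDerivWithinAt_expMap α _ u) (injOn_expMap hα _)]
  simp only [abs_det_smul_one]

lemma integrableOn_domain (hr0 : 0 < r) (hα : 1 / 2 ≤ α) (h : ℂ → ℂ) :
    IntegrableOn h (domain r α) ↔ IntegrableOn (fun u => (‖expMap α u / α‖ ^ 2 : ℝ) • h (expMap α u))
      (rectDom (logWidth r α)) := by
  rw [← image_expMap hr0 hα, integrableOn_image_iff_integrableOn_abs_det_fderiv_smul volume
    (isOpen_rectDom _).measurableSet (fun u _ => hasFDerivWithinAt_expMap α _ u) (injOn_expMap hα _)]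
  simp only [abs_det_smul_one]

lemma memLp_comp_expMap (hr0 : 0 < r) (hα : 1 / 2 ≤ α) {p : ℝ≥0∞} {f : ℂ → ℂ}
    (hf : MemLp f p (volume.restrict (domain r α))) :
    MemLp (fun u => f (expMap α u)) p (volume.restrict (rectDom (logWidth r α))) := by
  have hα0 : 0 < α := by linarith
  have hm := (continuous_expMap α).measurable
  have hle : Measure.map (expMap α) (volume.restrict (rectDom (logWidth r α)))
      ≤ ENNReal.ofReal ((α / r) ^ 2) • volume.restrict (domain r α) := by
    refine Measure.le_iff.mpr fun A hA => ?_
    rw [Measure.map_apply hm hA, Measure.restrict_apply (hm hA), Measure.smul_apply,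
      Measure.restrict_apply hA, smul_eq_mul]
    set S := A ∩ domain r α
    have hSm : MeasurableSet S := hA.inter (isOpen_domain hr0 hα0).measurableSet
    have himg : expMap α ⁻¹' A ∩ rectDom (logWidth r α) ⊆ logMap α '' S := fun u hu =>
      ⟨expMap α u, ⟨hu.1, expMap_mem hr0 hα hu.2⟩, logMap_expMap hα hu.2.2.1 hu.2.2.2⟩
    have hinj : Set.InjOn (logMap α) S := fun x hx y hy hxy => by
      rw [← expMap_logMap hα0 (ne_zero_of_mem_domain hr0 hx.2), hxy,
        expMap_logMap hα0 (ne_zero_of_mem_domain hr0 hy.2)]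
    refine (measure_mono himg).trans ?_
    rw [← lintegral_abs_det_fderiv_eq_addHaar_image volume hSm (fun z hz =>
      (hasDerivAt_logMap hz.2.2.2.1).complexToReal_fderiv.hasFDerivWithinAt) hinj,
      ← setLIntegral_const]
    refine setLIntegral_mono' hSm fun z hz => ?_
    rw [abs_det_smul_one, norm_div, Complex.norm_real, Real.norm_eq_abs, abs_of_pos hα0]
    refine ENNReal.ofReal_le_ofReal ?_
    have := hz.2.1
    gcongr
  exact (hf.of_measure_le_smul ENNReal.ofReal_ne_top hle).comp_of_map hm.aemeasurable

/-- The right hand side of the equation in logarithmic coordinates. -/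
def pullRhs (α : ℝ) (f : ℂ → ℂ) (u : ℂ) : ℂ := f (expMap α u) * starRingEnd ℂ (expMap α u / α)

lemma memLp_pullRhs (hr0 : 0 < r) (hα : 1 / 2 ≤ α) {p : ℝ≥0∞} {f : ℂ → ℂ}
    (hf : MemLp f p (volume.restrict (domain r α))) :
    MemLp (pullRhs α f) p (volume.restrict (rectDom (logWidth r α))) := by
  have hα0 : 0 < α := by linarith
  have h1 := memLp_comp_expMap hr0 hα hf
  have hc : Continuous fun u => starRingEnd ℂ (expMap α u / α) :=
    Complex.continuous_conj.comp ((continuous_expMap α).div_const _)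
  refine h1.of_le_mul (c := 1 / α) (h1.1.mul hc.aestronglyMeasurable) ?_
  refine (ae_restrict_iff' (isOpen_rectDom _).measurableSet).mpr (ae_of_all _ fun u hu => ?_)
  rw [pullRhs, norm_mul, RCLike.norm_conj, norm_div, Complex.norm_real, Real.norm_eq_abs,
    abs_of_pos hα0, mul_comm]
  have := (expMap_mem hr0 hα hu).2.1.le
  gcongr

end

/-! ### The formula in logarithmic coordinates, and its convergence -/

section

variable {r α : ℝ}

lemma exp_sub_ne_one {L : ℝ} {U V : ℂ} (hU : U ∈ rectDom L) (hV : V ∈ rectClosed L) (h : U ≠ V) :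
    Complex.exp (U - V) ≠ 1 :=
  exp_ne_one_of_abs_im_lt (sub_mem_poleBox hU hV).2 (sub_ne_zero.mpr h)

/-- The logarithmic coordinate `α (log s + iτ)` of the point `s e^{iτ}`. -/
lemma logCoord_mem (hr0 : 0 < r) (hα : 0 < α) {s τ : ℝ} (hs : s ∈ Set.Icc r 1)
    (hτ : τ ∈ Set.Icc 0 (Real.pi / α)) :
    (α * (Real.log s + τ * Complex.I) : ℂ) ∈ rectClosed (logWidth r α) := by
  have hs0 : 0 < s := hr0.trans_le hs.1
  have h1 : Real.log r ≤ Real.log s := Real.log_le_log hr0 hs.1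
  have h2 : Real.log s ≤ 0 := Real.log_nonpos hs0.le hs.2
  have h3 : α * τ ≤ Real.pi := (le_div_iff₀' hα).mp hτ.2
  have h4 : 0 ≤ α * τ := mul_nonneg hα.le hτ.1
  rw [mem_rectClosed, logWidth, neg_neg]
  simp only [Complex.mul_re, Complex.mul_im, Complex.add_re, Complex.add_im, Complex.ofReal_re,
    Complex.ofReal_im, Complex.I_re, Complex.I_im]
  refine ⟨⟨?_, ?_⟩, ?_, ?_⟩ <;> nlinarith

lemma polarPow_self {s : ℝ} (hs : 0 < s) (τ : ℝ) :
    polarPow α s τ = Complex.exp (α * (Real.log s + τ * Complex.I)) := polarPow_eq α hs τ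

lemma polarPt_ne_zero {s : ℝ} (hs : 0 < s) (τ : ℝ) : polarPt s τ ≠ 0 :=
  mul_ne_zero (Complex.ofReal_ne_zero.mpr hs.ne') (Complex.exp_ne_zero _)

lemma arcIntegrand_one (hr0 : 0 < r) (hr1 : r < 1) (hα : 1 / 2 ≤ α) (γ : ℂ → ℝ) {U : ℂ}
    (hU : U ∈ rectDom (logWidth r α)) (τ : ℝ) :
    arcIntegrand r α γ (expMap α U) 1 τ = (γ (expMap α ((α * τ : ℝ) * Complex.I)) : ℂ)
      * (2 * (kerK (logWidth r α) U ((α * τ : ℝ) * Complex.I) - 1)) / polarPt 1 τ := by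
  have hα0 : 0 < α := by linarith
  have e : (α * (Real.log 1 + τ * Complex.I) : ℂ) = (α * τ : ℝ) * Complex.I := by
    simp [mul_assoc]
  rw [arcIntegrand, polarPow_self one_pos, branchPow_self hα hU.2.1 hU.2.2, e,
    H1_exp_of_re_zero hr0 hr1 hα0 hU (by simp), polarPt_eq hα0 one_pos, e]

lemma arcIntegrand_inner (hr0 : 0 < r) (hr1 : r < 1) (hα : 1 / 2 ≤ α) (γ : ℂ → ℝ) {U : ℂ}
    (hU : U ∈ rectDom (logWidth r α)) (τ : ℝ) :
    arcIntegrand r α γ (expMap α U) r τ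
      = (γ (expMap α (-(logWidth r α : ℂ) + (α * τ : ℝ) * Complex.I)) : ℂ)
      * (2 * kerK (logWidth r α) U (-(logWidth r α : ℂ) + (α * τ : ℝ) * Complex.I)) / polarPt r τ := by
  have hα0 : 0 < α := by linarith
  have e : (α * (Real.log r + τ * Complex.I) : ℂ)
      = -(logWidth r α : ℂ) + (α * τ : ℝ) * Complex.I := by
    rw [logWidth]; push_cast; ring
  rw [arcIntegrand, polarPow_self hr0, branchPow_self hα hU.2.1 hU.2.2, e,
    H1_exp_of_re hr0 hr1 hα0 hU (by simp), polarPt_eq hα0 hr0, e]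

lemma H2_polarPow (hr0 : 0 < r) (hr1 : r < 1) (hα : 1 / 2 ≤ α) {U V : ℂ}
    (hU : U ∈ rectDom (logWidth r α)) (hV : V ∈ rectClosed (logWidth r α)) (h : U ≠ V) :
    H2 r α (Complex.exp U) (Complex.exp V) = (Complex.exp V)⁻¹ * kerK (logWidth r α) U V :=
  H2_exp hr0 hr1 (by linarith) (sub_mem_poleBox hU hV).1 (kerP_mem_of_add hU hV).1
    (exp_sub_ne_one hU hV h)

/-- On the sides `τ = 0` and `τ = π / α`. -/
lemma rayIntegrand_mul_exp (hr0 : 0 < r) (hr1 : r < 1) (hα : 1 / 2 ≤ α) (γ : ℂ → ℝ) {U : ℂ}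
    (hU : U ∈ rectDom (logWidth r α)) {s τ : ℝ} (hs : s ∈ Set.Icc r 1)
    (hτ : τ = 0 ∨ τ = Real.pi / α) :
    rayIntegrand r α γ (expMap α U) s τ
      = (γ (expMap α ((α * Real.log s : ℝ) + (α * τ : ℝ) * Complex.I)) : ℂ)
        * kerK (logWidth r α) U ((α * Real.log s : ℝ) + (α * τ : ℝ) * Complex.I) * (s : ℂ)⁻¹
          * Complex.exp (-(τ * Complex.I)) := by
  have hα0 : 0 < α := by linarith
  have hα' : (α : ℂ) ≠ 0 := Complex.ofReal_ne_zero.mpr hα0.ne'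
  have hs0 : 0 < s := hr0.trans_le hs.1
  have e : (α * (Real.log s + τ * Complex.I) : ℂ)
      = (α * Real.log s : ℝ) + (α * τ : ℝ) * Complex.I := by push_cast; ring
  have hmem := logCoord_mem hr0 hα0 hs (τ := τ) (by
    rcases hτ with rfl | rfl
    · exact ⟨le_rfl, by positivity⟩
    · exact ⟨by positivity, le_rfl⟩)
  rw [rayIntegrand, polarPow_self hs0, branchPow_self hα hU.2.1 hU.2.2, polarPt_eq hα0 hs0,
    polarPow_eq _ hs0, e]
  rw [e] at hmem
  set V : ℂ := (α * Real.log s : ℝ) + (α * τ : ℝ) * Complex.I with hV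
  have hne : U ≠ V := by
    rintro rfl
    have h1 := (mem_rectDom.mp hU).2
    have h2 : V.im = α * τ := by simp [hV]
    rcases hτ with rfl | rfl
    · simp [h2] at h1
    · rw [h2, mul_div_cancel₀ _ hα0.ne'] at h1
      exact lt_irrefl _ h1.2
  rw [H2_polarPow hr0 hr1 hα hU hmem hne]
  have hpow : Complex.exp (((α - 1 : ℝ) : ℂ) * (Real.log s + τ * Complex.I))
      = Complex.exp V * (s : ℂ)⁻¹ * Complex.exp (-(τ * Complex.I)) := by
    have hsl : (s : ℂ)⁻¹ = Complex.exp (-(Real.log s : ℂ)) := by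
      rw [Complex.exp_neg, ← Complex.ofReal_exp, Real.exp_log hs0]
    rw [hsl, ← Complex.exp_add, ← Complex.exp_add, hV]
    congr 1; push_cast; ring
  rw [hpow]
  field_simp [Complex.exp_ne_zero V]

lemma areaIntegrand_expMap (hr0 : 0 < r) (hr1 : r < 1) (hα : 1 / 2 ≤ α) (f : ℂ → ℂ) {U V : ℂ}
    (hU : U ∈ rectDom (logWidth r α)) (hV : V ∈ rectDom (logWidth r α)) (h : U ≠ V) :
    (‖expMap α V / α‖ ^ 2 : ℝ) • areaIntegrand r α f (expMap α U) (expMap α V)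
      = (1 / α : ℂ) * (kerK (logWidth r α) U V * pullRhs α f V
        - kerK (logWidth r α) U (starRingEnd ℂ V) * starRingEnd ℂ (pullRhs α f V)) := by
  have hα0 : 0 < α := by linarith
  have hα' : (α : ℂ) ≠ 0 := Complex.ofReal_ne_zero.mpr hα0.ne'
  have hU' := mem_rectDom.mp hU
  have hV' := mem_rectDom.mp hV
  have hk : H2 r α (Complex.exp U) (starRingEnd ℂ (Complex.exp V))
      = (Complex.exp (starRingEnd ℂ V))⁻¹ * kerK (logWidth r α) U (starRingEnd ℂ V) := by
    rw [← Complex.exp_conj]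
    refine H2_exp hr0 hr1 hα0 ?_ ?_ (exp_ne_one_of_abs_im_lt ?_ fun h0 => ?_)
    · simpa using (sub_mem_poleBox hU (rectDom_subset _ hV)).1
    · simpa using (kerP_mem_of_add hU (rectDom_subset _ hV)).1
    · simp; exact abs_lt.mpr ⟨by linarith, by linarith⟩
    · have := congrArg Complex.im h0; simp at this; linarith
  have hpow : branchPow (α - 1) (expMap α V) = Complex.exp V / expMap α V := by
    rw [branchPow_expMap hα _ hV'.2.1 hV'.2.2, expMap, ← Complex.exp_sub]
    congr 1; push_cast; field_simp
  rw [areaIntegrand, branchPow_self hα hU'.2.1 hU'.2.2, branchPow_self hα hV'.2.1 hV'.2.2,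
    H2_polarPow hr0 hr1 hα hU (rectDom_subset _ hV) h, hk, hpow, Complex.real_smul, pullRhs]
  have hn : ((‖expMap α V / α‖ ^ 2 : ℝ) : ℂ)
      = expMap α V * starRingEnd ℂ (expMap α V) / α ^ 2 := by
    rw [norm_div, div_pow, Complex.ofReal_div, Complex.ofReal_pow, Complex.ofReal_pow,
      ← Complex.mul_conj', Complex.norm_real, Real.norm_eq_abs, abs_of_pos hα0]
  have he := expMap_ne_zero α V
  have he' : starRingEnd ℂ (expMap α V) ≠ 0 := (map_ne_zero _).mpr he
  have hV0 := Complex.exp_ne_zero V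
  have hV0' := Complex.exp_ne_zero (starRingEnd ℂ V)
  rw [hn]
  simp only [map_mul, map_div₀, Complex.conj_conj, Complex.conj_ofReal, ← Complex.exp_conj]
  field_simp

lemma integral_arc (Φ : ℝ → ℂ) (hα : 0 < α) :
    ∫ τ in (0:ℝ)..(Real.pi / α), Φ (α * τ) = (1 / α : ℂ) * ∫ y in (0:ℝ)..Real.pi, Φ y := by
  rw [intervalIntegral.integral_comp_mul_left Φ hα.ne', mul_zero, mul_div_cancel₀ _ hα.ne',
    Complex.real_smul]
  push_cast
  rw [one_div]

lemma log_mem (hr0 : 0 < r) (hα : 0 < α) {s : ℝ} (hs : s ∈ Set.Icc r 1) :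
    α * Real.log s ∈ Set.Icc (-logWidth r α) 0 := by
  have h1 : Real.log r ≤ Real.log s := Real.log_le_log hr0 hs.1
  have h2 : Real.log s ≤ 0 := Real.log_nonpos (hr0.trans_le hs.1).le hs.2
  rw [logWidth, neg_neg]
  constructor <;> nlinarith

lemma integral_ray (hr0 : 0 < r) (hr1 : r < 1) (hα : 0 < α) {Φ : ℝ → ℂ}
    (hΦ : ContinuousOn Φ (Set.Icc (-logWidth r α) 0)) :
    ∫ s in r..1, Φ (α * Real.log s) * (s : ℂ)⁻¹
      = (1 / α : ℂ) * ∫ x in (-logWidth r α)..0, Φ x := by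
  have hα' : (α : ℂ) ≠ 0 := Complex.ofReal_ne_zero.mpr hα.ne'
  have hI : Set.uIcc r 1 = Set.Icc r 1 := Set.uIcc_of_le hr1.le
  have hne : ∀ s ∈ Set.uIcc r 1, s ≠ 0 := fun s hs => (hr0.trans_le (hI ▸ hs).1).ne'
  have := intervalIntegral.integral_deriv_smul_comp'' (a := r) (b := 1)
    (f := fun s => α * Real.log s) (f' := fun s => α * s⁻¹) (g := Φ)
    (continuousOn_const.mul (Real.continuousOn_log.mono fun s hs => hne s hs))
    (fun s hs => ((Real.hasDerivAt_log (hne s (by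
      rw [hI]; rw [min_eq_left hr1.le, max_eq_right hr1.le] at hs
      exact Set.Ioo_subset_Icc_self hs))).const_mul α).hasDerivWithinAt)
    (continuousOn_const.mul (continuousOn_inv₀.mono fun s hs => hne s hs))
    (hΦ.mono (by rintro _ ⟨s, hs, rfl⟩; exact log_mem hr0 hα (hI ▸ hs)))
  rw [Real.log_one, mul_zero, show α * Real.log r = -logWidth r α by rw [logWidth, neg_neg]] at this
  rw [← this, ← intervalIntegral.integral_const_mul]
  refine intervalIntegral.integral_congr fun s _ => ?_
  simp only [Function.comp, Complex.real_smul]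
  push_cast
  field_simp

/-- The explicit formula in logarithmic coordinates. -/
theorem formula_expMap (hr0 : 0 < r) (hr1 : r < 1) (hα : 1 / 2 ≤ α) (f : ℂ → ℂ) {γ : ℂ → ℝ}
    (hγ : ContinuousOn γ (frontier (domain r α))) (c : ℝ) {U : ℂ}
    (hU : U ∈ rectDom (logWidth r α)) :
    formula r α f γ c (expMap α U) = bdOp (logWidth r α) (fun v => γ (expMap α v)) U
      + Complex.I * c + areaPot (logWidth r α) (pullRhs α f) U := by
  have hα0 : 0 < α := by linarith
  have hα' : (α : ℂ) ≠ 0 := Complex.ofReal_ne_zero.mpr hα0.ne'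
  set L := logWidth r α with hL_def
  have hL : 0 < L := logWidth_pos hr0 hr1 hα0
  set g : ℂ → ℝ := fun v => γ (expMap α v) with hg_def
  have hg : ContinuousOn g (rectBdry L) := continuousOn_comp_expMap hr0 hr1 hα hγ
  have hg' : ContinuousOn (fun v => (g v : ℂ)) (rectBdry L) :=
    Complex.continuous_ofReal.comp_continuousOn hg
  have hgk : ContinuousOn (fun v => (g v : ℂ) * kerK L U v) (rectBdry L) :=
    hg'.fun_mul (continuousOn_kerK_rectBdry hL hU)
  obtain ⟨i1, i2, i3, i4⟩ := intervalIntegrable_sides hL hgk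
  obtain ⟨-, -, j3, -⟩ := intervalIntegrable_sides hL hg'
  have a1 : arcIntegral (arcIntegrand r α γ (expMap α U)) 1 0 (Real.pi / α)
      = 2 * Complex.I / α * ((∫ y : ℝ in (0:ℝ)..Real.pi, (g (y * Complex.I) : ℂ)
        * kerK L U (y * Complex.I)) - ∫ y : ℝ in (0:ℝ)..Real.pi, (g (y * Complex.I) : ℂ)) := by
    rw [← intervalIntegral.integral_sub i3 j3]
    have := integral_arc (fun y : ℝ => (g (y * Complex.I) : ℂ) * kerK L U (y * Complex.I)
      - (g (y * Complex.I) : ℂ)) hα0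
    rw [show ∀ X : ℂ, 2 * Complex.I / α * X = 2 * Complex.I * (1 / α * X) by intro X; ring, ← this,
      ← intervalIntegral.integral_const_mul, arcIntegral]
    refine intervalIntegral.integral_congr fun τ _ => ?_
    rw [arcIntegrand_one hr0 hr1 hα γ hU]
    have := polarPt_ne_zero one_pos τ
    field_simp
    simp only [hg_def, hL_def]
  have a2 : arcIntegral (arcIntegrand r α γ (expMap α U)) r (Real.pi / α) 0
      = -(2 * Complex.I / α * ∫ y : ℝ in (0:ℝ)..Real.pi, (g (-L + y * Complex.I) : ℂ)
        * kerK L U (-L + y * Complex.I)) := by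
    have := integral_arc (fun y : ℝ => (g (-L + y * Complex.I) : ℂ) * kerK L U (-L + y * Complex.I)) hα0
    rw [show ∀ X : ℂ, 2 * Complex.I / α * X = 2 * Complex.I * (1 / α * X) by intro X; ring, ← this,
      ← intervalIntegral.integral_const_mul, arcIntegral, intervalIntegral.integral_symm]
    congr 1
    refine intervalIntegral.integral_congr fun τ _ => ?_
    rw [arcIntegrand_inner hr0 hr1 hα γ hU]
    have := polarPt_ne_zero hr0 τ
    field_simp
    simp only [hg_def, hL_def]
  have hray : ∀ τ : ℝ, τ = 0 ∨ τ = Real.pi / α →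
      ContinuousOn (fun x : ℝ => (g (x + (α * τ : ℝ) * Complex.I) : ℂ)
        * kerK L U (x + (α * τ : ℝ) * Complex.I)) (Set.Icc (-L) 0) →
      ∫ s in r..1, rayIntegrand r α γ (expMap α U) s τ * Complex.exp (τ * Complex.I)
        = (1 / α : ℂ) * ∫ x in (-L)..0, (g (x + (α * τ : ℝ) * Complex.I) : ℂ)
          * kerK L U (x + (α * τ : ℝ) * Complex.I) := by
    intro τ hτ hc
    rw [← integral_ray hr0 hr1 hα0 hc]
    refine intervalIntegral.integral_congr fun s hs => ?_
    rw [Set.uIcc_of_le hr1.le] at hs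
    rw [rayIntegrand_mul_exp hr0 hr1 hα γ hU hs hτ, mul_assoc _ (Complex.exp _) (Complex.exp _),
      ← Complex.exp_add, neg_add_cancel, Complex.exp_zero, mul_one]
  have b1 : rayIntegral (rayIntegrand r α γ (expMap α U)) 0 r 1
      = (1 / α : ℂ) * ∫ x : ℝ in (-L)..0, (g x : ℂ) * kerK L U x := by
    have h := hray 0 (Or.inl rfl)
    simp only [mul_zero, Complex.ofReal_zero, zero_mul, add_zero] at h
    rw [← h (hgk.comp (f := fun x : ℝ => (x : ℂ)) (by fun_prop) fun x hx => bottom_mem hx),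
      rayIntegral]
    simp
  have b2 : rayIntegral (rayIntegrand r α γ (expMap α U)) (Real.pi / α) 1 r
      = -((1 / α : ℂ) * ∫ x : ℝ in (-L)..0, (g (x + Real.pi * Complex.I) : ℂ)
        * kerK L U (x + Real.pi * Complex.I)) := by
    have h := hray (Real.pi / α) (Or.inr rfl)
    rw [mul_div_cancel₀ _ hα0.ne'] at h
    rw [← h (hgk.comp (f := fun x : ℝ => (x : ℂ) + Real.pi * Complex.I) (by fun_prop)
      fun x hx => top_mem hx), rayIntegral, intervalIntegral.integral_symm]
  have harea : ∫ ζ in domain r α, areaIntegrand r α f (expMap α U) ζ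
      = (1 / α : ℂ) * ∫ v in rectDom L, (kerK L U v * pullRhs α f v
        - kerK L U (starRingEnd ℂ v) * starRingEnd ℂ (pullRhs α f v)) := by
    rw [setIntegral_domain hr0 hα, ← integral_const_mul]
    refine setIntegral_congr_ae (isOpen_rectDom _).measurableSet ?_
    -- at the pole `v = U` the two integrands take unrelated junk values
    have : ∀ᵐ v : ℂ, v ≠ U := by simp [ae_iff]
    filter_upwards [this] with v hv hvd
    exact areaIntegrand_expMap hr0 hr1 hα f hU hvd hv.symm
  have hπ : (Real.pi : ℂ) ≠ 0 := Complex.ofReal_ne_zero.mpr Real.pi_ne_zero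
  have hI := Complex.I_ne_zero
  rw [formula, a1, a2, b1, b2, harea, areaPot, bdOp, rectInt]
  generalize (∫ y : ℝ in (0:ℝ)..Real.pi, (g (y * Complex.I) : ℂ) * kerK L U (y * Complex.I)) = X1
  generalize (∫ y : ℝ in (0:ℝ)..Real.pi, (g (y * Complex.I) : ℂ)) = X2
  generalize (∫ y : ℝ in (0:ℝ)..Real.pi, (g (-L + y * Complex.I) : ℂ)
        * kerK L U (-L + y * Complex.I)) = X3
  generalize (∫ x : ℝ in (-L)..0, (g x : ℂ) * kerK L U x) = X4
  generalize (∫ x : ℝ in (-L)..0, (g (x + Real.pi * Complex.I) : ℂ)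
        * kerK L U (x + Real.pi * Complex.I)) = X5
  generalize (∫ v in rectDom L, (kerK L U v * pullRhs α f v
        - kerK L U (starRingEnd ℂ v) * starRingEnd ℂ (pullRhs α f v))) = X6
  field_simp
  ring

/-- Absolute convergence of the formula. -/
theorem formulaConverges (hr0 : 0 < r) (hr1 : r < 1) (hα : 1 / 2 ≤ α) {p : ℝ≥0∞} (hp : 2 < p)
    {f : ℂ → ℂ} (hf : MemLp f p (volume.restrict (domain r α))) {γ : ℂ → ℝ}
    (hγ : ContinuousOn γ (frontier (domain r α))) {z : ℂ} (hz : z ∈ domain r α) :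
    FormulaConverges r α f γ z := by
  have hα0 : 0 < α := by linarith
  set L := logWidth r α with hL_def
  have hL : 0 < L := logWidth_pos hr0 hr1 hα0
  obtain ⟨U, hU, rfl⟩ : ∃ U ∈ rectDom L, expMap α U = z := by
    rw [← image_expMap hr0 hα] at hz; exact hz
  have hUim := (mem_rectDom.mp hU).2
  have hg : ContinuousOn (fun v => γ (expMap α v)) (rectBdry L) :=
    continuousOn_comp_expMap hr0 hr1 hα hγ
  have hg' : ContinuousOn (fun v => (γ (expMap α v) : ℂ)) (rectBdry L) :=
    Complex.continuous_ofReal.comp_continuousOn hg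
  have hk := continuousOn_kerK_rectBdry hL hU
  have hmul : ∀ τ ∈ Set.uIcc 0 (Real.pi / α), α * τ ∈ Set.Icc 0 Real.pi := by
    intro τ hτ
    rw [Set.uIcc_of_le (by positivity)] at hτ
    exact ⟨mul_nonneg hα0.le hτ.1, (le_div_iff₀' hα0).mp hτ.2⟩
  have hpt : ∀ s : ℝ, Continuous fun τ : ℝ => polarPt s τ := fun s => by unfold polarPt; fun_prop
  have hray : ∀ τ : ℝ, τ = 0 ∨ τ = Real.pi / α →
      IntervalIntegrable (fun s => rayIntegrand r α γ (expMap α U) s τ) volume r 1 := by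
    intro τ hτ
    refine ContinuousOn.intervalIntegrable ?_
    rw [Set.uIcc_of_le hr1.le]
    have hlog : ContinuousOn (fun s : ℝ => ((α * Real.log s : ℝ) + (α * τ : ℝ) * Complex.I : ℂ))
        (Set.Icc r 1) := by
      refine ContinuousOn.add (Complex.continuous_ofReal.comp_continuousOn
        (continuousOn_const.mul (Real.continuousOn_log.mono fun s hs => ?_))) continuousOn_const
      exact (hr0.trans_le hs.1).ne'
    have hmem : Set.MapsTo (fun s : ℝ => ((α * Real.log s : ℝ) + (α * τ : ℝ) * Complex.I : ℂ))
        (Set.Icc r 1) (rectBdry L) := by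
      intro s hs
      rcases hτ with rfl | rfl
      · simpa using bottom_mem (log_mem hr0 hα0 hs)
      · have := top_mem (log_mem hr0 hα0 hs)
        simpa only [mul_div_cancel₀ _ hα0.ne'] using this
    refine ((((hg'.fun_mul hk).comp hlog hmem).mul
      (Complex.continuous_ofReal.continuousOn.inv₀ fun s hs => ?_)).mul
      (continuousOn_const (c := Complex.exp (-(τ * Complex.I))))).congr fun s hs =>
        rayIntegrand_mul_exp hr0 hr1 hα γ hU hs hτ
    exact Complex.ofReal_ne_zero.mpr (hr0.trans_le hs.1).ne'
  refine ⟨fun s hs τ hτ => ?_, ?_, ?_, hray _ (Or.inr rfl), hray _ (Or.inl rfl), ?_⟩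
  · have hV := logCoord_mem hr0 hα0 hs hτ
    rw [branchPow_self hα hUim.1 hUim.2, polarPow_self (hr0.trans_le hs.1), ← Complex.exp_conj]
    set V : ℂ := α * (Real.log s + τ * Complex.I)
    have h1 := (sub_mem_poleBox hU hV).1
    have h2 := (kerP_mem_of_add hU hV).1
    exact ⟨(hasSum_H1term hr0 hr1 hα0 h1).summable, (hasSum_H2term hr0 hr1 hα0 h1 h2).summable,
      (hasSum_H2term hr0 hr1 hα0 (by simpa using h1) (by simpa using h2)).summable⟩
  · refine ContinuousOn.intervalIntegrable ?_
    have hmem : Set.MapsTo (fun τ : ℝ => ((α * τ : ℝ) * Complex.I : ℂ))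
        (Set.uIcc 0 (Real.pi / α)) (rectBdry L) := fun τ hτ => right_mem hL (hmul τ hτ)
    have hσ : ContinuousOn (fun τ : ℝ => ((α * τ : ℝ) * Complex.I : ℂ))
        (Set.uIcc 0 (Real.pi / α)) := by fun_prop
    exact (((hg'.comp hσ hmem).mul (continuousOn_const.mul ((hk.comp hσ hmem).sub
      continuousOn_const))).div (hpt 1).continuousOn fun τ _ => polarPt_ne_zero one_pos τ).congr
      fun τ _ => arcIntegrand_one hr0 hr1 hα γ hU τ
  · refine ContinuousOn.intervalIntegrable ?_
    have hmem : Set.MapsTo (fun τ : ℝ => (-(L : ℂ) + (α * τ : ℝ) * Complex.I : ℂ))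
        (Set.uIcc 0 (Real.pi / α)) (rectBdry L) := fun τ hτ => left_mem hL (hmul τ hτ)
    have hσ : ContinuousOn (fun τ : ℝ => (-(L : ℂ) + (α * τ : ℝ) * Complex.I : ℂ))
        (Set.uIcc 0 (Real.pi / α)) := by fun_prop
    exact (((hg'.comp hσ hmem).mul (continuousOn_const.mul (hk.comp hσ hmem))).div
      (hpt r).continuousOn fun τ _ => polarPt_ne_zero hr0 τ).congr
      fun τ _ => arcIntegrand_inner hr0 hr1 hα γ hU τ
  · rw [integrableOn_domain hr0 hα]
    obtain ⟨k1, k2⟩ := integrableOn_areaPot hL hp (memLp_pullRhs hr0 hα hf) (rectDom_subset L hU)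
    refine (((integrable_fun_sub k1 k2).const_mul (1 / α : ℂ))).congr ?_
    refine (ae_restrict_iff' (isOpen_rectDom _).measurableSet).mpr ?_
    have : ∀ᵐ v : ℂ, v ≠ U := by simp [ae_iff]
    filter_upwards [this] with v hv hvd
    exact (areaIntegrand_expMap hr0 hr1 hα f hU hvd hv.symm).symm

end

/-! ### Transfer to the sector ring, uniqueness, and existence -/

section

variable {r α : ℝ}

lemma integrable_mul_dbar {O : Set ℂ} (hO : IsOpen O) {w φ : ℂ → ℂ} (hw : ContinuousOn w O)
    (hφ : ContDiff ℝ ∞ φ) (hc : HasCompactSupport φ) (hs : tsupport φ ⊆ O) :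
    Integrable (fun z => w z * dbar φ z) (volume.restrict O) :=
  ((continuous_mul_of_tsupport_subset hO hw (continuous_dbar (hφ.of_le (by exact_mod_cast le_top)))
    ((tsupport_dbar_subset φ).trans hs)).integrable_of_hasCompactSupport
      ((hasCompactSupport_dbar hc).mul_left)).restrict

lemma HasWeakDbar.sub {O : Set ℂ} (hO : IsOpen O) {w₁ w₂ f : ℂ → ℂ} (hw₁ : ContinuousOn w₁ O)
    (hw₂ : ContinuousOn w₂ O) (h₁ : HasWeakDbar O w₁ f) (h₂ : HasWeakDbar O w₂ f) :
    HasWeakDbar O (fun z => w₁ z - w₂ z) 0 := by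
  intro φ hφ hc hs
  simp only [sub_mul, Pi.zero_apply, zero_mul, integral_zero, neg_zero]
  rw [integral_sub (integrable_mul_dbar hO hw₁ hφ hc hs) (integrable_mul_dbar hO hw₂ hφ hc hs),
    h₁ φ hφ hc hs, h₂ φ hφ hc hs, sub_self]

lemma HasWeakDbar.add_differentiableOn {O : Set ℂ} (hO : IsOpen O) {h w f : ℂ → ℂ}
    (hh : DifferentiableOn ℂ h O) (hw : ContinuousOn w O) (hwf : HasWeakDbar O w f) :
    HasWeakDbar O (fun z => h z + w z) f := by
  intro φ hφ hc hs
  simp only [add_mul]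
  rw [integral_add (integrable_mul_dbar hO hh.continuousOn hφ hc hs)
    (integrable_mul_dbar hO hw hφ hc hs), hwf φ hφ hc hs,
    setIntegral_mul_dbar_of_differentiableOn hO hh (hφ.of_le (by exact_mod_cast le_top)) hc hs,
    zero_add]

lemma dbar_comp_expMap {φ : ℂ → ℂ} {u : ℂ} (hφ : DifferentiableAt ℝ φ (expMap α u)) :
    dbar (fun v => φ (expMap α v)) u
      = dbar φ (expMap α u) * starRingEnd ℂ (expMap α u / α) := by
  have h1 := hφ.hasFDerivAt.comp u (hasDerivAt_expMap α u).complexToReal_fderiv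
  have h2 : fderiv ℝ (fun v => φ (expMap α v)) u
      = (fderiv ℝ φ (expMap α u)).comp ((expMap α u / α) • (1 : ℂ →L[ℝ] ℂ)) := h1.fderiv
  set a := expMap α u / α
  have e1 : (fderiv ℝ φ (expMap α u)) a = a.re * fderiv ℝ φ (expMap α u) 1
      + a.im * fderiv ℝ φ (expMap α u) Complex.I := realLinear_apply_eq _ _
  have e2 : (fderiv ℝ φ (expMap α u)) (a * Complex.I) = (-a.im : ℝ) * fderiv ℝ φ (expMap α u) 1
      + a.re * fderiv ℝ φ (expMap α u) Complex.I := by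
    rw [realLinear_apply_eq]; simp
  have hconj : starRingEnd ℂ a = a.re - a.im * Complex.I := by
    apply Complex.ext <;> simp
  rw [dbar, h2, dbar, hconj]
  simp only [ContinuousLinearMap.comp_apply, smul_apply, one_apply_eq_self, smul_eq_mul,
    mul_one, e1, e2]
  push_cast
  linear_combination (a.im * fderiv ℝ φ (expMap α u) Complex.I / 2 : ℂ) * Complex.I_sq

/-- Transfer of the weak equation from the rectangle to the sector ring: a test function `φ` is
pulled back to `e' · (φ ∘ e)`, where `e` is the conformal map. -/
lemma hasWeakDbar_of_pullback (hr0 : 0 < r) (hα : 1 / 2 ≤ α) {w W f : ℂ → ℂ}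
    (hwW : ∀ u ∈ rectDom (logWidth r α), w (expMap α u) = W u)
    (hW : HasWeakDbar (rectDom (logWidth r α)) W (pullRhs α f)) : HasWeakDbar (domain r α) w f := by
  intro φ hφ hc hs
  have hα0 : 0 < α := by linarith
  set Q := rectDom (logWidth r α) with hQ
  have hQo : IsOpen Q := isOpen_rectDom _
  set η : ℂ → ℂ := fun u => expMap α u / α * φ (expMap α u) with hη
  -- outside the rectangle `e` is no longer injective, so the pull-back has to be cut off
  set ψ : ℂ → ℂ := Q.indicator η with hψ
  have hes : ContDiff ℝ ∞ (expMap α) :=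
    (Complex.contDiff_exp (𝕜 := ℝ)).comp (contDiff_id.div_const _)
  have hηs : ContDiff ℝ ∞ η := (hes.div_const _).mul (hφ.comp hes)
  set K : Set ℂ := logMap α '' tsupport φ with hK
  have hKc : IsCompact K := hc.isCompact.image_of_continuousOn ((continuousOn_logMap r α).mono hs)
  have hKQ : K ⊆ Q := by
    rintro _ ⟨z, hz, rfl⟩
    exact logMap_mem hr0 hα0 (hs hz)
  have hψ0 : ∀ u ∉ K, ψ u = 0 := by
    intro u hu
    by_cases huQ : u ∈ Q
    · have : expMap α u ∉ tsupport φ := fun h =>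
        hu ⟨_, h, logMap_expMap hα huQ.2.1 huQ.2.2⟩
      rw [hψ, Set.indicator_of_mem huQ, hη]
      simp only [image_eq_zero_of_notMem_tsupport this, mul_zero]
    · rw [hψ, Set.indicator_of_notMem huQ]
  have hsupp : tsupport ψ ⊆ K :=
    closure_minimal (fun u hu => by by_contra h; exact hu (hψ0 u h)) hKc.isClosed
  have hψη : ∀ u ∈ Q, ψ =ᶠ[𝓝 u] η := fun u hu => by
    filter_upwards [hQo.mem_nhds hu] with v hv
    rw [hψ, Set.indicator_of_mem hv]
  have hψs : ContDiff ℝ ∞ ψ := contDiff_of_contDiffAt_tsupport fun u hu =>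
    hηs.contDiffAt.congr_of_eventuallyEq (hψη u (hKQ (hsupp hu)))
  have hψc : HasCompactSupport ψ := hKc.of_isClosed_subset (isClosed_tsupport ψ) hsupp
  have key := hW ψ hψs hψc (hsupp.trans hKQ)
  have hnorm : ∀ u, ((‖expMap α u / α‖ ^ 2 : ℝ) : ℂ)
      = expMap α u / α * starRingEnd ℂ (expMap α u / α) := fun u => by
    rw [Complex.mul_conj']; push_cast; rfl
  rw [setIntegral_domain hr0 hα, setIntegral_domain hr0 hα]
  refine Eq.trans (setIntegral_congr_fun hQo.measurableSet fun u hu => ?_)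
    (key.trans (congrArg Neg.neg (setIntegral_congr_fun hQo.measurableSet fun u hu => ?_)))
  · have h1 : dbar ψ u = expMap α u / α * (dbar φ (expMap α u) * starRingEnd ℂ (expMap α u / α)) := by
      have hφd : DifferentiableAt ℝ φ (expMap α u) := hφ.differentiable (by simp) _
      have hed : DifferentiableAt ℂ (fun v => expMap α v / α) u :=
        (hasDerivAt_expMap α u).differentiableAt.div_const _
      have her : DifferentiableAt ℝ (expMap α) u :=
        (hasDerivAt_expMap α u).differentiableAt.restrictScalars ℝ
      have hcd : DifferentiableAt ℝ (fun v => φ (expMap α v)) u := hφd.comp u her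
      rw [dbar_congr (hψη u hu), dbar_mul (hed.restrictScalars ℝ) hcd,
        dbar_of_differentiableAt hed, dbar_comp_expMap hφd]
      ring
    rw [h1, Complex.real_smul, hnorm, hwW u hu]
    ring
  · rw [hψ, Set.indicator_of_mem hu, Complex.real_smul, hnorm, pullRhs]
    ring

lemma image_mul_Ioo (hα : 0 < α) :
    (fun τ => α * τ) '' Set.Ioo 0 (Real.pi / α) = Set.Ioo 0 Real.pi := by
  rw [Set.image_mul_left_Ioo hα, mul_zero, mul_div_cancel₀ _ hα.ne']

lemma hasDerivWithinAt_mul (S : Set ℝ) (x : ℝ) : HasDerivWithinAt (fun τ => α * τ) α S x := by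
  simpa using ((hasDerivAt_id x).const_mul α).hasDerivWithinAt

lemma eLpNorm_comp_mul (hα : 0 < α) (h : ℝ → ℝ) :
    eLpNorm h 1 (volume.restrict (Set.Ioo 0 Real.pi)) = ENNReal.ofReal α
      * eLpNorm (fun τ => h (α * τ)) 1 (volume.restrict (Set.Ioo 0 (Real.pi / α))) := by
  rw [eLpNorm_one_eq_lintegral_enorm, eLpNorm_one_eq_lintegral_enorm, ← image_mul_Ioo hα,
    lintegral_image_eq_lintegral_abs_deriv_mul measurableSet_Ioo
      (fun x _ => hasDerivWithinAt_mul _ x) (fun x _ y _ h => mul_left_cancel₀ hα.ne' h),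
    lintegral_const_mul' _ _ ENNReal.ofReal_ne_top, abs_of_pos hα]

/-- An `L¹` trace on the right side of the rectangle is one on the outer arc. -/
lemma isImTrace_of_rect (hr0 : 0 < r) (hr1 : r < 1) (hα : 0 < α) {w W : ℂ → ℂ} {v : ℝ → ℝ}
    (hwW : ∀ u ∈ rectDom (logWidth r α), w (expMap α u) = W u)
    (hv : IntegrableOn v (Set.Ioo 0 Real.pi))
    (hlim : Tendsto (fun x : ℝ => eLpNorm (fun θ : ℝ => (W (x + θ * Complex.I)).im - v θ) 1
        (volume.restrict (Set.Ioo 0 Real.pi))) (𝓝[<] 0) (𝓝 0)) :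
    IsImTrace α w (fun τ => v (α * τ)) := by
  constructor
  · rw [← image_mul_Ioo hα, integrableOn_image_iff_integrableOn_abs_deriv_smul measurableSet_Ioo
      (fun x _ => hasDerivWithinAt_mul _ x) (fun x _ y _ h => mul_left_cancel₀ hα.ne' h)] at hv
    exact (integrable_smul_iff (abs_ne_zero.mpr hα.ne') _).mp hv
  · have hlog : Tendsto (fun s : ℝ => α * Real.log s) (𝓝[<] 1) (𝓝[<] 0) := by
      refine tendsto_nhdsWithin_iff.mpr ⟨?_, ?_⟩
      · have : Tendsto (fun s : ℝ => α * Real.log s) (𝓝 1) (𝓝 (α * Real.log 1)) :=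
          (Real.continuousAt_log one_ne_zero).tendsto.const_mul α
        rw [Real.log_one, mul_zero] at this
        exact this.mono_left nhdsWithin_le_nhds
      · filter_upwards [Ioo_mem_nhdsLT (zero_lt_one' ℝ)] with s hs
        exact mul_neg_of_pos_of_neg hα (Real.log_neg hs.1 hs.2)
    have h1 := ENNReal.Tendsto.const_mul (a := ENNReal.ofReal α⁻¹) (hlim.comp hlog)
      (Or.inr ENNReal.ofReal_ne_top)
    rw [mul_zero] at h1
    refine h1.congr' ?_
    filter_upwards [Ioo_mem_nhdsLT hr1] with s hs
    have hs0 : 0 < s := hr0.trans hs.1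
    rw [Function.comp, eLpNorm_comp_mul hα, ← mul_assoc, ← ENNReal.ofReal_mul (by positivity),
      inv_mul_cancel₀ hα.ne', ENNReal.ofReal_one, one_mul]
    refine eLpNorm_congr_ae ?_
    refine (ae_restrict_iff' measurableSet_Ioo).mpr (ae_of_all _ fun τ hτ => ?_)
    have hlr : Real.log r < Real.log s := Real.log_lt_log hr0 hs.1
    have hl0 : Real.log s < 0 := Real.log_neg hs0 hs.2
    have hmem : ((α * Real.log s : ℝ) + (α * τ : ℝ) * Complex.I : ℂ) ∈ rectDom (logWidth r α) := by
      refine add_mul_I_mem_rectDom ?_ (mul_neg_of_pos_of_neg hα hl0)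
        ⟨mul_pos hα hτ.1, (lt_div_iff₀' hα).mp hτ.2⟩
      rw [logWidth, neg_neg]
      exact mul_lt_mul_of_pos_left hlr hα
    beta_reduce
    rw [← hwW _ hmem, polarPt_eq hα hs0]
    congr 4
    push_cast; ring

lemma normalization_eq (hα : 0 < α) (v : ℝ → ℝ) :
    (α / (Real.pi * Complex.I) : ℂ)
      * arcIntegral (fun s τ => (v τ : ℂ) / polarPt s τ) 1 0 (Real.pi / α)
      = ((α / Real.pi * ∫ τ in Set.Ioo 0 (Real.pi / α), v τ : ℝ) : ℂ) := by
  have h1 : ∀ τ : ℝ, (v τ : ℂ) / polarPt 1 τ * (Complex.I * polarPt 1 τ) = Complex.I * v τ :=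
    fun τ => by
      have := polarPt_ne_zero one_pos τ
      field_simp
  have hI := Complex.I_ne_zero
  have hπ : (Real.pi : ℂ) ≠ 0 := Complex.ofReal_ne_zero.mpr Real.pi_ne_zero
  simp only [arcIntegral, h1]
  rw [intervalIntegral.integral_const_mul, intervalIntegral.integral_ofReal,
    intervalIntegral.integral_of_le (by positivity), integral_Ioc_eq_integral_Ioo]
  push_cast
  field_simp

/-- A holomorphic function whose real part tends to zero at the boundary has nonpositive real part:
otherwise its exponential attains its maximum modulus inside. -/
lemma re_nonpos_of_tendsto_frontier {U : Set ℂ} (hU : IsOpen U) (hUc : IsPreconnected U)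
    (hUb : Bornology.IsBounded U) {h : ℂ → ℂ} (hh : DifferentiableOn ℂ h U)
    (hlim : ∀ t ∈ frontier U, Tendsto (fun z => (h z).re) (𝓝[U] t) (𝓝 0)) {z : ℂ} (hz : z ∈ U) :
    (h z).re ≤ 0 := by
  by_contra hcon
  push Not at hcon
  set ε := (h z).re with hε
  -- compact, since the real part is small near the boundary
  set K : Set ℂ := {x ∈ U | ε ≤ (h x).re} with hK
  have hKU : K ⊆ U := fun x hx => hx.1
  have hKclosed : IsClosed K := by
    refine isClosed_of_closure_subset fun x hx => ?_
    have hne : (𝓝[K] x).NeBot := mem_closure_iff_nhdsWithin_neBot.mp hx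
    have hge : ∀ᶠ y in 𝓝[K] x, ε ≤ (h y).re := by
      filter_upwards [self_mem_nhdsWithin] with y hy using hy.2
    by_cases hxU : x ∈ U
    · have ht : Tendsto (fun y => (h y).re) (𝓝[K] x) (𝓝 (h x).re) :=
        (Complex.continuous_re.continuousAt.tendsto.comp
          (hh.continuousOn.continuousAt (hU.mem_nhds hxU)).tendsto).mono_left nhdsWithin_le_nhds
      exact ⟨hxU, ge_of_tendsto ht hge⟩
    · have hxf : x ∈ frontier U := by
        rw [hU.frontier_eq]; exact ⟨closure_mono hKU hx, hxU⟩
      have := ge_of_tendsto ((hlim x hxf).mono_left (nhdsWithin_mono x hKU)) hge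
      linarith
  have hKc : IsCompact K := Metric.isCompact_of_isClosed_isBounded hKclosed (hUb.subset hKU)
  obtain ⟨c, hcK, hcmax⟩ := hKc.exists_isMaxOn ⟨z, hz, le_rfl⟩
    (Complex.continuous_re.comp_continuousOn (hh.continuousOn.mono hKU))
  have hmax : IsMaxOn (norm ∘ fun x => Complex.exp (h x)) U c := by
    intro x hx
    simp only [Set.mem_ofPred_eq, Function.comp, Complex.norm_exp, Real.exp_le_exp]
    by_cases hxK : x ∈ K
    · exact hcmax hxK
    · have : (h x).re < ε := by by_contra h'; exact hxK ⟨hx, not_lt.mp h'⟩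
      exact this.le.trans hcK.2
  have hconst := Complex.norm_eqOn_of_isPreconnected_of_isMaxOn hUc hU hh.cexp hcK.1 hmax
  -- the modulus of `exp h` is constant, so `U = K` would be open and compact
  have hUK : U = K := Set.Subset.antisymm (fun x hx => ⟨hx, by
    have := hconst hx
    simp only [Function.comp, Function.const, Complex.norm_exp, Real.exp_eq_exp] at this
    rw [this]; exact hcK.2⟩) hKU
  have hclopen : IsClopen U := ⟨hUK ▸ hKclosed, hU⟩
  rcases isClopen_iff.mp hclopen with h0 | h0
  · rw [h0] at hz; exact hz
  · rw [← hUK, h0] at hKc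
    exact noncompact_univ ℂ hKc

/-- A holomorphic function whose real part tends to zero at the boundary is an imaginary constant. -/
lemma exists_eq_const_of_tendsto_frontier {U : Set ℂ} (hU : IsOpen U) (hUc : IsPreconnected U)
    (hUb : Bornology.IsBounded U) (hne : U.Nonempty) {h : ℂ → ℂ} (hh : DifferentiableOn ℂ h U)
    (hlim : ∀ t ∈ frontier U, Tendsto (fun z => (h z).re) (𝓝[U] t) (𝓝 0)) :
    ∃ C : ℝ, ∀ z ∈ U, h z = C * Complex.I := by
  have hre : ∀ z ∈ U, (h z).re = 0 := fun z hz => by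
    refine le_antisymm (re_nonpos_of_tendsto_frontier hU hUc hUb hh hlim hz) ?_
    have := re_nonpos_of_tendsto_frontier hU hUc hUb hh.fun_neg
      (fun t ht => by simpa using (hlim t ht).neg) hz
    simpa using this
  obtain ⟨z₀, hz₀⟩ := hne
  have hmax : IsMaxOn (norm ∘ fun x => Complex.exp (h x)) U z₀ := fun x hx => by
    simp [Complex.norm_exp, hre x hx, hre z₀ hz₀]
  have hexp := Complex.eqOn_of_isPreconnected_of_isMaxOn_norm hUc hU hh.cexp hz₀ hmax
  have hderiv : Set.EqOn (deriv h) 0 U := fun z hz => by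
    have hd := (hh.differentiableAt (hU.mem_nhds hz)).hasDerivAt
    have h1 : HasDerivAt (fun x => Complex.exp (h x)) 0 z :=
      (hasDerivAt_const z (Complex.exp (h z₀))).congr_of_eventuallyEq
        (Filter.mem_of_superset (hU.mem_nhds hz) fun x hx => hexp hx)
    have h2 := hd.cexp.unique h1
    simpa [Complex.exp_ne_zero] using h2
  refine ⟨(h z₀).im, fun z hz => ?_⟩
  rw [hU.is_const_of_deriv_eq_zero hUc hh hderiv hz hz₀]
  apply Complex.ext <;> simp [hre z₀ hz₀]

lemma isPreconnected_domain (hr0 : 0 < r) (hα : 1 / 2 ≤ α) : IsPreconnected (domain r α) := by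
  rw [← image_expMap hr0 hα]
  refine IsPreconnected.image ?_ _ (continuous_expMap α).continuousOn
  have hconv : Convex ℝ (rectDom (logWidth r α)) :=
    ((convex_Ioo (-logWidth r α) 0).linear_preimage Complex.reLm).inter
      ((convex_Ioo 0 Real.pi).linear_preimage Complex.imLm)
  exact hconv.isPreconnected

/-- Two solutions differ by an imaginary constant, which the normalization excludes. -/
theorem IsSolution.eqOn (hr0 : 0 < r) (hr1 : r < 1) (hα : 1 / 2 ≤ α) {f : ℂ → ℂ} {γ : ℂ → ℝ} {c : ℝ}
    {w₁ w₂ : ℂ → ℂ} (h₁ : IsSolution r α f γ c w₁) (h₂ : IsSolution r α f γ c w₂) {z : ℂ}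
    (hz : z ∈ domain r α) : w₁ z = w₂ z := by
  have hα0 : 0 < α := by linarith
  have hO := isOpen_domain (r := r) hr0 hα0
  have hd : DifferentiableOn ℂ (fun z => w₁ z - w₂ z) (domain r α) :=
    HasWeakDbar.differentiableOn hO (h₁.continuousOn.sub h₂.continuousOn)
      (h₁.equation.sub hO h₁.continuousOn h₂.continuousOn h₂.equation)
  have hb : Bornology.IsBounded (domain r α) :=
    (Metric.isBounded_ball (x := (0 : ℂ)) (r := 1)).subset fun z hz => by simpa using hz.2.1
  obtain ⟨C, hC⟩ := exists_eq_const_of_tendsto_frontier hO (isPreconnected_domain hr0 hα) hb ⟨z, hz⟩ hd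
    fun t ht => by simpa using (h₁.boundary t ht).sub (h₂.boundary t ht)
  obtain ⟨v₁, ⟨hv₁, hl₁⟩, hn₁⟩ := h₁.normalization
  obtain ⟨v₂, ⟨hv₂, hl₂⟩, hn₂⟩ := h₂.normalization
  set μ := volume.restrict (Set.Ioo 0 (Real.pi / α)) with hμ
  have hpt : ∀ s ∈ Set.Ioo r 1, ∀ τ ∈ Set.Ioo 0 (Real.pi / α), polarPt s τ ∈ domain r α := by
    intro s hs τ hτ
    have hs0 : 0 < s := hr0.trans hs.1
    rw [polarPt_eq hα0 hs0]
    refine expMap_mem hr0 hα ?_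
    have := add_mul_I_mem_rectDom (L := logWidth r α) (x := α * Real.log s) (θ := α * τ)
      (by rw [logWidth, neg_neg]; exact mul_lt_mul_of_pos_left (Real.log_lt_log hr0 hs.1) hα0)
      (mul_neg_of_pos_of_neg hα0 (Real.log_neg hs0 hs.2))
      ⟨mul_pos hα0 hτ.1, (lt_div_iff₀' hα0).mp hτ.2⟩
    convert! this using 1
    push_cast; ring
  have hmeas : ∀ w : ℂ → ℂ, ContinuousOn w (domain r α) → ∀ s ∈ Set.Ioo r 1,
      AEStronglyMeasurable (fun τ : ℝ => (w (polarPt s τ)).im) μ := by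
    intro w hw s hs
    refine ContinuousOn.aestronglyMeasurable (Complex.continuous_im.comp_continuousOn
      (hw.comp (Continuous.continuousOn ?_) fun τ hτ => hpt s hs τ hτ)) measurableSet_Ioo
    unfold polarPt; fun_prop
  -- the traces differ by the constant `C`
  have hzero : eLpNorm (fun τ => v₁ τ - v₂ τ - C) 1 μ = 0 := by
    have hsum := hl₁.add hl₂
    rw [add_zero] at hsum
    refine le_antisymm (ge_of_tendsto hsum ?_) zero_le
    filter_upwards [Ioo_mem_nhdsLT hr1] with s hs
    have e : ∀ᵐ τ ∂μ, v₁ τ - v₂ τ - C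
        = ((fun τ : ℝ => (w₂ (polarPt s τ)).im - v₂ τ)
          - fun τ : ℝ => (w₁ (polarPt s τ)).im - v₁ τ) τ := by
      refine (ae_restrict_iff' measurableSet_Ioo).mpr (ae_of_all _ fun τ hτ => ?_)
      have h3 := congrArg Complex.im (hC _ (hpt s hs τ hτ))
      simp only [Complex.sub_im, Complex.mul_im, Complex.ofReal_re, Complex.I_im, mul_one,
        Complex.ofReal_im, zero_mul, add_zero] at h3
      simp only [Pi.sub_apply]
      linarith
    rw [eLpNorm_congr_ae e, add_comm]
    exact eLpNorm_sub_le ((hmeas w₂ h₂.continuousOn s hs).sub hv₂.1)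
      ((hmeas w₁ h₁.continuousOn s hs).sub hv₁.1) le_rfl
  have hm : AEStronglyMeasurable (fun τ => v₁ τ - v₂ τ - C) μ :=
    (hv₁.1.sub hv₂.1).sub aestronglyMeasurable_const
  have hae : (fun τ => v₁ τ - v₂ τ - C) =ᵐ[μ] 0 := (eLpNorm_eq_zero_iff hm one_ne_zero).mp hzero
  have hint : ∫ τ, (v₁ τ - v₂ τ) ∂μ = C * (Real.pi / α) := by
    have : ∫ τ, (v₁ τ - v₂ τ) ∂μ = ∫ _, C ∂μ := integral_congr_ae (by
      filter_upwards [hae] with τ hτ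
      simp only [Pi.zero_apply] at hτ
      linarith)
    rw [this, hμ, setIntegral_const, Measure.real, Real.volume_Ioo, sub_zero,
      ENNReal.toReal_ofReal (by positivity), smul_eq_mul, mul_comm]
  rw [integral_sub hv₁ hv₂] at hint
  rw [normalization_eq hα0] at hn₁ hn₂
  have hn₁' := Complex.ofReal_injective hn₁
  have hn₂' := Complex.ofReal_injective hn₂
  -- the normalization compares the means of the traces
  have hC0 : C = 0 := by
    have hπ := Real.pi_pos
    have : α / Real.pi * (C * (Real.pi / α)) = 0 := by
      rw [← hint, mul_sub, hn₁', hn₂', sub_self]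
    field_simp at this
    exact this
  have := hC z hz
  rw [hC0, Complex.ofReal_zero, zero_mul] at this
  exact sub_eq_zero.mp this

/-- The explicit formula solves the problem. -/
theorem isSolution_formula (hr0 : 0 < r) (hr1 : r < 1) (hα : 1 / 2 ≤ α) {p : ℝ≥0∞} (hp : 2 < p)
    {f : ℂ → ℂ} (hf : MemLp f p (volume.restrict (domain r α))) {γ : ℂ → ℝ}
    (hγ : ContinuousOn γ (frontier (domain r α))) (c : ℝ) :
    IsSolution r α f γ c (formula r α f γ c) := by
  have hα0 : 0 < α := by linarith
  set L := logWidth r α with hL_def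
  have hL : 0 < L := logWidth_pos hr0 hr1 hα0
  have hF := memLp_pullRhs hr0 hα hf
  set g : ℂ → ℝ := fun v => γ (expMap α v) with hg_def
  have hg : ContinuousOn g (rectBdry L) := continuousOn_comp_expMap hr0 hr1 hα hγ
  set A := areaPot L (pullRhs α f) with hA_def
  have hA : ContinuousOn A (rectClosed L) := continuousOn_areaPot hL hp hF
  have hB := differentiableOn_bdOp hL hg
  set W : ℂ → ℂ := fun u => bdOp L g u + Complex.I * c + A u with hW_def
  have hwW : ∀ u ∈ rectDom L, formula r α f γ c (expMap α u) = W u := fun u hu =>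
    formula_expMap hr0 hr1 hα f hγ c hu
  have hwz : ∀ z ∈ domain r α, formula r α f γ c z = W (logMap α z) := fun z hz => by
    rw [← hwW _ (logMap_mem hr0 hα0 hz), expMap_logMap hα0 (ne_zero_of_mem_domain hr0 hz)]
  have hBc : DifferentiableOn ℂ (fun u => bdOp L g u + Complex.I * c) (rectDom L) := hB.add_const _
  have hWc : ContinuousOn W (rectDom L) := hBc.continuousOn.add (hA.mono (rectDom_subset L))
  refine ⟨?_, ?_, ?_, ?_⟩
  · exact (hWc.comp (continuousOn_logMap r α) fun z hz => logMap_mem hr0 hα0 hz).congr hwz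
  · exact hasWeakDbar_of_pullback hr0 hα hwW
      ((hasWeakDbar_areaPot hL hp hF).add_differentiableOn (isOpen_rectDom L) hBc
        (hA.mono (rectDom_subset L)))
  · intro t ht
    have h := tendsto_comp_logMap hr0 hα (Φ := fun u => (W u).re) (γ := γ) (fun v hv => by
      have h1 := tendsto_re_bdOp hL hg hv
      have h2 : Tendsto (fun u => (A u).re) (𝓝[rectDom L] v) (𝓝 (A v).re) :=
        (Complex.continuous_re.continuousAt.tendsto.comp (hA v hv.1)).mono_left
          (nhdsWithin_mono v (rectDom_subset L))
      rw [hA_def, areaPot_re_eq_zero hL _ hv.1 hv.2] at h2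
      simpa [hW_def] using h1.add h2) ht
    refine h.congr' ?_
    filter_upwards [self_mem_nhdsWithin] with z hz
    rw [hwz z hz]
  · obtain ⟨v, hv, hlim, hint⟩ := exists_trace_bdOp hL hg
    have hAm := memLp_im_right hL hA
    have hAlim := tendsto_eLpNorm_im_of_continuousOn hL hA
    set μ := volume.restrict (Set.Ioo 0 Real.pi) with hμ
    set vW : ℝ → ℝ := fun θ => (v θ + (A (θ * Complex.I)).im) + c with hvW
    have hAi := memLp_one_iff_integrable.mp hAm
    have hci : Integrable (fun _ : ℝ => c) μ := integrable_const _
    have hvWi : IntegrableOn vW (Set.Ioo 0 Real.pi) := (hv.add hAi).add hci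
    have hWlim : Tendsto (fun x : ℝ => eLpNorm (fun θ : ℝ => (W (x + θ * Complex.I)).im - vW θ) 1 μ)
        (𝓝[<] 0) (𝓝 0) := by
      have hsum := hlim.add hAlim
      rw [add_zero] at hsum
      refine tendsto_of_tendsto_of_tendsto_of_le_of_le' tendsto_const_nhds hsum
        (Eventually.of_forall fun _ => zero_le) ?_
      filter_upwards [eventually_nhdsLT_zero (neg_lt_zero.mpr hL)] with x hx
      have h1 := eLpNorm_add_le
        ((aestronglyMeasurable_im_vertical hB.continuousOn hx.1 hx.2).sub hv.1)
        ((aestronglyMeasurable_im_vertical (hA.mono (rectDom_subset L)) hx.1 hx.2).sub hAm.1)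
        (le_refl (1 : ℝ≥0∞))
      refine le_trans (le_of_eq ?_) h1
      congr 1
      ext θ
      simp [hW_def, hvW]
      ring
    refine ⟨fun τ => vW (α * τ), isImTrace_of_rect hr0 hr1 hα0 hwW hvWi hWlim, ?_⟩
    rw [normalization_eq hα0]
    norm_cast
    have hcov : ∫ τ in Set.Ioo 0 Real.pi, vW τ = α * ∫ τ in Set.Ioo 0 (Real.pi / α), vW (α * τ) := by
      rw [← image_mul_Ioo hα0, integral_image_eq_integral_abs_deriv_smul measurableSet_Ioo
        (fun x _ => hasDerivWithinAt_mul _ x) (fun x _ y _ h => mul_left_cancel₀ hα0.ne' h),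
        integral_smul, abs_of_pos hα0, smul_eq_mul]
    have hAint : ∫ θ in Set.Ioo 0 Real.pi, (A (θ * Complex.I)).im = 0 := by
      have h0 := integral_areaPot hL hp hF
      have hI : IntervalIntegrable (fun y : ℝ => A (y * Complex.I)) volume 0 Real.pi :=
        (intervalIntegrable_sides hL (hA.mono Set.sdiff_subset)).2.2.1
      have h1 := Complex.imCLM.intervalIntegral_comp_comm hI
      simp only [Complex.imCLM_apply] at h1
      rw [hA_def, h0, Complex.zero_im, intervalIntegral.integral_of_le Real.pi_pos.le,
        integral_Ioc_eq_integral_Ioo] at h1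
      exact h1
    have htot : ∫ τ in Set.Ioo 0 Real.pi, vW τ = Real.pi * c := by
      have hvA : Integrable (fun θ : ℝ => v θ + (A (θ * Complex.I)).im) μ := hv.add hAi
      simp only [hvW]
      rw [integral_add hvA hci, integral_add hv hAi, hint, hAint, setIntegral_const,
        Measure.real, Real.volume_Ioo, sub_zero, ENNReal.toReal_ofReal Real.pi_pos.le, smul_eq_mul]
      ring
    have hπ := Real.pi_pos
    rw [div_mul_eq_mul_div, ← hcov, htot, mul_div_cancel_left₀ _ hπ.ne']

end

end SectorRing

end

theorem theorem2p2 (r α : ℝ) (hr0 : 0 < r) (hr1 : r < 1) (hα : 1 / 2 ≤ α)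
    (p : ℝ≥0∞) (hp : 2 < p)
    (f : ℂ → ℂ) (hf : MemLp f p (volume.restrict (SectorRing.domain r α)))
    (γ : ℂ → ℝ) (hγ : ContinuousOn γ (frontier (SectorRing.domain r α)))
    (c : ℝ) :
    (∀ z ∈ SectorRing.domain r α, SectorRing.FormulaConverges r α f γ z) ∧
    SectorRing.IsSolution r α f γ c (SectorRing.formula r α f γ c) ∧
    (∀ w : ℂ → ℂ, SectorRing.IsSolution r α f γ c w →
      ∀ z ∈ SectorRing.domain r α, w z = SectorRing.formula r α f γ c z) :=
  ⟨fun _ hz => SectorRing.formulaConverges hr0 hr1 hα hp hf hγ hz,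
    SectorRing.isSolution_formula hr0 hr1 hα hp hf hγ c,
    fun _ hw _ hz => hw.eqOn hr0 hr1 hα (SectorRing.isSolution_formula hr0 hr1 hα hp hf hγ c) hz⟩
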